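/- **Setting.** Let $\mathbf C\in\mathbb R^{n\times m}$ have full column rank, let $\mathbf d\in\mathbb R^n$, assume $\min_{x}\|\mathbf Cx-\mathbf d\|_\infty=1$, and let $0<\epsilon<1/2$. Put $\widetilde{\mathbf C}=\begin{bmatrix}\mathbf C\\-\mathbf C\end{bmatrix}$, $\widetilde{\mathbf d}=\begin{bmatrix}\mathbf d\\-\mathbf d\end{bmatrix}$; vectors indexed by $e$ have $2n$ coordinates, and products of such vectors are coordinatewise. Let $\eta\le 1/10$ be real, let $C_3\ge2$ be a constant, and put $$\alpha=\ell_\alpha(n)\,n^{-1/2+\eta}\epsilon,\quad \tau=\ell_\tau(n)\,n^{1/2-\eta}\epsilon^{-4},\quad \rho=\ell_\rho(n)\,n^{1/2-3\eta}\epsilon^{-2},\quad \delta=\epsilon/100,$$ $$T=\lceil\alpha^{-1}\epsilon^{-2}\ln n\rceil,\qquad b=\lceil \ell_b(n)\,n^{1/2+\eta}\epsilon^{-2}\rceil .$$ Write $\Phi(w)=\|w\|_1$, let $\log$ denote $\log_2$, and let $\lfloor\log n\rfloor$ be the top level. **Algorithm.** Let $S^{(0)},\dots,S^{(T-1)}\in\mathbb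 R^{b\times 2n}$ be random matrices whose entries are independent and uniform on $\{\pm1/\sqrt b\}$. Start with $i=k=0$, $w=\mathbf 1$, $\bar r=r=(1+\epsilon)\mathbf 1$, $x=0$, $r^{(0)}=r$. While $i<T$, do one *iteration*: let $\bar R=\mathrm{diag}(\bar r)$, $\Delta=(\widetilde{\mathbf C}^\top\bar R\widetilde{\mathbf C})^{-1}\widetilde{\mathbf C}^\top\bar R\,\widetilde{\mathbf d}$, $u=\widetilde{\mathbf C}\Delta-\widetilde{\mathbf d}$, $\Psi=\sum_e\bar r_eu_e^2$. * *Primal step*, if $\sum_e\bar r_e|u_e|^3\le C_3\rho\Psi$. Let $\hat u=\bar R^{-1/2}(S^{(i)})^\top S^{(i)}\bar R^{1/2}u$, and let $\vec\alpha_e=\alpha(1+\epsilon\alpha\hat u_e)$ if $\hat u_e\ge0$ and $\vec\alpha_e=\alpha/(1-\epsilon\alpha\hat u_e)$ otherwise. Set $w\leftarrow w(1+\epsilon\vec\alpha\hat u)$, $r\leftarrow w+\frac{\epsilon}{2n}\sum_ew_e$ (using the new $w$), $x\leftarrow x+\Delta$, $i\leftarrow i+1$, and store $r^{(i)}=r$.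 Then (SelectVector) put $\bar r_e\leftarrow r_e$ for all $e$ if $2^{\lfloor\log n\rfloor}$ divides $i$; otherwise do so for those $e$ for which there is an integer $0\le l<\lfloor\log n\rfloor$ such that $2^l$ divides $i$, $|\ln(r^{(i)}_e/r^{(i-2^l)}_e)|\ge\delta/(2\log n)$, and every width reduction step that updated $e$ so far was executed at a primal index at most $i-2^l$. * *Width reduction step*, otherwise. Let $S=\{e:|u_e|\ge\rho/(2C_3)\}$ and let $H\subseteq S$ be an inclusion-maximal subset with $\sum_{e\in H}\bar r_e\le\tau^{-1}\Psi$. If $H\ne S$, pick any $\bar e\in S\setminus H$ and let $G=H\cup\{\bar e\}$. If $H=S$, go through $\zeta=\rho,2\rho,4\rho,\dots,2^{c}\rho$, where $c$ is the least natural number with $2^{c}\rho\ge\sqrt{n/\epsilon}$, and let $G=H_\zeta:=\{e\in H:\zeta\le|u_e|<2\zeta\}$ for the first $\zeta$ with $\sum_{e\in H_\zeta}\bar r_e|u_e|^3\ge\rho\Psi/\log(n/(\epsilon\rho))$ (and $G=\emptyset$ if there is none). For $e\in G$ set $w_e\leftarrow(1+\epsilon)w_e+\frac{\epsilon^2}{2n}\Phi(w)$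 (with the old $\Phi(w)$); then $r\leftarrow w+\frac{\epsilon}{2n}\Phi(w)$ (with the new $w$), $\bar r_e\leftarrow r_e$ for $e\in G$, and $k\leftarrow k+1$. Return $\hat x=x/T$. The choices of $H$ and $\bar e$ may be made by an arbitrary fixed rule that depends on the current state of the algorithm (the values of $i$, $k$, $w$, $r$, $\bar r$, $x$, the stored vectors $r^{(j)}$, and the last width reduction index of every coordinate). **Theorem.** For every $C_3\ge2$ there are functions $\ell_\alpha,\ell_\tau,\ell_\rho,\ell_b$, each bounded above and below by $A_0(1+\ln n)^{p_0}$ and $A_0^{-1}(1+\ln n)^{-p_0}$ for some constants $A_0>0$, $p_0\in\mathbb N$ and all $n\ge1$, and constants $M,A\in\mathbb R$, $p,q\in\mathbb N$, such that for all $\eta\le1/10$, all $n,m$, all $\mathbf C,\mathbf d,\epsilon$ as above and every such rule, the following hold together with probability at least $1-1/n^3$. The algorithm stops after $T+K$ iterations, where $K<\infty$ is its number of width reduction steps, and * $T+K\le A(1+\ln n)^p\,n^{1/2-\eta}\epsilon^{-4}$; * $\|\mathbf C\hat x-\mathbf d\|_\infty\le1+M\epsilon$; * in every width reduction step the set $S$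 of large coordinates has at most $A(1+\ln n)^p\,n^{1/2+\eta}$ elements; * for every integer $l\ge0$, the number of iterations in which $\mathrm{diag}(\bar r)$ receives an update of rank at least $A(1+\ln n)^p\epsilon^{-q}\,n^{1/5}2^{2l}$ is at most $(T+K)/2^{l}$. -/

import Mathlib

open scoped Matrix

namespace NonMonotoneMWU

/-- The coordinates of the doubled system: `Sum.inl e` is row `e` of `C`, and
`Sum.inr e` is row `e` of `-C`. -/
abbrev Coord (n : ℕ) := Fin n ⊕ Fin n

/-- The input of the algorithm together with its numerical parameters. -/
structure Params (n m : ℕ) where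
  C : Matrix (Fin n) (Fin m) ℝ
  d : Fin n → ℝ
  ε : ℝ
  α : ℝ
  τ : ℝ
  ρ : ℝ
  δ : ℝ
  C₃ : ℝ
  T : ℕ
  b : ℕ

/-- The parameter setting of the algorithm; `lα`, `lτ`, `lρ`, `lb` are the polylogarithmic
factors hidden in the soft-Theta notation. -/
noncomputable def params {n m : ℕ} (C : Matrix (Fin n) (Fin m) ℝ) (d : Fin n → ℝ)
    (ε η C₃ : ℝ) (lα lτ lρ lb : ℕ → ℝ) : Params n m where
  C := C
  d := d
  ε := ε
  α := lα n * (n : ℝ) ^ (-(1 / 2 : ℝ) + η) * ε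
  τ := lτ n * (n : ℝ) ^ ((1 / 2 : ℝ) - η) * (1 / ε ^ 4)
  ρ := lρ n * (n : ℝ) ^ ((1 / 2 : ℝ) - 3 * η) * (1 / ε ^ 2)
  δ := ε / 100
  C₃ := C₃
  T := ⌈(lα n * (n : ℝ) ^ (-(1 / 2 : ℝ) + η) * ε)⁻¹ * (1 / ε ^ 2) * Real.log n⌉₊
  b := ⌈lb n * (n : ℝ) ^ ((1 / 2 : ℝ) + η) * (1 / ε ^ 2)⌉₊

/-- The state of the algorithm after `i` primal steps and `k` width reduction steps.
`rHist j` is the vector `r` that was handed to `SelectVector` when the `j`-th primal step was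
completed (`rHist 0` is the initial `r`), and `lastWidth e` is the largest primal index during
which a width reduction step has updated coordinate `e` (`none` if there was no such step). -/
structure State (n m : ℕ) where
  i : ℕ
  k : ℕ
  w : Coord n → ℝ
  r : Coord n → ℝ
  rbar : Coord n → ℝ
  x : Fin m → ℝ
  rHist : ℕ → Coord n → ℝ
  lastWidth : Coord n → Option ℕ

variable {n m : ℕ}

/-- The initial state. -/
noncomputable def init (P : Params n m) : State n m where
  i := 0
  k := 0
  w := fun _ => 1
  r := fun _ => 1 + P.ε
  rbar := fun _ => 1 + P.ε
  x := 0
  rHist := fun _ _ => 1 + P.ε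
  lastWidth := fun _ => none

/-- The doubled matrix, `C` stacked on `-C`. -/
def Ct (P : Params n m) : Matrix (Coord n) (Fin m) ℝ := Matrix.fromRows P.C (-P.C)

/-- The doubled right-hand side, `d` stacked on `-d`. -/
def dt (P : Params n m) : Coord n → ℝ := Sum.elim P.d (-P.d)

/-- The weighted least squares solution `Δ = (Cᵀ R C)⁻¹ Cᵀ R d` of the doubled system, where `R`
is the diagonal matrix of `rbar`. -/
noncomputable def stepDir (P : Params n m) (st : State n m) : Fin m → ℝ :=
  (((Ct P)ᵀ * Matrix.diagonal st.rbar * Ct P)⁻¹ * (Ct P)ᵀ * Matrix.diagonal st.rbar) *ᵥ dt P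

/-- The residual vector `u` of the least squares solution. -/
noncomputable def resid (P : Params n m) (st : State n m) : Coord n → ℝ :=
  Ct P *ᵥ stepDir P st - dt P

/-- The potential `Ψ(rbar)`. -/
noncomputable def psi (P : Params n m) (st : State n m) : ℝ :=
  ∑ e, st.rbar e * resid P st e ^ 2

/-- The potential `Φ(w) = ‖w‖₁`. -/
def phi (w : Coord n → ℝ) : ℝ := ∑ e, |w e|

/-- The sketched residual `R^{-1/2} Sᵀ S R^{1/2} u`. -/
noncomputable def sketchedResid (P : Params n m) (sk : Matrix (Fin P.b) (Coord n) ℝ)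
    (st : State n m) : Coord n → ℝ :=
  fun e => (√(st.rbar e))⁻¹ *
    ((skᵀ * sk) *ᵥ (fun f => √(st.rbar f) * resid P st f)) e

/-- The test that decides whether the next step is a primal step. -/
def PrimalTest (P : Params n m) (st : State n m) : Prop :=
  ∑ e, st.rbar e * |resid P st e| ^ 3 ≤ P.C₃ * P.ρ * psi P st

open Classical in
/-- `SelectVector` at primal index `i ≥ 1` with new vector `r`, lazy vector `rbar`, and history
`rHist`: the levels are `ℓ = 0, 1, …, ⌊log₂ n⌋`, and the top level refreshes every coordinate. -/
noncomputable def selectVector (δ : ℝ) (i : ℕ) (rHist : ℕ → Coord n → ℝ)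
    (lastWidth : Coord n → Option ℕ) (r rbar : Coord n → ℝ) : Coord n → ℝ :=
  fun e =>
    if 2 ^ Nat.log 2 n ∣ i ∨
        ∃ l < Nat.log 2 n, 2 ^ l ∣ i ∧
          δ / (2 * Real.logb 2 n) ≤ |Real.log (r e / rHist (i - 2 ^ l) e)| ∧
          ∀ j ∈ lastWidth e, j + 2 ^ l ≤ i
    then r e else rbar e

/-- The coordinatewise step size of a primal step, for a value `v` of the sketched residual. -/
noncomputable def stepSize (P : Params n m) (v : ℝ) : ℝ :=
  if 0 ≤ v then P.α * (1 + P.ε * P.α * v) else P.α / (1 - P.ε * P.α * v)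

/-- The weights after a primal step. -/
noncomputable def primalW (P : Params n m) (sk : Matrix (Fin P.b) (Coord n) ℝ)
    (st : State n m) : Coord n → ℝ :=
  fun e => st.w e *
    (1 + P.ε * stepSize P (sketchedResid P sk st e) * sketchedResid P sk st e)

/-- The vector `r` after a primal step. -/
noncomputable def primalR (P : Params n m) (sk : Matrix (Fin P.b) (Coord n) ℝ)
    (st : State n m) : Coord n → ℝ :=
  fun e => primalW P sk st e + P.ε / (2 * n) * ∑ f, primalW P sk st f

/-- A primal step with sketching matrix `sk`. -/
noncomputable def primalStep (P : Params n m) (sk : Matrix (Fin P.b) (Coord n) ℝ)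
    (st : State n m) : State n m where
  i := st.i + 1
  k := st.k
  w := primalW P sk st
  r := primalR P sk st
  rbar := selectVector P.δ (st.i + 1) st.rHist st.lastWidth (primalR P sk st) st.rbar
  x := st.x + stepDir P st
  rHist := Function.update st.rHist (st.i + 1) (primalR P sk st)
  lastWidth := st.lastWidth

open Classical in
/-- The set `S` of large coordinates of a width reduction step. -/
noncomputable def large (P : Params n m) (st : State n m) : Finset (Coord n) :=
  Finset.univ.filter fun e => P.ρ / (2 * P.C₃) ≤ |resid P st e|

/-- How the two free choices of a width reduction step are made: the maximal subset `H ⊆ S`, and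
the coordinate in `S \ H`. -/
structure Rule (n m : ℕ) where
  H : State n m → Finset (Coord n)
  ebar : State n m → Coord n

/-- The rule obeys the algorithm: `H` is an inclusion-maximal subset of `S` whose total weight is
at most `Ψ / τ`, and `ebar` is in `S \ H` whenever `H ≠ S`.  (For the states of a genuine run,
`Ψ ≥ 0`.) -/
def Rule.Valid (P : Params n m) (rule : Rule n m) : Prop :=
  ∀ st : State n m, 0 ≤ psi P st →
    Maximal (fun H : Finset (Coord n) =>
      H ⊆ large P st ∧ ∑ e ∈ H, st.rbar e ≤ P.τ⁻¹ * psi P st) (rule.H st) ∧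
    (rule.H st ≠ large P st → rule.ebar st ∈ large P st ∧ rule.ebar st ∉ rule.H st)

/-- The least natural number `c` with `2 ^ c * ρ ≥ √(n / ε)`. -/
noncomputable def cRho (P : Params n m) : ℕ := sInf {c : ℕ | √(n / P.ε) ≤ 2 ^ c * P.ρ}

open Classical in
/-- The set `H_ζ` for `ζ = 2 ^ j * ρ`. -/
noncomputable def bucket (P : Params n m) (H : Finset (Coord n)) (st : State n m) (j : ℕ) :
    Finset (Coord n) :=
  H.filter fun e => 2 ^ j * P.ρ ≤ |resid P st e| ∧ |resid P st e| < 2 * (2 ^ j * P.ρ)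

/-- The search loop over `ζ` can stop at `ζ = 2 ^ j * ρ`. -/
def Hit (P : Params n m) (H : Finset (Coord n)) (st : State n m) (j : ℕ) : Prop :=
  j ≤ cRho P ∧
    P.ρ * psi P st / Real.logb 2 (n / (P.ε * P.ρ)) ≤
      ∑ e ∈ bucket P H st j, st.rbar e * |resid P st e| ^ 3

open Classical in
/-- The set of coordinates whose weights a width reduction step updates: `H ∪ {ebar}` if `H ≠ S`,
and otherwise `H_ζ` for the first `ζ` at which the search loop stops. -/
noncomputable def widthSet (P : Params n m) (rule : Rule n m) (st : State n m) :
    Finset (Coord n) :=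
  if rule.H st ≠ large P st then insert (rule.ebar st) (rule.H st)
  else if ∃ j, Hit P (rule.H st) st j then bucket P (rule.H st) st (sInf {j | Hit P (rule.H st) st j})
  else ∅

open Classical in
/-- The weights after a width reduction step. -/
noncomputable def widthW (P : Params n m) (rule : Rule n m) (st : State n m) : Coord n → ℝ :=
  fun e => if e ∈ widthSet P rule st
    then (1 + P.ε) * st.w e + P.ε ^ 2 / (2 * n) * phi st.w else st.w e

/-- The vector `r` after a width reduction step. -/
noncomputable def widthR (P : Params n m) (rule : Rule n m) (st : State n m) : Coord n → ℝ :=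
  fun e => widthW P rule st e + P.ε / (2 * n) * phi (widthW P rule st)

open Classical in
/-- A width reduction step. -/
noncomputable def widthStep (P : Params n m) (rule : Rule n m) (st : State n m) : State n m where
  i := st.i
  k := st.k + 1
  w := widthW P rule st
  r := widthR P rule st
  rbar := fun e => if e ∈ widthSet P rule st then widthR P rule st e else st.rbar e
  x := st.x
  rHist := st.rHist
  lastWidth := fun e => if e ∈ widthSet P rule st then some st.i else st.lastWidth e

open Classical in
/-- One iteration of the main loop; nothing happens once `T` primal steps are complete. (If the
primal test fails then the test of the second branch holds, as `C₃ ≥ 1`.) -/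
noncomputable def step (P : Params n m) (rule : Rule n m) (sk : Matrix (Fin P.b) (Coord n) ℝ)
    (st : State n m) : State n m :=
  if st.i < P.T then
    if PrimalTest P st then primalStep P sk st else widthStep P rule st
  else st

/-- The sample space: the signs of the entries of the `T` sketching matrices. -/
abbrev Signs (P : Params n m) := Fin P.T → Fin P.b → Coord n → Bool

/-- The `i`-th sketching matrix, of size `b × 2n`, with entries `±1/√b`. -/
noncomputable def sketch (P : Params n m) (s : Signs P) (i : ℕ) :
    Matrix (Fin P.b) (Coord n) ℝ :=
  if h : i < P.T then Matrix.of fun a e => (if s ⟨i, h⟩ a e then 1 else -1) / √(P.b : ℝ)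
  else 0

/-- The state after `t` iterations (of either kind). -/
noncomputable def run (P : Params n m) (rule : Rule n m) (s : Signs P) (t : ℕ) : State n m :=
  (fun st => step P rule (sketch P s st.i) st)^[t] (init P)

/-- The rank of the update that the diagonal matrix of `rbar` receives in iteration `t`. -/
noncomputable def updateRank (P : Params n m) (rule : Rule n m) (s : Signs P) (t : ℕ) : ℕ :=
  (Matrix.diagonal (run P rule s (t + 1)).rbar - Matrix.diagonal (run P rule s t).rbar).rank

open Classical in
/-- The probability of an event when all signs are independent and uniform. -/
noncomputable def signProb (P : Params n m) (E : Signs P → Prop) : ℝ :=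
  ((Finset.univ.filter E).card : ℝ) / (Fintype.card (Signs P) : ℝ)

/-- `l` is bounded above and below by powers of `log n`, that is, `l(n)` is soft-Theta of `1`. -/
def IsPolylogFactor (l : ℕ → ℝ) : Prop :=
  ∃ (A : ℝ) (p : ℕ), 0 < A ∧ ∀ n : ℕ, 1 ≤ n →
    A⁻¹ / (1 + Real.log n) ^ p ≤ l n ∧ l n ≤ A * (1 + Real.log n) ^ p

open Classical in
/-- The guarantees of a run whose sketches have signs `s`: after `T + K` iterations, of which `K`
are width reduction steps, all `T` primal steps are complete, and
* `T + K ≤ A (1 + log n)^p n^(1/2-η) ε^(-4)`;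
* the returned vector `x / T` has error at most `1 + M ε`;
* every width reduction step has at most `A (1 + log n)^p n^(1/2+η)` large coordinates;
* for every `l`, at most `(T + K) / 2^l` iterations update `rbar` with a rank as large as
  `A (1 + log n)^p ε^(-q) n^(1/5) 2^(2l)`. -/
def Guarantees (P : Params n m) (rule : Rule n m) (s : Signs P) (η M A : ℝ) (p q : ℕ) : Prop :=
  ∃ K : ℕ,
    (run P rule s (P.T + K)).i = P.T ∧ (run P rule s (P.T + K)).k = K ∧
    ((P.T + K : ℕ) : ℝ) ≤
      A * (1 + Real.log n) ^ p * (n : ℝ) ^ ((1 / 2 : ℝ) - η) * (1 / P.ε ^ 4) ∧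
    ‖P.C *ᵥ ((P.T : ℝ)⁻¹ • (run P rule s (P.T + K)).x) - P.d‖ ≤ 1 + M * P.ε ∧
    (∀ t < P.T + K, ¬ PrimalTest P (run P rule s t) →
      ((large P (run P rule s t)).card : ℝ) ≤
        A * (1 + Real.log n) ^ p * (n : ℝ) ^ ((1 / 2 : ℝ) + η)) ∧
    ∀ l : ℕ,
      (((Finset.range (P.T + K)).filter fun t =>
          A * (1 + Real.log n) ^ p * (1 / P.ε ^ q) * (n : ℝ) ^ (1 / 5 : ℝ) * 2 ^ (2 * l) ≤
            (updateRank P rule s t : ℝ)).card : ℝ) ≤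
        ((P.T + K : ℕ) : ℝ) / 2 ^ l

end NonMonotoneMWU

open scoped Matrix
namespace NonMonotoneMWU
variable {n m : ℕ}

section Abstract

variable {S Ω : Type*} [Fintype S] [Fintype Ω]

/-- Averaging over the resampled point is averaging over the sample space. -/
theorem sum_resample (R : S × Ω → S × Ω) (hR : Function.Involutive R) (F : S → ℝ) :
    ∑ s, ∑ ω, F (R (s, ω)).1 = Fintype.card Ω * ∑ s, F s := by
  rw [← Fintype.sum_prod_type' (fun s ω => F (R (s, ω)).1)]
  refine (Equiv.sum_comp hR.toPerm (fun p : S × Ω => F p.1)).trans ?_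
  rw [Fintype.sum_prod_type]
  simp [Finset.mul_sum]

theorem sum_exp_le [Nonempty Ω] (R : ℕ → S × Ω → S × Ω) (hR : ∀ t, Function.Involutive (R t))
    (f : ℕ → S → ℝ) (hpast : ∀ t, ∀ t' < t, ∀ s ω, f t' (R t (s, ω)).1 = f t' s)
    (hexp : ∀ t s, ∑ ω, Real.exp (f t (R t (s, ω)).1) ≤ Fintype.card Ω) (N : ℕ) :
    ∑ s, Real.exp (∑ t ∈ Finset.range N, f t s) ≤ Fintype.card S := by
  induction N with
  | zero => simp
  | succ N ih =>
    refine le_trans ?_ ih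
    have hc : (0 : ℝ) < Fintype.card Ω := by exact_mod_cast Fintype.card_pos
    refine le_of_mul_le_mul_left ?_ hc
    rw [← sum_resample (R N) (hR N), Finset.mul_sum]
    refine Finset.sum_le_sum fun s _ => ?_
    have : ∀ ω, Real.exp (∑ t ∈ Finset.range (N + 1), f t (R N (s, ω)).1) =
        Real.exp (∑ t ∈ Finset.range N, f t s) * Real.exp (f N (R N (s, ω)).1) := by
      intro ω
      rw [Finset.sum_range_succ, Real.exp_add,
        Finset.sum_congr rfl fun t ht => hpast N t (Finset.mem_range.1 ht) s ω]
    simp_rw [this]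
    rw [← Finset.mul_sum, mul_comm]
    exact mul_le_mul_of_nonneg_right (hexp N s) (Real.exp_pos _).le

open Classical in
theorem card_le_of_exp {F : S → ℝ} (hF : ∑ s, Real.exp (F s) ≤ Fintype.card S) (a : ℝ) :
    ((Finset.univ.filter fun s => a ≤ F s).card : ℝ) ≤ Real.exp (-a) * Fintype.card S := by
  have h1 : ((Finset.univ.filter fun s => a ≤ F s).card : ℝ) * Real.exp a ≤
      ∑ s, Real.exp (F s) := by
    rw [← nsmul_eq_mul]
    refine le_trans (Finset.card_nsmul_le_sum _ (fun s => Real.exp (F s)) _ ?_)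
      (Finset.sum_le_sum_of_subset_of_nonneg (Finset.filter_subset _ _)
        fun _ _ _ => (Real.exp_pos _).le)
    intro s hs
    exact Real.exp_le_exp.2 (Finset.mem_filter.1 hs).2
  have h2 := h1.trans hF
  rw [Real.exp_neg, inv_mul_eq_div, le_div_iff₀ (Real.exp_pos a)]
  exact h2

open Classical in
/-- The maximal inequality for exponential supermartingales. -/
theorem card_exists_sum_ge_le [Nonempty Ω] (R : ℕ → S × Ω → S × Ω)
    (hR : ∀ t, Function.Involutive (R t))
    (f : ℕ → S → ℝ) (hpast : ∀ t, ∀ t' < t, ∀ s ω, f t' (R t (s, ω)).1 = f t' s)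
    (hexp : ∀ t s, ∑ ω, Real.exp (f t (R t (s, ω)).1) ≤ Fintype.card Ω) (N : ℕ) (a : ℝ) :
    ((Finset.univ.filter fun s => ∃ t ≤ N, a ≤ ∑ t' ∈ Finset.range t, f t' s).card : ℝ) ≤
      Real.exp (-a) * Fintype.card S := by
  set g : ℕ → S → ℝ := fun t s =>
    if ∀ t₀ ≤ t, ∑ t' ∈ Finset.range t₀, f t' s < a then f t s else 0 with hg
  have hsum : ∀ t, ∀ t₀ ≤ t, ∀ s ω, ∑ t' ∈ Finset.range t₀, f t' (R t (s, ω)).1 =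
      ∑ t' ∈ Finset.range t₀, f t' s := by
    intro t t₀ ht₀ s ω
    refine Finset.sum_congr rfl fun t' ht' => ?_
    exact hpast t t' (lt_of_lt_of_le (Finset.mem_range.1 ht') ht₀) s ω
  have hcond : ∀ t, ∀ t' ≤ t, ∀ s ω,
      (∀ t₀ ≤ t', ∑ t'' ∈ Finset.range t₀, f t'' (R t (s, ω)).1 < a) ↔
      (∀ t₀ ≤ t', ∑ t'' ∈ Finset.range t₀, f t'' s < a) := by
    intro t t' ht' s ω
    refine forall_congr' fun t₀ => forall_congr' fun h => ?_
    rw [hsum t t₀ (h.trans ht')]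
  have hgpast : ∀ t, ∀ t' < t, ∀ s ω, g t' (R t (s, ω)).1 = g t' s := by
    intro t t' ht' s ω
    simp only [hg, hcond t t' ht'.le, hpast t t' ht']
  have hgexp : ∀ t s, ∑ ω, Real.exp (g t (R t (s, ω)).1) ≤ Fintype.card Ω := by
    intro t s
    by_cases h : ∀ t₀ ≤ t, ∑ t' ∈ Finset.range t₀, f t' s < a
    · simp only [hg, hcond t t le_rfl]
      simpa only [if_pos h] using hexp t s
    · simp only [hg, hcond t t le_rfl]
      simp [if_neg h]
  refine le_trans ?_ (card_le_of_exp (sum_exp_le R hR g hgpast hgexp N) a)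
  norm_cast
  refine Finset.card_le_card fun s hs => ?_
  rw [Finset.mem_filter] at hs ⊢
  refine ⟨hs.1, ?_⟩
  obtain ⟨t, htN, hta⟩ := hs.2
  have hex : ∃ t, a ≤ ∑ t' ∈ Finset.range t, f t' s := ⟨t, hta⟩
  set t₁ := Nat.find hex with ht₁
  have h1 : a ≤ ∑ t' ∈ Finset.range t₁, f t' s := Nat.find_spec hex
  have h1N : t₁ ≤ N := (Nat.find_min' hex hta).trans htN
  have h2 : ∀ t' < t₁, g t' s = f t' s := by
    intro t' ht'
    simp only [hg]
    rw [if_pos]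
    intro t₀ ht₀
    exact not_le.1 (Nat.find_min hex (lt_of_le_of_lt ht₀ ht'))
  have h3 : ∀ t', t₁ ≤ t' → g t' s = 0 := by
    intro t' ht'
    simp only [hg]
    rw [if_neg]
    intro h
    exact absurd h1 (not_le.2 (h t₁ ht'))
  rw [← Finset.sum_range_add_sum_Ico _ h1N,
    Finset.sum_congr rfl fun t' ht' => h2 t' (Finset.mem_range.1 ht'),
    Finset.sum_eq_zero (s := Finset.Ico t₁ N) fun t' ht' => h3 t' (Finset.mem_Ico.1 ht').1]
  simpa using h1

end Abstract

/-- The real sign of a Boolean. -/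
def sgn (x : Bool) : ℝ := if x then 1 else -1

theorem sgn_mul_self (x : Bool) : sgn x * sgn x = 1 := by cases x <;> simp [sgn]

theorem sgn_beq (x y : Bool) : sgn (x == y) = sgn x * sgn y := by
  cases x <;> cases y <;> simp [sgn]

theorem sum_exp_sgn_le (y : ℝ) : ∑ x : Bool, Real.exp (sgn x * y) ≤ 2 * Real.exp (y ^ 2 / 2) := by
  have := Real.cosh_le_exp_half_sq y
  rw [Real.cosh_eq] at this
  simp [sgn]
  linarith

theorem sum_exp_rademacher_le {ι : Type*} [Fintype ι] [DecidableEq ι] (y : ι → ℝ) :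
    ∑ τ : ι → Bool, Real.exp (∑ f, sgn (τ f) * y f) ≤
      Fintype.card (ι → Bool) * Real.exp ((∑ f, y f ^ 2) / 2) := by
  have h := Finset.prod_univ_sum (fun _ : ι => (Finset.univ : Finset Bool))
    (fun f x => Real.exp (sgn x * y f))
  rw [Fintype.piFinset_univ] at h
  simp_rw [Real.exp_sum]
  rw [← h]
  calc ∏ f, ∑ x : Bool, Real.exp (sgn x * y f) ≤ ∏ f : ι, 2 * Real.exp (y f ^ 2 / 2) :=
        Finset.prod_le_prod (fun f _ => Finset.sum_nonneg fun _ _ => (Real.exp_pos _).le)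
          fun f _ => sum_exp_sgn_le _
    _ = _ := by
        rw [Finset.prod_mul_distrib, ← Real.exp_sum, Finset.sum_div]
        simp

/-- Multiplying all the other signs by a fixed one does not change their distribution. -/
theorem sum_exp_row_le {ι : Type*} [Fintype ι] [DecidableEq ι] (e : ι) (y : ι → ℝ) (hy : y e = 0) :
    ∑ τ : ι → Bool, Real.exp (∑ f, sgn (τ e) * sgn (τ f) * y f) ≤
      Fintype.card (ι → Bool) * Real.exp ((∑ f, y f ^ 2) / 2) := by
  set Θ : (ι → Bool) → (ι → Bool) := fun τ f => if f = e then τ e else (τ f == τ e) with hΘ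
  have hinv : Function.Involutive Θ := by
    intro τ
    funext f
    by_cases h : f = e
    · subst h; simp [hΘ]
    · simp only [hΘ, h, if_false, if_true]
      cases τ f <;> cases τ e <;> rfl
  refine le_trans (le_of_eq ?_) (sum_exp_rademacher_le y)
  rw [← Equiv.sum_comp hinv.toPerm (fun τ : ι → Bool => Real.exp (∑ f, sgn (τ f) * y f))]
  refine Finset.sum_congr rfl fun τ _ => ?_
  congr 1
  refine Finset.sum_congr rfl fun f _ => ?_
  by_cases h : f = e
  · subst h; simp [hy]
  · simp [hΘ, h, sgn_beq, mul_comm]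

theorem sum_exp_rows_le {ι : Type*} [Fintype ι] [DecidableEq ι] (b : ℕ) (e : ι) (y : ι → ℝ)
    (hy : y e = 0) :
    ∑ σ : Fin b → ι → Bool, Real.exp (∑ a, ∑ f, sgn (σ a e) * sgn (σ a f) * y f) ≤
      Fintype.card (Fin b → ι → Bool) * Real.exp (b * ((∑ f, y f ^ 2) / 2)) := by
  have h := Finset.prod_univ_sum (fun _ : Fin b => (Finset.univ : Finset (ι → Bool)))
    (fun _ τ => Real.exp (∑ f, sgn (τ e) * sgn (τ f) * y f))
  rw [Fintype.piFinset_univ] at h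
  have h2 : ∀ σ : Fin b → ι → Bool,
      Real.exp (∑ a, ∑ f, sgn (σ a e) * sgn (σ a f) * y f) =
      ∏ a, Real.exp (∑ f, sgn (σ a e) * sgn (σ a f) * y f) := fun σ => Real.exp_sum _ _
  simp_rw [h2]
  rw [← h, Real.exp_nat_mul]
  simp only [Finset.prod_const, Finset.card_univ, Fintype.card_fin]
  rw [Fintype.card_fun, Fintype.card_fin, Nat.cast_pow, ← mul_pow]
  exact pow_le_pow_left₀ (Finset.sum_nonneg fun _ _ => (Real.exp_pos _).le)
    (sum_exp_row_le e y hy) b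

/-- The sketching matrix with given signs. -/
noncomputable def signMatrix {b : ℕ} (σ : Fin b → Coord n → Bool) : Matrix (Fin b) (Coord n) ℝ :=
  Matrix.of fun a e => (if σ a e then 1 else -1) / √(b : ℝ)

/-- The error of the sketched residual. -/
noncomputable def noise (P : Params n m) (sk : Matrix (Fin P.b) (Coord n) ℝ) (st : State n m)
    (e : Coord n) : ℝ := sketchedResid P sk st e - resid P st e

theorem noise_signMatrix (P : Params n m) (hb : 0 < P.b) (st : State n m) (e : Coord n)
    (he : 0 < st.rbar e) (σ : Fin P.b → Coord n → Bool) :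
    noise P (signMatrix σ) st e = ∑ a, ∑ f, sgn (σ a e) * sgn (σ a f) *
      (if f = e then 0 else (P.b * √(st.rbar e))⁻¹ * (√(st.rbar f) * resid P st f)) := by
  have hb' : (0 : ℝ) < P.b := by exact_mod_cast hb
  have hs : √(st.rbar e) ≠ 0 := (Real.sqrt_pos.2 he).ne'
  have hbb : √(P.b : ℝ) * √(P.b : ℝ) = P.b := Real.mul_self_sqrt hb'.le
  set z : Coord n → ℝ := fun f => √(st.rbar f) * resid P st f with hz
  have h1 : sketchedResid P (signMatrix σ) st e =
      ∑ a, ∑ f, sgn (σ a e) * sgn (σ a f) * ((P.b * √(st.rbar e))⁻¹ * z f) := by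
    rw [sketchedResid, Matrix.mulVec, dotProduct, Finset.sum_comm, Finset.mul_sum]
    refine Finset.sum_congr rfl fun f _ => ?_
    rw [Matrix.mul_apply, Finset.sum_mul, Finset.mul_sum]
    refine Finset.sum_congr rfl fun a _ => ?_
    have : (signMatrix σ)ᵀ e a * (signMatrix σ) a f = sgn (σ a e) * sgn (σ a f) * (P.b : ℝ)⁻¹ := by
      simp only [signMatrix, Matrix.transpose_apply, Matrix.of_apply, sgn]
      rw [div_mul_div_comm, hbb, div_eq_mul_inv]
    rw [this, mul_inv]
    ring
  have h2 : resid P st e = ∑ a : Fin P.b, ∑ f, sgn (σ a e) * sgn (σ a f) *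
      (if f = e then (P.b * √(st.rbar e))⁻¹ * z f else 0) := by
    simp only [mul_ite, mul_zero, Finset.sum_ite_eq', Finset.mem_univ, if_true, sgn_mul_self,
      one_mul, Finset.sum_const, Finset.card_univ, Fintype.card_fin, nsmul_eq_mul, hz]
    field_simp
  rw [noise, h1, h2, ← Finset.sum_sub_distrib]
  refine Finset.sum_congr rfl fun a _ => ?_
  rw [← Finset.sum_sub_distrib]
  refine Finset.sum_congr rfl fun f _ => ?_
  split_ifs <;> simp [hz]

theorem sum_exp_noise_le (P : Params n m) (hb : 0 < P.b) (st : State n m)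
    (hr : ∀ f, 0 < st.rbar f) (e : Coord n) (l : ℝ) :
    ∑ σ : Fin P.b → Coord n → Bool, Real.exp (l * noise P (signMatrix σ) st e) ≤
      Fintype.card (Fin P.b → Coord n → Bool) *
        Real.exp (l ^ 2 / 2 * (psi P st / (P.b * st.rbar e))) := by
  have hb' : (0 : ℝ) < P.b := by exact_mod_cast hb
  set y : Coord n → ℝ := fun f =>
    if f = e then 0 else l * ((P.b * √(st.rbar e))⁻¹ * (√(st.rbar f) * resid P st f)) with hy
  have h1 : ∀ σ : Fin P.b → Coord n → Bool, l * noise P (signMatrix σ) st e =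
      ∑ a, ∑ f, sgn (σ a e) * sgn (σ a f) * y f := by
    intro σ
    rw [noise_signMatrix P hb st e (hr e), Finset.mul_sum]
    refine Finset.sum_congr rfl fun a _ => ?_
    rw [Finset.mul_sum]
    refine Finset.sum_congr rfl fun f _ => ?_
    simp only [hy]
    split_ifs <;> ring
  simp_rw [h1]
  refine (sum_exp_rows_le P.b e y (by simp [hy])).trans ?_
  refine mul_le_mul_of_nonneg_left (Real.exp_le_exp.2 ?_) (Nat.cast_nonneg _)
  have h2 : ∑ f, y f ^ 2 ≤ ∑ f, l ^ 2 * ((P.b ^ 2 * st.rbar e)⁻¹ *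
      (st.rbar f * resid P st f ^ 2)) := by
    refine Finset.sum_le_sum fun f _ => ?_
    have h0 : l ^ 2 * ((P.b ^ 2 * st.rbar e)⁻¹ * (st.rbar f * resid P st f ^ 2)) =
        (l * ((P.b * √(st.rbar e))⁻¹ * (√(st.rbar f) * resid P st f))) ^ 2 := by
      rw [mul_pow, mul_pow, mul_pow, inv_pow, mul_pow, Real.sq_sqrt (hr e).le,
        Real.sq_sqrt (hr f).le]
    rw [h0]
    simp only [hy]
    split_ifs
    · simpa using sq_nonneg _
    · exact le_rfl
  have h3 : ∑ f, l ^ 2 * ((P.b ^ 2 * st.rbar e)⁻¹ * (st.rbar f * resid P st f ^ 2)) =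
      l ^ 2 * ((P.b ^ 2 * st.rbar e)⁻¹ * psi P st) := by
    rw [psi, Finset.mul_sum, Finset.mul_sum]
  rw [h3] at h2
  calc (P.b : ℝ) * ((∑ f, y f ^ 2) / 2)
      ≤ P.b * (l ^ 2 * ((P.b ^ 2 * st.rbar e)⁻¹ * psi P st) / 2) := by gcongr
    _ = l ^ 2 / 2 * (psi P st / (P.b * st.rbar e)) := by
        have := (hr e).ne'
        field_simp

/-- The next step is a primal step. -/
def IsPrimal (P : Params n m) (st : State n m) : Prop := st.i < P.T ∧ PrimalTest P st

/-- The next step is a width reduction step. -/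
def IsWidth (P : Params n m) (st : State n m) : Prop := st.i < P.T ∧ ¬ PrimalTest P st

theorem step_of_isPrimal {P : Params n m} {st : State n m} (h : IsPrimal P st) (rule : Rule n m)
    (sk : Matrix (Fin P.b) (Coord n) ℝ) : step P rule sk st = primalStep P sk st := by
  rw [step, if_pos h.1, if_pos h.2]

theorem step_of_isWidth {P : Params n m} {st : State n m} (h : IsWidth P st) (rule : Rule n m)
    (sk : Matrix (Fin P.b) (Coord n) ℝ) : step P rule sk st = widthStep P rule st := by
  rw [step, if_pos h.1, if_neg h.2]

theorem step_of_le {P : Params n m} {st : State n m} (h : P.T ≤ st.i) (rule : Rule n m)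
    (sk : Matrix (Fin P.b) (Coord n) ℝ) : step P rule sk st = st := by
  rw [step, if_neg (not_lt.2 h)]

theorem step_cases (P : Params n m) (st : State n m) :
    IsPrimal P st ∨ IsWidth P st ∨ P.T ≤ st.i := by
  unfold IsPrimal IsWidth
  by_cases h : st.i < P.T
  · by_cases h2 : PrimalTest P st
    · exact Or.inl ⟨h, h2⟩
    · exact Or.inr (Or.inl ⟨h, h2⟩)
  · exact Or.inr (Or.inr (not_lt.1 h))

theorem IsWidth.not_isPrimal {P : Params n m} {st : State n m} (h : IsWidth P st) :
    ¬ IsPrimal P st := fun h' => h.2 h'.2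

theorem step_i_of_not_isPrimal {P : Params n m} {st : State n m} (h : ¬ IsPrimal P st)
    (rule : Rule n m) (sk : Matrix (Fin P.b) (Coord n) ℝ) : (step P rule sk st).i = st.i := by
  rcases step_cases P st with h' | h' | h'
  · exact absurd h' h
  · rw [step_of_isWidth h']; rfl
  · rw [step_of_le h']

theorem step_congr_of_not_isPrimal {P : Params n m} {st : State n m} (h : ¬ IsPrimal P st)
    (rule : Rule n m) (sk sk' : Matrix (Fin P.b) (Coord n) ℝ) :
    step P rule sk st = step P rule sk' st := by
  rcases step_cases P st with h' | h' | h'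
  · exact absurd h' h
  · rw [step_of_isWidth h', step_of_isWidth h']
  · rw [step_of_le h', step_of_le h']

section Run

variable (P : Params n m) (rule : Rule n m) (s : Signs P)

theorem run_zero : run P rule s 0 = init P := rfl

theorem run_succ (t : ℕ) :
    run P rule s (t + 1) = step P rule (sketch P s (run P rule s t).i) (run P rule s t) := by
  unfold run
  rw [Function.iterate_succ_apply']

theorem run_succ_of_isPrimal {t : ℕ} (h : IsPrimal P (run P rule s t)) :
    run P rule s (t + 1) = primalStep P (sketch P s (run P rule s t).i) (run P rule s t) := by
  rw [run_succ, step_of_isPrimal h]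

theorem run_succ_of_isWidth {t : ℕ} (h : IsWidth P (run P rule s t)) :
    run P rule s (t + 1) = widthStep P rule (run P rule s t) := by
  rw [run_succ, step_of_isWidth h]

theorem run_succ_of_le {t : ℕ} (h : P.T ≤ (run P rule s t).i) :
    run P rule s (t + 1) = run P rule s t := by
  rw [run_succ, step_of_le h]

theorem run_i_succ_of_isPrimal {t : ℕ} (h : IsPrimal P (run P rule s t)) :
    (run P rule s (t + 1)).i = (run P rule s t).i + 1 := by
  rw [run_succ_of_isPrimal P rule s h]; rfl

theorem run_i_succ_of_not_isPrimal {t : ℕ} (h : ¬ IsPrimal P (run P rule s t)) :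
    (run P rule s (t + 1)).i = (run P rule s t).i := by
  rw [run_succ, step_i_of_not_isPrimal h]

theorem run_i_mono : Monotone fun t => (run P rule s t).i := by
  refine monotone_nat_of_le_succ fun t => ?_
  by_cases h : IsPrimal P (run P rule s t)
  · simp only [run_i_succ_of_isPrimal P rule s h]; omega
  · simp only [run_i_succ_of_not_isPrimal P rule s h]; exact le_rfl

theorem run_i_le (t : ℕ) : (run P rule s t).i ≤ P.T := by
  induction t with
  | zero => exact Nat.zero_le _
  | succ t ih =>
    by_cases h : IsPrimal P (run P rule s t)
    · rw [run_i_succ_of_isPrimal P rule s h]; exact h.1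
    · rw [run_i_succ_of_not_isPrimal P rule s h]; exact ih

open Classical in
theorem card_isPrimal (t : ℕ) :
    ((Finset.range t).filter fun t' => IsPrimal P (run P rule s t')).card = (run P rule s t).i := by
  induction t with
  | zero => rfl
  | succ t ih =>
    rw [Finset.range_add_one, Finset.filter_insert]
    split_ifs with h
    · rw [Finset.card_insert_of_notMem (by simp), ih, run_i_succ_of_isPrimal P rule s h]
    · rw [ih, run_i_succ_of_not_isPrimal P rule s h]

theorem run_update (j : Fin P.T) (ω : Fin P.b → Coord n → Bool) {t : ℕ}
    (ht : (run P rule s t).i = j) : ∀ t' ≤ t,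
      run P rule (Function.update s j ω) t' = run P rule s t' := by
  intro t' ht'
  induction t' with
  | zero => rfl
  | succ t' ih =>
    have ih' := ih (by omega)
    rw [run_succ, run_succ, ih']
    by_cases hp : IsPrimal P (run P rule s t')
    · congr 1
      have h1 : (run P rule s (t' + 1)).i ≤ j := ht ▸ run_i_mono P rule s ht'
      rw [run_i_succ_of_isPrimal P rule s hp] at h1
      unfold sketch
      split_ifs with h
      · rw [Function.update_of_ne]
        intro h2
        have := congrArg Fin.val h2
        simp at this
        omega
      · rfl
    · exact step_congr_of_not_isPrimal hp _ _ _

open Classical in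
/-- Exchange the signs that the next step of the run reads with `ω`. -/
noncomputable def resample (t : ℕ) (x : Signs P × (Fin P.b → Coord n → Bool)) :
    Signs P × (Fin P.b → Coord n → Bool) :=
  if h : (run P rule x.1 t).i < P.T then
    (Function.update x.1 ⟨_, h⟩ x.2, x.1 ⟨_, h⟩) else x

theorem resample_of_lt {t : ℕ} {s : Signs P} (ω : Fin P.b → Coord n → Bool)
    (h : (run P rule s t).i < P.T) : resample P rule t (s, ω) =
      (Function.update s ⟨_, h⟩ ω, s ⟨_, h⟩) := by
  rw [resample, dif_pos h]

theorem run_resample {t : ℕ} (x : Signs P × (Fin P.b → Coord n → Bool)) :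
    ∀ t' ≤ t, run P rule (resample P rule t x).1 t' = run P rule x.1 t' := by
  intro t' ht'
  unfold resample
  split_ifs with h
  · exact run_update P rule x.1 ⟨_, h⟩ x.2 rfl t' ht'
  · rfl

theorem resample_involutive (t : ℕ) : Function.Involutive (resample P rule t) := by
  intro x
  obtain ⟨s, ω⟩ := x
  by_cases h : (run P rule s t).i < P.T
  · have h1 := run_update P rule s ⟨_, h⟩ ω rfl t le_rfl
    rw [resample_of_lt P rule ω h]
    have h2 : (run P rule (Function.update s ⟨_, h⟩ ω) t).i < P.T := by rw [h1]; exact h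
    rw [resample_of_lt P rule _ h2]
    have h3 : (⟨_, h2⟩ : Fin P.T) = ⟨_, h⟩ := by
      apply Fin.ext; simp [h1]
    rw [h3]
    simp
  · have : resample P rule t (s, ω) = (s, ω) := by rw [resample, dif_neg h]
    rw [this, this]

end Run

/-- The states at which the errors of the sketches are under control. -/
def Ok (P : Params n m) (st : State n m) : Prop :=
  ∀ e, 0 < st.w e ∧ 0 < st.rbar e ∧ P.ε * psi P st ≤ 4 * n * st.rbar e

open Classical in
/-- A weighted error of the sketch of step `t`, if this is a primal step. -/
noncomputable def obs (P : Params n m) (rule : Rule n m) (p : State n m → Coord n → ℝ)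
    (s : Signs P) (t : ℕ) : ℝ :=
  if IsPrimal P (run P rule s t) ∧ Ok P (run P rule s t) then
    ∑ e, p (run P rule s t) e * noise P (sketch P s (run P rule s t).i) (run P rule s t) e
  else 0

/-- Weights of coordinates that form a probability distribution at the relevant states. -/
def IsWeight (P : Params n m) (p : State n m → Coord n → ℝ) : Prop :=
  ∀ st, Ok P st → (∀ e, 0 ≤ p st e) ∧ ∑ e, p st e = 1

theorem sum_exp_weighted_noise_le (P : Params n m) (hb : 0 < P.b) (hε : 0 < P.ε)
    {p : State n m → Coord n → ℝ} (hp : IsWeight P p) {st : State n m} (h : Ok P st) (l : ℝ) :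
    ∑ σ : Fin P.b → Coord n → Bool,
      Real.exp (l * (∑ e, p st e * noise P (signMatrix σ) st e) - l ^ 2 / 2 * (4 * n / (P.ε * P.b))) ≤
      Fintype.card (Fin P.b → Coord n → Bool) := by
  have hb' : (0 : ℝ) < P.b := by exact_mod_cast hb
  obtain ⟨hp0, hp1⟩ := hp st h
  set v := l ^ 2 / 2 * (4 * n / (P.ε * P.b)) with hv
  have h1 : ∀ σ : Fin P.b → Coord n → Bool,
      Real.exp (l * (∑ e, p st e * noise P (signMatrix σ) st e) - v) ≤
        ∑ e, p st e * (Real.exp (l * noise P (signMatrix σ) st e) * Real.exp (-v)) := by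
    intro σ
    have := convexOn_exp.map_sum_le (t := Finset.univ) (w := p st)
      (p := fun e => l * noise P (signMatrix σ) st e) (fun e _ => hp0 e) hp1 (fun _ _ => trivial)
    simp only [smul_eq_mul] at this
    rw [sub_eq_add_neg, Real.exp_add, Finset.mul_sum]
    calc _ ≤ (∑ e, p st e * Real.exp (l * noise P (signMatrix σ) st e)) * Real.exp (-v) := by
          refine mul_le_mul_of_nonneg_right (le_trans (le_of_eq ?_) this) (Real.exp_pos _).le
          congr 1
          exact Finset.sum_congr rfl fun _ _ => by ring
      _ = _ := by
          rw [Finset.sum_mul]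
          exact Finset.sum_congr rfl fun _ _ => by ring
  have h2 : ∀ e, ∑ σ : Fin P.b → Coord n → Bool,
      Real.exp (l * noise P (signMatrix σ) st e) * Real.exp (-v) ≤
        Fintype.card (Fin P.b → Coord n → Bool) := by
    intro e
    have hre := (h e).2.1
    rw [← Finset.sum_mul]
    refine (mul_le_mul_of_nonneg_right
      (sum_exp_noise_le P hb st (fun f => (h f).2.1) e l) (Real.exp_pos _).le).trans ?_
    rw [mul_assoc, ← Real.exp_add]
    refine mul_le_of_le_one_right (Nat.cast_nonneg _) ?_
    rw [Real.exp_le_one_iff]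
    have : psi P st / (P.b * st.rbar e) ≤ 4 * n / (P.ε * P.b) := by
      rw [div_le_div_iff₀ (by positivity) (by positivity)]
      nlinarith [mul_le_mul_of_nonneg_left (h e).2.2 hb'.le]
    have := mul_le_mul_of_nonneg_left this (by positivity : 0 ≤ l ^ 2 / 2)
    linarith
  calc _ ≤ ∑ σ : Fin P.b → Coord n → Bool, ∑ e, p st e *
        (Real.exp (l * noise P (signMatrix σ) st e) * Real.exp (-v)) :=
        Finset.sum_le_sum fun σ _ => h1 σ
    _ = ∑ e, p st e * ∑ σ : Fin P.b → Coord n → Bool,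
        (Real.exp (l * noise P (signMatrix σ) st e) * Real.exp (-v)) := by
        rw [Finset.sum_comm]
        exact Finset.sum_congr rfl fun _ _ => by rw [Finset.mul_sum]
    _ ≤ ∑ e, p st e * Fintype.card (Fin P.b → Coord n → Bool) :=
        Finset.sum_le_sum fun e _ => mul_le_mul_of_nonneg_left (h2 e) (hp0 e)
    _ = _ := by rw [← Finset.sum_mul, hp1, one_mul]

section Event

variable (P : Params n m) (rule : Rule n m)

open Classical in
/-- The increments of the exponential supermartingale of a weighted error. -/
noncomputable def expIncr (p : State n m → Coord n → ℝ) (l : ℝ) (t : ℕ) (s : Signs P) : ℝ :=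
  if IsPrimal P (run P rule s t) ∧ Ok P (run P rule s t) then
    l * obs P rule p s t - l ^ 2 / 2 * (4 * n / (P.ε * P.b))
  else 0

theorem expIncr_resample_of_lt (p : State n m → Coord n → ℝ) (l : ℝ) {t t' : ℕ} (h : t' < t)
    (s : Signs P) (ω : Fin P.b → Coord n → Bool) :
    expIncr P rule p l t' (resample P rule t (s, ω)).1 = expIncr P rule p l t' s := by
  have h1 := run_resample P rule (s, ω) t' h.le
  have h2 := run_resample P rule (s, ω) (t' + 1) h
  unfold expIncr obs
  rw [h1]
  by_cases hc : IsPrimal P (run P rule s t') ∧ Ok P (run P rule s t')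
  · simp only [if_pos hc]
    have : sketch P (resample P rule t (s, ω)).1 (run P rule s t').i =
        sketch P s (run P rule s t').i := by
      unfold resample
      split_ifs with h3
      · unfold sketch
        split_ifs with h4
        · have h8 : (⟨_, h4⟩ : Fin P.T) ≠ ⟨_, h3⟩ := by
            intro h5
            have h6 := congrArg Fin.val h5
            have h7 := run_i_mono P rule s (show t' + 1 ≤ t from h)
            simp only at h6 h7
            rw [run_i_succ_of_isPrimal P rule s hc.1] at h7
            omega
          ext a e
          simp only [Matrix.of_apply, Function.update_of_ne h8]
        · rfl
      · rfl
    rw [this]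
  · simp only [if_neg hc]

theorem sum_exp_expIncr_le (hb : 0 < P.b) (hε : 0 < P.ε) {p : State n m → Coord n → ℝ}
    (hp : IsWeight P p) (l : ℝ) (t : ℕ) (s : Signs P) :
    ∑ ω, Real.exp (expIncr P rule p l t (resample P rule t (s, ω)).1) ≤
      Fintype.card (Fin P.b → Coord n → Bool) := by
  have h1 : ∀ ω, run P rule (resample P rule t (s, ω)).1 t = run P rule s t :=
    fun ω => run_resample P rule (s, ω) t le_rfl
  by_cases hc : IsPrimal P (run P rule s t) ∧ Ok P (run P rule s t)
  · refine le_trans (le_of_eq ?_) (sum_exp_weighted_noise_le P hb hε hp hc.2 l)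
    refine Finset.sum_congr rfl fun ω _ => ?_
    have h2 : sketch P (resample P rule t (s, ω)).1 (run P rule s t).i = signMatrix ω := by
      rw [resample_of_lt P rule ω hc.1.1, sketch, dif_pos hc.1.1]
      simp [signMatrix]
    rw [expIncr, obs, h1 ω, h2, if_pos hc, if_pos hc]
  · have : ∀ ω, expIncr P rule p l t (resample P rule t (s, ω)).1 = 0 := by
      intro ω
      rw [expIncr, h1 ω, if_neg hc]
    simp [this]

open Classical in
theorem card_sum_obs_ge_le (hb : 0 < P.b) (hε : 0 < P.ε) {p : State n m → Coord n → ℝ}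
    (hp : IsWeight P p) (l a : ℝ) (N : ℕ) :
    ((Finset.univ.filter fun s => ∃ t ≤ N, a + l ^ 2 / 2 * (4 * n / (P.ε * P.b)) * P.T ≤
      l * ∑ t' ∈ Finset.range t, obs P rule p s t').card : ℝ) ≤
      Real.exp (-a) * Fintype.card (Signs P) := by
  refine le_trans ?_ (card_exists_sum_ge_le (resample P rule) (resample_involutive P rule)
    (expIncr P rule p l) (fun t t' h s ω => expIncr_resample_of_lt P rule p l h s ω)
    (fun t s => sum_exp_expIncr_le P rule hb hε hp l t s) N a)
  refine Nat.cast_le.2 (Finset.card_le_card fun s hs => ?_)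
  rw [Finset.mem_filter] at hs ⊢
  refine ⟨hs.1, ?_⟩
  obtain ⟨t, htN, ht⟩ := hs.2
  refine ⟨t, htN, ?_⟩
  set v := l ^ 2 / 2 * (4 * n / (P.ε * P.b)) with hv
  have hv0 : 0 ≤ v := by positivity
  have h1 : ∀ t', l * obs P rule p s t' - (if IsPrimal P (run P rule s t') then v else 0) ≤
      expIncr P rule p l t' s := by
    intro t'
    unfold expIncr
    by_cases hc : IsPrimal P (run P rule s t') ∧ Ok P (run P rule s t')
    · rw [if_pos hc, if_pos hc.1]
    · rw [if_neg hc, obs, if_neg hc, mul_zero]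
      split_ifs <;> simp [hv0]
  have h2 := Finset.sum_le_sum fun t' (_ : t' ∈ Finset.range t) => h1 t'
  rw [Finset.sum_sub_distrib, ← Finset.mul_sum, ← Finset.sum_filter, Finset.sum_const,
    card_isPrimal, nsmul_eq_mul] at h2
  have h3 : ((run P rule s t).i : ℝ) * v ≤ v * P.T := by
    rw [mul_comm]
    exact mul_le_mul_of_nonneg_left (by exact_mod_cast run_i_le P rule s t) hv0
  linarith

open Classical in
theorem card_obs_ge_le (hb : 0 < P.b) (hε : 0 < P.ε) {p : State n m → Coord n → ℝ}
    (hp : IsWeight P p) (l : ℝ) {a : ℝ} (ha : 0 < a) (t : ℕ) :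
    ((Finset.univ.filter fun s => a + l ^ 2 / 2 * (4 * n / (P.ε * P.b)) ≤
      l * obs P rule p s t).card : ℝ) ≤ Real.exp (-a) * Fintype.card (Signs P) := by
  have h := sum_exp_le (resample P rule) (resample_involutive P rule)
    (fun t' s => if t' = t then expIncr P rule p l t s else 0) (by
      intro t₁ t' h s ω
      split_ifs with h1
      · subst h1; exact expIncr_resample_of_lt P rule p l h s ω
      · rfl) (by
      intro t₁ s
      split_ifs with h1
      · subst h1; exact sum_exp_expIncr_le P rule hb hε hp l t₁ s
      · simp) (t + 1)
  simp only [Finset.sum_ite_eq', Finset.mem_range, Nat.lt_succ_self, if_true] at h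
  refine le_trans ?_ (card_le_of_exp h a)
  refine Nat.cast_le.2 (Finset.card_le_card fun s hs => ?_)
  rw [Finset.mem_filter] at hs ⊢
  refine ⟨hs.1, ?_⟩
  have h2 := hs.2
  set v := l ^ 2 / 2 * (4 * n / (P.ε * P.b)) with hv
  have hv0 : 0 ≤ v := by positivity
  unfold expIncr
  by_cases hc : IsPrimal P (run P rule s t) ∧ Ok P (run P rule s t)
  · rw [if_pos hc]; linarith
  · rw [obs, if_neg hc, mul_zero] at h2
    linarith

/-- The weights used in the analysis: single coordinates, and the normalized weights `w`. -/
noncomputable def weight : Option (Coord n) → State n m → Coord n → ℝ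
  | none => fun st e => st.w e / ∑ f, st.w f
  | some e => fun _ => Pi.single e 1

theorem isWeight_weight (hn : 0 < n) (q : Option (Coord n)) : IsWeight P (weight (m := m) q) := by
  intro st h
  have : Nonempty (Coord n) := ⟨Sum.inl ⟨0, hn⟩⟩
  cases q with
  | none =>
    have hpos : 0 < ∑ f, st.w f := Finset.sum_pos (fun f _ => (h f).1) Finset.univ_nonempty
    refine ⟨fun e => div_nonneg (h e).1.le hpos.le, ?_⟩
    simp only [weight]
    rw [← Finset.sum_div, div_self hpos.ne']
  | some e =>
    refine ⟨fun f => ?_, by simp [weight]⟩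
    by_cases hf : f = e
    · subst hf; simp [weight]
    · simp [weight, hf]

/-- All errors of the sketches of the first `N` steps, and their sums over time, are small. -/
def SmallNoise (s : Signs P) (N : ℕ) (v xbar : ℝ) : Prop :=
  (∀ q, ∀ t ≤ N, |∑ t' ∈ Finset.range t, obs P rule (weight q) s t'| ≤ v) ∧
    ∀ t < N, ∀ e, |obs P rule (weight (some e)) s t| ≤ xbar

open Classical in
theorem smallNoise_prob (hn : 0 < n) (hb : 0 < P.b) (hε : 0 < P.ε) (hT : 0 < P.T) {N : ℕ}
    {v xbar a₁ a₂ : ℝ} (hv0 : 0 < v) (hx0 : 0 < xbar) (ha₂ : 0 < a₂)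
    (hv : 2 * a₁ * (4 * n / (P.ε * P.b)) * P.T ≤ v ^ 2)
    (hx : 2 * a₂ * (4 * n / (P.ε * P.b)) ≤ xbar ^ 2) :
    1 - (2 * (2 * n + 1) * Real.exp (-a₁) + 4 * n * N * Real.exp (-a₂)) ≤
      signProb P fun s => SmallNoise P rule s N v xbar := by
  have hb' : (0 : ℝ) < P.b := by exact_mod_cast hb
  have hn' : (0 : ℝ) < n := by exact_mod_cast hn
  have hT' : (0 : ℝ) < P.T := by exact_mod_cast hT
  set σ2 := 4 * n / (P.ε * P.b) with hσ
  have hσ0 : 0 < σ2 := by positivity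
  set l₁ := v / (σ2 * P.T) with hl₁
  set l₂ := xbar / σ2 with hl₂
  have hl₁0 : 0 < l₁ := by positivity
  have hl₂0 : 0 < l₂ := by positivity
  have e1 : a₁ + l₁ ^ 2 / 2 * σ2 * P.T ≤ l₁ * v := by
    have h1 : l₁ ^ 2 / 2 * σ2 * P.T = v ^ 2 / (σ2 * P.T) / 2 := by rw [hl₁]; field_simp
    have h2 : l₁ * v = v ^ 2 / (σ2 * P.T) := by rw [hl₁]; field_simp
    have h3 : 2 * a₁ ≤ v ^ 2 / (σ2 * P.T) := by
      rw [le_div_iff₀ (by positivity)]; linarith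
    rw [h1, h2]; linarith
  have e2 : a₂ + l₂ ^ 2 / 2 * σ2 ≤ l₂ * xbar := by
    have h1 : l₂ ^ 2 / 2 * σ2 = xbar ^ 2 / σ2 / 2 := by rw [hl₂]; field_simp
    have h2 : l₂ * xbar = xbar ^ 2 / σ2 := by rw [hl₂]; field_simp
    have h3 : 2 * a₂ ≤ xbar ^ 2 / σ2 := by
      rw [le_div_iff₀ (by positivity)]; linarith
    rw [h1, h2]; linarith
  set A : Option (Coord n) → ℝ → Finset (Signs P) := fun q l => Finset.univ.filter fun s =>
    ∃ t ≤ N, a₁ + l ^ 2 / 2 * σ2 * P.T ≤ l * ∑ t' ∈ Finset.range t, obs P rule (weight q) s t'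
    with hA
  set B : ℕ × Coord n → ℝ → Finset (Signs P) := fun x l => Finset.univ.filter fun s =>
    a₂ + l ^ 2 / 2 * σ2 ≤ l * obs P rule (weight (some x.2)) s x.1 with hB
  have hAc : ∀ q l, ((A q l).card : ℝ) ≤ Real.exp (-a₁) * Fintype.card (Signs P) := fun q l =>
    card_sum_obs_ge_le P rule hb hε (isWeight_weight P hn q) l a₁ N
  have hBc : ∀ x l, ((B x l).card : ℝ) ≤ Real.exp (-a₂) * Fintype.card (Signs P) := fun x l =>
    card_obs_ge_le P rule hb hε (isWeight_weight P hn _) l ha₂ x.1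
  set bad : Finset (Signs P) :=
    (Finset.univ.biUnion fun q => A q l₁ ∪ A q (-l₁)) ∪
      ((Finset.range N ×ˢ (Finset.univ : Finset (Coord n))).biUnion fun x => B x l₂ ∪ B x (-l₂))
    with hbad
  have hsub : (Finset.univ.filter fun s => ¬ SmallNoise P rule s N v xbar) ⊆ bad := by
    intro s hs
    by_contra hs'
    apply (Finset.mem_filter.1 hs).2
    simp only [hbad, hA, hB, Finset.mem_union, Finset.mem_biUnion, Finset.mem_univ, true_and,
      Finset.mem_filter, Finset.mem_product, Finset.mem_range, and_true, not_or, not_exists,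
      not_and, not_le] at hs'
    refine ⟨fun q t ht => abs_le.2 ⟨?_, ?_⟩, fun t ht e => abs_le.2 ⟨?_, ?_⟩⟩
    · have := (hs'.1 q).2 t ht
      rw [neg_sq] at this
      nlinarith
    · have := (hs'.1 q).1 t ht
      nlinarith
    · have := (hs'.2 (t, e) ht).2
      rw [neg_sq] at this
      nlinarith
    · have := (hs'.2 (t, e) ht).1
      nlinarith
  have hunion : ∀ (x y : Finset (Signs P)), ((x ∪ y).card : ℝ) ≤ x.card + y.card := fun x y => by
    exact_mod_cast Finset.card_union_le x y
  have hbadc : (bad.card : ℝ) ≤ (2 * (2 * n + 1) * Real.exp (-a₁) + 4 * n * N * Real.exp (-a₂)) *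
      Fintype.card (Signs P) := by
    have h1 : ((Finset.univ.biUnion fun q => A q l₁ ∪ A q (-l₁)).card : ℝ) ≤
        ∑ _q : Option (Coord n), 2 * (Real.exp (-a₁) * Fintype.card (Signs P)) := by
      refine le_trans (Nat.cast_le.2 Finset.card_biUnion_le) ?_
      push_cast
      refine Finset.sum_le_sum fun q _ => ?_
      linarith [hunion (A q l₁) (A q (-l₁)), hAc q l₁, hAc q (-l₁)]
    have h2 : (((Finset.range N ×ˢ (Finset.univ : Finset (Coord n))).biUnion
        fun x => B x l₂ ∪ B x (-l₂)).card : ℝ) ≤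
        ∑ _x ∈ Finset.range N ×ˢ (Finset.univ : Finset (Coord n)),
          2 * (Real.exp (-a₂) * Fintype.card (Signs P)) := by
      refine le_trans (Nat.cast_le.2 Finset.card_biUnion_le) ?_
      push_cast
      refine Finset.sum_le_sum fun x _ => ?_
      linarith [hunion (B x l₂) (B x (-l₂)), hBc x l₂, hBc x (-l₂)]
    simp only [Finset.sum_const, Finset.card_univ, Finset.card_product, Finset.card_range,
      Fintype.card_option, Fintype.card_sum, Fintype.card_fin, nsmul_eq_mul] at h1 h2
    push_cast at h1 h2
    have h3 := hunion (Finset.univ.biUnion fun q => A q l₁ ∪ A q (-l₁))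
      ((Finset.range N ×ˢ (Finset.univ : Finset (Coord n))).biUnion fun x => B x l₂ ∪ B x (-l₂))
    rw [← hbad] at h3
    refine h3.trans ((add_le_add h1 h2).trans (le_of_eq ?_))
    ring
  have hcard : (0 : ℝ) < Fintype.card (Signs P) := by exact_mod_cast Fintype.card_pos
  rw [signProb, le_div_iff₀ hcard]
  have hcompl := Finset.card_filter_add_card_filter_not (s := (Finset.univ : Finset (Signs P)))
    (fun s => SmallNoise P rule s N v xbar)
  have hle : ((Finset.univ.filter fun s => ¬ SmallNoise P rule s N v xbar).card : ℝ) ≤ bad.card := by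
    exact_mod_cast Finset.card_le_card hsub
  have hcompl' : ((Finset.univ.filter fun s => SmallNoise P rule s N v xbar).card : ℝ) +
      (Finset.univ.filter fun s => ¬ SmallNoise P rule s N v xbar).card =
      Fintype.card (Signs P) := by exact_mod_cast hcompl
  nlinarith

end Event

theorem Ct_mulVec_inl (P : Params n m) (y : Fin m → ℝ) (e : Fin n) :
    (Ct P *ᵥ y) (Sum.inl e) = (P.C *ᵥ y) e := rfl

theorem Ct_mulVec_inr (P : Params n m) (y : Fin m → ℝ) (e : Fin n) :
    (Ct P *ᵥ y) (Sum.inr e) = -(P.C *ᵥ y) e := by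
  have h : (Ct P *ᵥ y) (Sum.inr e) = ((-P.C) *ᵥ y) e := rfl
  rw [h, Matrix.neg_mulVec]
  rfl

theorem isUnit_normal (P : Params n m) (hC : Function.Injective P.C.mulVec) {r : Coord n → ℝ}
    (hr : ∀ e, 0 < r e) : IsUnit ((Ct P)ᵀ * Matrix.diagonal r * Ct P) := by
  rw [← Matrix.mulVec_injective_iff_isUnit]
  rw [← Matrix.coe_mulVecLin, ← LinearMap.ker_eq_bot, LinearMap.ker_eq_bot']
  intro y hy
  rw [Matrix.mulVecLin_apply] at hy
  have h1 : y ⬝ᵥ (((Ct P)ᵀ * Matrix.diagonal r * Ct P) *ᵥ y) =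
      ∑ e, r e * (Ct P *ᵥ y) e ^ 2 := by
    rw [← Matrix.mulVec_mulVec, ← Matrix.mulVec_mulVec, Matrix.dotProduct_mulVec,
      Matrix.vecMul_transpose, dotProduct]
    refine Finset.sum_congr rfl fun e _ => ?_
    rw [Matrix.mulVec_diagonal]
    ring
  rw [hy, dotProduct_zero] at h1
  have h2 : ∀ e, (Ct P *ᵥ y) e = 0 := by
    intro e
    have h3 := (Finset.sum_eq_zero_iff_of_nonneg fun e _ =>
      mul_nonneg (hr e).le (sq_nonneg ((Ct P *ᵥ y) e))).1 h1.symm e (Finset.mem_univ e)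
    rcases mul_eq_zero.1 h3 with h4 | h4
    · exact absurd h4 (hr e).ne'
    · exact pow_eq_zero_iff two_ne_zero |>.1 h4
  apply hC
  funext e
  rw [← Ct_mulVec_inl, h2, Matrix.mulVec_zero]
  rfl

/-- The normal equations. -/
theorem sum_resid_mul_eq_zero (P : Params n m) (hC : Function.Injective P.C.mulVec)
    {st : State n m} (hr : ∀ e, 0 < st.rbar e) (y : Fin m → ℝ) :
    ∑ e, st.rbar e * resid P st e * (Ct P *ᵥ y) e = 0 := by
  set M := (Ct P)ᵀ * Matrix.diagonal st.rbar * Ct P with hM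
  have hu : IsUnit M.det := (Matrix.isUnit_iff_isUnit_det _).1 (isUnit_normal P hC hr)
  have h1 : M *ᵥ stepDir P st = ((Ct P)ᵀ * Matrix.diagonal st.rbar) *ᵥ dt P := by
    rw [stepDir, ← hM, Matrix.mulVec_mulVec, ← Matrix.mul_assoc, ← Matrix.mul_assoc,
      Matrix.mul_nonsing_inv _ hu, Matrix.one_mul]
  have h2 : ((Ct P)ᵀ * Matrix.diagonal st.rbar) *ᵥ resid P st = 0 := by
    rw [resid, Matrix.mulVec_sub, Matrix.mulVec_mulVec, ← hM, h1, sub_self]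
  have h3 : y ⬝ᵥ (((Ct P)ᵀ * Matrix.diagonal st.rbar) *ᵥ resid P st) =
      ∑ e, st.rbar e * resid P st e * (Ct P *ᵥ y) e := by
    rw [← Matrix.mulVec_mulVec, Matrix.dotProduct_mulVec, Matrix.vecMul_transpose, dotProduct]
    refine Finset.sum_congr rfl fun e _ => ?_
    rw [Matrix.mulVec_diagonal]
    ring
  rw [← h3, h2, dotProduct_zero]

theorem sum_resid_mul_resid (P : Params n m) (hC : Function.Injective P.C.mulVec)
    {st : State n m} (hr : ∀ e, 0 < st.rbar e) (y : Fin m → ℝ) :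
    ∑ e, st.rbar e * resid P st e * (Ct P *ᵥ y - dt P) e = psi P st := by
  have h := sum_resid_mul_eq_zero P hC hr (y - stepDir P st)
  have h2 : ∀ e, st.rbar e * resid P st e * (Ct P *ᵥ y - dt P) e =
      st.rbar e * resid P st e * (Ct P *ᵥ (y - stepDir P st)) e +
        st.rbar e * resid P st e ^ 2 := by
    intro e
    have : (Ct P *ᵥ y - dt P) e = (Ct P *ᵥ (y - stepDir P st)) e + resid P st e := by
      rw [Matrix.mulVec_sub, resid]
      simp
    rw [this]
    ring
  simp_rw [h2]
  rw [Finset.sum_add_distrib, h, zero_add, psi]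

/-- Changing the weights: the dual solution of the old weights bounds the new optimum. -/
theorem psi_add_le_sum (P : Params n m) (hC : Function.Injective P.C.mulVec)
    {st : State n m} (hr : ∀ e, 0 < st.rbar e) {r' : Coord n → ℝ} (hr' : ∀ e, 0 < r' e)
    (y : Fin m → ℝ) :
    psi P st + ∑ e, (1 - st.rbar e / r' e) * (st.rbar e * resid P st e ^ 2) ≤
      ∑ e, r' e * (Ct P *ᵥ y - dt P) e ^ 2 := by
  have h := sum_resid_mul_resid P hC hr y
  have h1 : psi P st + ∑ e, (1 - st.rbar e / r' e) * (st.rbar e * resid P st e ^ 2) =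
      ∑ e, (2 * (st.rbar e * resid P st e * (Ct P *ᵥ y - dt P) e) -
        (st.rbar e * resid P st e) ^ 2 / r' e) := by
    rw [Finset.sum_sub_distrib, ← Finset.mul_sum, h]
    simp only [sub_mul, one_mul]
    rw [Finset.sum_sub_distrib, ← psi]
    have : ∑ e, st.rbar e / r' e * (st.rbar e * resid P st e ^ 2) =
        ∑ e, (st.rbar e * resid P st e) ^ 2 / r' e :=
      Finset.sum_congr rfl fun e _ => by ring
    rw [this]
    ring
  rw [h1]
  refine Finset.sum_le_sum fun e _ => ?_
  have := hr' e
  rw [sub_le_iff_le_add, ← sub_le_iff_le_add', le_div_iff₀ this]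
  nlinarith [sq_nonneg (r' e * (Ct P *ᵥ y - dt P) e - st.rbar e * resid P st e)]

theorem psi_add_le_psi (P : Params n m) (hC : Function.Injective P.C.mulVec)
    {st st' : State n m} (hr : ∀ e, 0 < st.rbar e) (hr' : ∀ e, 0 < st'.rbar e) :
    psi P st + ∑ e, (1 - st.rbar e / st'.rbar e) * (st.rbar e * resid P st e ^ 2) ≤ psi P st' :=
  psi_add_le_sum P hC hr hr' (stepDir P st')

theorem psi_le_sum_sq (P : Params n m) (hC : Function.Injective P.C.mulVec)
    {st : State n m} (hr : ∀ e, 0 < st.rbar e) (y : Fin m → ℝ) :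
    psi P st ≤ ∑ e, st.rbar e * (Ct P *ᵥ y - dt P) e ^ 2 := by
  have h := psi_add_le_sum P hC hr hr y
  have h2 : ∑ e, (1 - st.rbar e / st.rbar e) * (st.rbar e * resid P st e ^ 2) = 0 :=
    Finset.sum_eq_zero fun e _ => by rw [div_self (hr e).ne']; ring
  linarith

theorem abs_Ct_sub_dt_inl (P : Params n m) (y : Fin m → ℝ) (e : Fin n) :
    |(Ct P *ᵥ y - dt P) (Sum.inl e)| = |(P.C *ᵥ y - P.d) e| := by
  rfl

theorem abs_Ct_sub_dt_inr (P : Params n m) (y : Fin m → ℝ) (e : Fin n) :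
    |(Ct P *ᵥ y - dt P) (Sum.inr e)| = |(P.C *ᵥ y - P.d) e| := by
  have h : (Ct P *ᵥ y - dt P) (Sum.inr e) = -((P.C *ᵥ y - P.d) e) := by
    rw [Pi.sub_apply, Ct_mulVec_inr]
    simp [dt]
    ring
  rw [h, abs_neg]

theorem abs_Ct_sub_dt_le (P : Params n m) (y : Fin m → ℝ) (e : Coord n) :
    |(Ct P *ᵥ y - dt P) e| ≤ ‖P.C *ᵥ y - P.d‖ := by
  cases e with
  | inl e => rw [abs_Ct_sub_dt_inl]; exact norm_le_pi_norm (P.C *ᵥ y - P.d) e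
  | inr e => rw [abs_Ct_sub_dt_inr]; exact norm_le_pi_norm (P.C *ᵥ y - P.d) e

theorem psi_le_sum_rbar (P : Params n m) (hC : Function.Injective P.C.mulVec)
    (hd : IsLeast (Set.range fun x : Fin m → ℝ => ‖P.C.mulVec x - P.d‖) 1)
    {st : State n m} (hr : ∀ e, 0 < st.rbar e) : psi P st ≤ ∑ e, st.rbar e := by
  obtain ⟨y, hy⟩ := hd.1
  refine (psi_le_sum_sq P hC hr y).trans (Finset.sum_le_sum fun e _ => ?_)
  have h1 := abs_Ct_sub_dt_le P y e
  have h2 : ‖P.C *ᵥ y - P.d‖ = 1 := hy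
  rw [h2] at h1
  have h3 : (Ct P *ᵥ y - dt P) e ^ 2 ≤ 1 := by
    rw [← sq_abs]; exact pow_le_one₀ (abs_nonneg _) h1
  exact mul_le_of_le_one_right (hr e).le h3

theorem exists_one_le_abs_resid (P : Params n m) (hn : 0 < n)
    (hd : IsLeast (Set.range fun x : Fin m → ℝ => ‖P.C.mulVec x - P.d‖) 1) (st : State n m) :
    ∃ e, 1 ≤ |resid P st e| := by
  have h1 : (1 : ℝ) ≤ ‖P.C *ᵥ stepDir P st - P.d‖ := hd.2 ⟨stepDir P st, rfl⟩
  by_contra! h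
  have : Nonempty (Fin n) := ⟨⟨0, hn⟩⟩
  have h2 : ‖P.C *ᵥ stepDir P st - P.d‖ < 1 := by
    rw [pi_norm_lt_iff one_pos]
    intro e
    exact h (Sum.inl e)
  linarith

theorem psi_nonneg (P : Params n m) {st : State n m} (hr : ∀ e, 0 < st.rbar e) : 0 ≤ psi P st :=
  Finset.sum_nonneg fun e _ => mul_nonneg (hr e).le (sq_nonneg _)

theorem rbar_mul_sq_le_psi (P : Params n m) {st : State n m} (hr : ∀ e, 0 < st.rbar e)
    (e : Coord n) : st.rbar e * resid P st e ^ 2 ≤ psi P st :=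
  Finset.single_le_sum (f := fun e => st.rbar e * resid P st e ^ 2)
    (fun e _ => mul_nonneg (hr e).le (sq_nonneg _)) (Finset.mem_univ e)

/-- The factor by which a primal step multiplies a weight. -/
noncomputable def grow (z : ℝ) : ℝ := if 0 ≤ z then 1 + z + z ^ 2 else 1 / (1 - z)

theorem exp_le_grow {z : ℝ} (hz : z ≤ 1) : Real.exp z ≤ grow z := by
  unfold grow
  split_ifs with h
  · have := Real.abs_exp_sub_one_sub_id_le (x := z) (by rw [abs_of_nonneg h]; exact hz)
    linarith [le_abs_self (Real.exp z - 1 - z)]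
  · push Not at h
    rw [le_div_iff₀ (by linarith)]
    have h1 := Real.add_one_le_exp (-z)
    have h2 : Real.exp z * Real.exp (-z) = 1 := by rw [← Real.exp_add]; simp
    nlinarith [Real.exp_pos z]

theorem grow_le (z : ℝ) : grow z ≤ 1 + z + z ^ 2 := by
  unfold grow
  split_ifs with h
  · exact le_rfl
  · push Not at h
    rw [div_le_iff₀ (by linarith)]
    nlinarith [mul_nonneg_of_nonpos_of_nonpos h.le (by nlinarith [sq_nonneg z] : z * z * 1 * (-1) ≤ 0), sq_nonneg z, pow_pos (neg_pos.2 h) 3]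

theorem le_grow (z : ℝ) : 1 + z ≤ grow z := by
  unfold grow
  split_ifs with h
  · nlinarith [sq_nonneg z]
  · push Not at h
    rw [le_div_iff₀ (by linarith)]
    nlinarith [sq_nonneg z]

theorem grow_pos (z : ℝ) : 0 < grow z := by
  unfold grow
  split_ifs with h
  · positivity
  · push Not at h
    exact div_pos one_pos (by linarith)

theorem le_log_grow {z : ℝ} (hz : z ≤ 1) : z ≤ Real.log (grow z) := by
  rw [Real.le_log_iff_exp_le (grow_pos z)]
  exact exp_le_grow hz

theorem log_grow_le (z : ℝ) : Real.log (grow z) ≤ z + z ^ 2 := by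
  have := Real.log_le_sub_one_of_pos (grow_pos z)
  linarith [grow_le z]

theorem sub_sq_le_log_one_add {y : ℝ} (hy : |y| ≤ 1 / 3) : y - y ^ 2 ≤ Real.log (1 + y) := by
  have h := Real.abs_log_sub_add_sum_range_le (x := -y) (by rw [abs_neg]; linarith) 2
  simp only [Finset.sum_range_succ, Finset.sum_range_zero, abs_neg, sub_neg_eq_add] at h
  norm_num at h
  have h2 : |y| ^ 3 / (1 - |y|) ≤ y ^ 2 / 2 := by
    rw [div_le_iff₀ (by linarith), ← sq_abs y]
    nlinarith [mul_nonneg (sq_nonneg |y|) (abs_nonneg y), mul_nonneg (sq_nonneg |y|) (by linarith : 0 ≤ 1 - 3 * |y|)]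
  linarith [(abs_le.1 h).1]

theorem sq_sum_mul_le {ι : Type*} [Fintype ι] {p f : ι → ℝ} (hp : ∀ e, 0 ≤ p e)
    (hp1 : ∑ e, p e = 1) : (∑ e, p e * f e) ^ 2 ≤ ∑ e, p e * f e ^ 2 := by
  have h := (even_two.convexOn_pow (𝕜 := ℝ)).map_sum_le (t := Finset.univ) (w := p) (p := f)
    (fun e _ => hp e) hp1 (fun _ _ => trivial)
  simpa only [smul_eq_mul] using h

theorem abs_sum_mul_le {ι : Type*} [Fintype ι] {p f : ι → ℝ} (hp : ∀ e, 0 ≤ p e)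
    (hp1 : ∑ e, p e = 1) {c : ℝ} (hf : ∀ e, |f e| ≤ c) : |∑ e, p e * f e| ≤ c := by
  calc |∑ e, p e * f e| ≤ ∑ e, p e * c := by
        refine (Finset.abs_sum_le_sum_abs _ _).trans (Finset.sum_le_sum fun e _ => ?_)
        rw [abs_mul, abs_of_nonneg (hp e)]
        exact mul_le_mul_of_nonneg_left (hf e) (hp e)
    _ = c := by rw [← Finset.sum_mul, hp1, one_mul]

/-- The numerical facts about the parameters on which the analysis of a run rests. -/
structure Nums (P : Params n m) (xbar Kmax : ℝ) : Prop where
  hn : 2 ≤ n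
  hε0 : 0 < P.ε
  hε : P.ε < 1 / 2
  hδ : P.δ = P.ε / 100
  hC : 2 ≤ P.C₃
  hα0 : 0 < P.α
  hα : P.α ≤ P.ε / 1000
  hτ0 : 0 < P.τ
  hρ : 1 ≤ P.ρ
  hx0 : 0 ≤ xbar
  hx : P.α * xbar ≤ 1 / 1000
  hx2 : P.α * xbar ^ 2 ≤ P.ε / (12800 * (1 + Real.log n) ^ 2)
  hcube : P.α ^ 3 * (P.C₃ * P.ρ * (4 * n / P.ε)) ≤ (1 / 1000) ^ 3
  hτρ : 4 * P.C₃ ^ 2 * P.τ < P.ρ ^ 2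
  hwide : P.ρ ≤ √(n / P.ε) → 4 ≤ √(n / P.ε)
  hlog : Real.logb 2 (n / (P.ε * P.ρ)) ≤ 2 * (1 + Real.log n)
  hK0 : 0 ≤ Kmax
  hK : 4 * P.ε / P.τ * (Kmax + 1) ≤ P.ε / (10 ^ 4 * (1 + Real.log n) ^ 2)
  hT : P.ε * P.α * P.T ≤ (1 + Real.log n) / P.ε
  hT' : Real.log n / P.ε ≤ P.ε * P.α * P.T
  hβ : xbar + 2 ≤ P.C₃ * P.ρ
  hκ : 2 / n ≤ 2 * P.ε * P.α * P.C₃ * P.ρ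
  hKx : (16004 * P.C₃ * (1 + Real.log n) ^ 3 * P.ρ / P.ε ^ 2) ^ 3 * (64 * n * (1 + Real.log n) ^ 2) <
    Kmax ^ 3 * (P.ρ ^ 2 * P.ε)

namespace Nums

variable {P : Params n m} {xbar Kmax : ℝ} (hP : Nums P xbar Kmax)

theorem n_pos (hP : Nums P xbar Kmax) : (0 : ℝ) < n := by
  have := hP.hn
  exact_mod_cast (by omega : 0 < n)

theorem two_le_n (hP : Nums P xbar Kmax) : (2 : ℝ) ≤ n := by exact_mod_cast hP.hn

theorem one_le_L (hP : Nums P xbar Kmax) : 1 ≤ 1 + Real.log n := by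
  have := Real.log_nonneg (by linarith [hP.two_le_n] : (1 : ℝ) ≤ n)
  linarith

theorem nonempty (hP : Nums P xbar Kmax) : Nonempty (Coord n) :=
  ⟨Sum.inl ⟨0, by have := hP.hn; omega⟩⟩

end Nums

/-- States at which `rbar` is a good approximation of `r`. -/
structure Near (P : Params n m) (st : State n m) : Prop where
  w_pos : ∀ e, 0 < st.w e
  r_eq : ∀ e, st.r e = st.w e + P.ε / (2 * n) * ∑ f, st.w f
  rbar_pos : ∀ e, 0 < st.rbar e
  near : ∀ e, |Real.log (st.rbar e) - Real.log (st.r e)| ≤ P.ε / 50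

theorem abs_log_sub_le {x y c d : ℝ} (hx : 0 < x) (hy : 0 < y)
    (h : |Real.log x - Real.log y| ≤ c) (hcd : Real.exp c ≤ d) : x ≤ d * y ∧ y ≤ d * x := by
  obtain ⟨h1, h2⟩ := abs_le.1 h
  constructor
  · calc x = Real.exp (Real.log x) := (Real.exp_log hx).symm
      _ ≤ Real.exp (c + Real.log y) := Real.exp_le_exp.2 (by linarith)
      _ = Real.exp c * y := by rw [Real.exp_add, Real.exp_log hy]
      _ ≤ d * y := by gcongr
  · calc y = Real.exp (Real.log y) := (Real.exp_log hy).symm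
      _ ≤ Real.exp (c + Real.log x) := Real.exp_le_exp.2 (by linarith)
      _ = Real.exp c * x := by rw [Real.exp_add, Real.exp_log hx]
      _ ≤ d * x := by gcongr

theorem exp_le_one_add {x : ℝ} (h0 : 0 ≤ x) (h : x ≤ 1 / 4) : Real.exp x ≤ 1 + 5 / 4 * x := by
  have := Real.abs_exp_sub_one_sub_id_le (x := x) (by rw [abs_of_nonneg h0]; linarith)
  nlinarith [le_abs_self (Real.exp x - 1 - x)]

section NearFacts

variable {P : Params n m} {xbar Kmax : ℝ} {st : State n m}

theorem sum_w_pos (hP : Nums P xbar Kmax) (h : Near P st) : 0 < ∑ f, st.w f :=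
  have := hP.nonempty
  Finset.sum_pos (fun f _ => h.w_pos f) Finset.univ_nonempty

theorem Near.r_pos (hP : Nums P xbar Kmax) (h : Near P st) (e : Coord n) : 0 < st.r e := by
  rw [h.r_eq]
  have h1 := h.w_pos e
  have h2 := sum_w_pos hP h
  have h3 := hP.n_pos
  have h4 := hP.hε0
  positivity

theorem Near.rbar_le (hP : Nums P xbar Kmax) (h : Near P st) (e : Coord n) :
    st.rbar e ≤ (1 + P.ε / 40) * st.r e ∧ st.r e ≤ (1 + P.ε / 40) * st.rbar e := by
  refine abs_log_sub_le (h.rbar_pos e) (h.r_pos hP e) (h.near e) ?_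
  have := exp_le_one_add (x := P.ε / 50) (by linarith [hP.hε0]) (by linarith [hP.hε])
  linarith

theorem sum_r_eq (hP : Nums P xbar Kmax) (h : Near P st) :
    ∑ e, st.r e = (1 + P.ε) * ∑ f, st.w f := by
  have := hP.n_pos
  simp_rw [h.r_eq]
  rw [Finset.sum_add_distrib]
  simp only [Finset.sum_const, Finset.card_univ, Fintype.card_sum, Fintype.card_fin, nsmul_eq_mul]
  push_cast
  field_simp
  ring

theorem sum_rbar_le (hP : Nums P xbar Kmax) (h : Near P st) :
    ∑ e, st.rbar e ≤ (1 + P.ε / 40) * ((1 + P.ε) * ∑ f, st.w f) := by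
  rw [← sum_r_eq hP h, Finset.mul_sum]
  exact Finset.sum_le_sum fun e _ => (h.rbar_le hP e).1

variable (hC : Function.Injective P.C.mulVec)
  (hd : IsLeast (Set.range fun x : Fin m → ℝ => ‖P.C.mulVec x - P.d‖) 1)

theorem psi_le_phi (hC : Function.Injective P.C.mulVec)
    (hd : IsLeast (Set.range fun x : Fin m → ℝ => ‖P.C.mulVec x - P.d‖) 1)
    (hP : Nums P xbar Kmax) (h : Near P st) :
    psi P st ≤ (1 + P.ε / 40) * ((1 + P.ε) * ∑ f, st.w f) :=
  (psi_le_sum_rbar P hC hd h.rbar_pos).trans (sum_rbar_le hP h)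

theorem psi_lt_rbar (hC : Function.Injective P.C.mulVec)
    (hd : IsLeast (Set.range fun x : Fin m → ℝ => ‖P.C.mulVec x - P.d‖) 1)
    (hP : Nums P xbar Kmax) (h : Near P st) (e : Coord n) :
    P.ε * psi P st < 4 * n * st.rbar e := by
  have h1 := psi_le_phi hC hd hP h
  have h2 := (h.rbar_le hP e).2
  rw [h.r_eq] at h2
  have h3 := h.w_pos e
  have h4 := hP.n_pos
  have h5 := hP.hε0
  have h6 := hP.hε
  have h7 := sum_w_pos hP h
  set Φ := ∑ f, st.w f
  have h8 : P.ε * Φ < 2 * n * ((1 + P.ε / 40) * st.rbar e) := by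
    have : P.ε / (2 * n) * Φ < (1 + P.ε / 40) * st.rbar e := by linarith
    rw [div_mul_eq_mul_div, div_lt_iff₀ (by positivity)] at this
    linarith
  have h9 : P.ε * psi P st ≤ (1 + P.ε / 40) * (1 + P.ε) * (P.ε * Φ) := by
    have := mul_le_mul_of_nonneg_left h1 h5.le
    linarith
  have h10 : (1 + P.ε / 40) * (1 + P.ε) * (P.ε * Φ) <
      (1 + P.ε / 40) * (1 + P.ε) * (2 * n * ((1 + P.ε / 40) * st.rbar e)) :=
    mul_lt_mul_of_pos_left h8 (by positivity)
  have h11 : (1 + P.ε / 40) * (1 + P.ε) * (1 + P.ε / 40) ≤ 2 := by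
    have a1 : (1 + P.ε / 40) ≤ 81 / 80 := by linarith
    have a2 : (1 + P.ε) ≤ 3 / 2 := by linarith
    calc (1 + P.ε / 40) * (1 + P.ε) * (1 + P.ε / 40) ≤ 81 / 80 * (3 / 2) * (81 / 80) := by gcongr
      _ ≤ 2 := by norm_num
  have h12 := mul_le_mul_of_nonneg_right h11
    (by have := h.rbar_pos e; positivity : 0 ≤ 2 * n * st.rbar e)
  linarith

theorem Near.ok (hC : Function.Injective P.C.mulVec)
    (hd : IsLeast (Set.range fun x : Fin m → ℝ => ‖P.C.mulVec x - P.d‖) 1)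
    (hP : Nums P xbar Kmax) (h : Near P st) : Ok P st :=
  fun e => ⟨h.w_pos e, h.rbar_pos e, (psi_lt_rbar hC hd hP h e).le⟩

theorem psi_pos (hd : IsLeast (Set.range fun x : Fin m → ℝ => ‖P.C.mulVec x - P.d‖) 1)
    (hP : Nums P xbar Kmax) (h : Near P st) : 0 < psi P st := by
  obtain ⟨e, he⟩ := exists_one_le_abs_resid P (by have := hP.hn; omega) hd st
  refine lt_of_lt_of_le ?_ (rbar_mul_sq_le_psi P h.rbar_pos e)
  have := h.rbar_pos e
  rw [← sq_abs]
  positivity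

theorem resid_sq_lt (hC : Function.Injective P.C.mulVec)
    (hd : IsLeast (Set.range fun x : Fin m → ℝ => ‖P.C.mulVec x - P.d‖) 1)
    (hP : Nums P xbar Kmax) (h : Near P st) (e : Coord n) :
    resid P st e ^ 2 < 4 * n / P.ε := by
  have h1 := psi_lt_rbar hC hd hP h e
  have h2 := rbar_mul_sq_le_psi P h.rbar_pos e
  have h3 := h.rbar_pos e
  have h5 := hP.hε0
  rw [lt_div_iff₀ h5]
  have : st.rbar e * (resid P st e ^ 2 * P.ε) < st.rbar e * (4 * n) := by
    nlinarith
  exact lt_of_mul_lt_mul_left this h3.le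

theorem sum_resid_sq_le (hC : Function.Injective P.C.mulVec)
    (hd : IsLeast (Set.range fun x : Fin m → ℝ => ‖P.C.mulVec x - P.d‖) 1)
    (hP : Nums P xbar Kmax) (h : Near P st) (G : Finset (Coord n)) :
    P.ε * psi P st * ∑ e ∈ G, resid P st e ^ 2 ≤
      4 * n * ∑ e ∈ G, st.rbar e * resid P st e ^ 2 := by
  rw [Finset.mul_sum, Finset.mul_sum]
  refine Finset.sum_le_sum fun e _ => ?_
  rw [← mul_assoc]
  exact mul_le_mul_of_nonneg_right (psi_lt_rbar hC hd hP h e).le (sq_nonneg _)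

theorem sum_rbar_sq_le_psi (h : Near P st) (G : Finset (Coord n)) :
    ∑ e ∈ G, st.rbar e * resid P st e ^ 2 ≤ psi P st :=
  Finset.sum_le_sum_of_subset_of_nonneg (Finset.subset_univ _)
    fun e _ _ => mul_nonneg (h.rbar_pos e).le (sq_nonneg _)

theorem sum_resid_sq_univ_le (hC : Function.Injective P.C.mulVec)
    (hd : IsLeast (Set.range fun x : Fin m → ℝ => ‖P.C.mulVec x - P.d‖) 1)
    (hP : Nums P xbar Kmax) (h : Near P st) : ∑ e, resid P st e ^ 2 ≤ 4 * n / P.ε := by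
  have h1 := sum_resid_sq_le hC hd hP h Finset.univ
  have h2 := psi_pos hd hP h
  have h5 := hP.hε0
  rw [le_div_iff₀ h5]
  have h3 : psi P st * ((∑ e, resid P st e ^ 2) * P.ε) ≤ psi P st * (4 * n) := by
    rw [← psi] at h1
    linarith
  exact le_of_mul_le_mul_left h3 h2

theorem isWeight_none (hC : Function.Injective P.C.mulVec)
    (hd : IsLeast (Set.range fun x : Fin m → ℝ => ‖P.C.mulVec x - P.d‖) 1)
    (hP : Nums P xbar Kmax) (h : Near P st) :
    (∀ e, 0 ≤ weight none st e) ∧ ∑ e, weight none st e = 1 :=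
  isWeight_weight P (by have := hP.hn; omega) none st (h.ok hC hd hP)

theorem sum_weight_mul_sq_le (hC : Function.Injective P.C.mulVec)
    (hd : IsLeast (Set.range fun x : Fin m → ℝ => ‖P.C.mulVec x - P.d‖) 1)
    (hP : Nums P xbar Kmax) (h : Near P st) :
    ∑ e, weight none st e * resid P st e ^ 2 ≤ (1 + P.ε) ^ 2 := by
  have h7 := sum_w_pos hP h
  have h5 := hP.hε0
  have h6 := hP.hε
  have h1 := psi_le_phi hC hd hP h
  have h2 : ∑ e, st.w e * resid P st e ^ 2 ≤ (1 + P.ε / 40) * psi P st := by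
    rw [psi, Finset.mul_sum]
    refine Finset.sum_le_sum fun e _ => ?_
    rw [← mul_assoc]
    refine mul_le_mul_of_nonneg_right (le_trans ?_ (h.rbar_le hP e).2) (sq_nonneg _)
    rw [h.r_eq]
    have := hP.n_pos
    have : 0 ≤ P.ε / (2 * n) * ∑ f, st.w f := by positivity
    linarith
  have h3 : ∑ e, weight none st e * resid P st e ^ 2 =
      (∑ e, st.w e * resid P st e ^ 2) / ∑ f, st.w f := by
    rw [Finset.sum_div]
    refine Finset.sum_congr rfl fun e _ => ?_
    simp only [weight]
    ring
  rw [h3, div_le_iff₀ h7]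
  have h4 : (1 + P.ε / 40) * psi P st ≤
      (1 + P.ε / 40) * ((1 + P.ε / 40) * ((1 + P.ε) * ∑ f, st.w f)) :=
    mul_le_mul_of_nonneg_left h1 (by positivity)
  have h8 : (1 + P.ε / 40) * (1 + P.ε / 40) ≤ 1 + P.ε := by nlinarith
  have h9 := mul_le_mul_of_nonneg_right h8 (by positivity : 0 ≤ (1 + P.ε) * ∑ f, st.w f)
  linarith

theorem abs_sum_weight_mul_le (hC : Function.Injective P.C.mulVec)
    (hd : IsLeast (Set.range fun x : Fin m → ℝ => ‖P.C.mulVec x - P.d‖) 1)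
    (hP : Nums P xbar Kmax) (h : Near P st) :
    |∑ e, weight none st e * resid P st e| ≤ 1 + P.ε := by
  obtain ⟨h1, h2⟩ := isWeight_none hC hd hP h
  exact abs_le_of_sq_le_sq ((sq_sum_mul_le h1 h2).trans (sum_weight_mul_sq_le hC hd hP h))
    (by linarith [hP.hε0])

end NearFacts

/-- The exponent of the multiplicative update of a primal step. -/
noncomputable def expo (P : Params n m) (sk : Matrix (Fin P.b) (Coord n) ℝ) (st : State n m)
    (e : Coord n) : ℝ := P.ε * P.α * sketchedResid P sk st e

theorem primalW_eq (P : Params n m) (sk : Matrix (Fin P.b) (Coord n) ℝ) (st : State n m)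
    (hε : 0 < P.ε) (hα : 0 < P.α) (e : Coord n) :
    primalW P sk st e = st.w e * grow (expo P sk st e) := by
  have hεα : 0 < P.ε * P.α := mul_pos hε hα
  unfold primalW stepSize grow expo
  have : 0 ≤ sketchedResid P sk st e ↔ 0 ≤ P.ε * P.α * sketchedResid P sk st e :=
    (mul_nonneg_iff_of_pos_left hεα).symm
  by_cases h : 0 ≤ sketchedResid P sk st e
  · rw [if_pos h, if_pos (this.1 h)]
    ring
  · rw [if_neg h, if_neg (fun h' => h (this.2 h'))]
    have h1 : P.ε * P.α * sketchedResid P sk st e < 0 := by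
      push Not at h
      exact mul_neg_of_pos_of_neg hεα h
    have h2 : 1 - P.ε * P.α * sketchedResid P sk st e ≠ 0 := by linarith
    field_simp
    ring

theorem primalW_pos (P : Params n m) (sk : Matrix (Fin P.b) (Coord n) ℝ) {st : State n m}
    (hε : 0 < P.ε) (hα : 0 < P.α) (hw : ∀ e, 0 < st.w e) (e : Coord n) :
    0 < primalW P sk st e := by
  rw [primalW_eq P sk st hε hα]
  exact mul_pos (hw e) (grow_pos _)

section Primal

variable {P : Params n m} {xbar Kmax : ℝ} {st : State n m} {sk : Matrix (Fin P.b) (Coord n) ℝ}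

theorem sketchedResid_eq (e : Coord n) :
    sketchedResid P sk st e = resid P st e + noise P sk st e := by
  unfold noise; ring

theorem alpha_mul_resid_le (hC : Function.Injective P.C.mulVec)
    (hd : IsLeast (Set.range fun x : Fin m → ℝ => ‖P.C.mulVec x - P.d‖) 1)
    (hP : Nums P xbar Kmax) (h : Near P st) (ht : PrimalTest P st) (e : Coord n) :
    P.α * |resid P st e| ≤ 1 / 1000 := by
  have h0 := h.rbar_pos e
  have h1 : st.rbar e * |resid P st e| ^ 3 ≤ P.C₃ * P.ρ * psi P st :=
    (Finset.single_le_sum (f := fun e => st.rbar e * |resid P st e| ^ 3)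
      (fun e _ => mul_nonneg (h.rbar_pos e).le (by positivity)) (Finset.mem_univ e)).trans ht
  have h2 := psi_lt_rbar hC hd hP h e
  have h3 : 0 ≤ P.C₃ * P.ρ := mul_nonneg (by linarith [hP.hC]) (by linarith [hP.hρ])
  have h5 := hP.hε0
  have h4 : |resid P st e| ^ 3 ≤ P.C₃ * P.ρ * (4 * n / P.ε) := by
    have h6 : psi P st ≤ st.rbar e * (4 * n / P.ε) := by
      rw [mul_div_assoc', le_div_iff₀ h5]; linarith
    have h7 : st.rbar e * |resid P st e| ^ 3 ≤ st.rbar e * (P.C₃ * P.ρ * (4 * n / P.ε)) := by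
      calc _ ≤ _ := h1
        _ ≤ P.C₃ * P.ρ * (st.rbar e * (4 * n / P.ε)) := mul_le_mul_of_nonneg_left h6 h3
        _ = _ := by ring
    exact le_of_mul_le_mul_left h7 h0
  have h8 : (P.α * |resid P st e|) ^ 3 ≤ (1 / 1000) ^ 3 := by
    rw [mul_pow]
    exact (mul_le_mul_of_nonneg_left h4 (pow_pos hP.hα0 3).le).trans hP.hcube
  exact le_of_pow_le_pow_left₀ (by norm_num) (by norm_num) h8

theorem abs_expo_le (hP : Nums P xbar Kmax) (hN : ∀ e, |noise P sk st e| ≤ xbar) (e : Coord n) :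
    |expo P sk st e| ≤ P.ε * P.α * (|resid P st e| + xbar) := by
  have h1 : 0 < P.ε * P.α := mul_pos hP.hε0 hP.hα0
  rw [expo, abs_mul, abs_of_pos h1, sketchedResid_eq]
  exact mul_le_mul_of_nonneg_left ((abs_add_le _ _).trans (by linarith [hN e])) h1.le

theorem expo_small (hP : Nums P xbar Kmax) {u : ℝ} (hu : P.α * u ≤ 1 / 1000) :
    P.ε * P.α * (u + xbar) ≤ P.ε / 500 := by
  have := mul_le_mul_of_nonneg_left (add_le_add hu hP.hx) hP.hε0.le
  linarith

theorem log_primalW (hP : Nums P xbar Kmax) (h : Near P st)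
    (hz : expo P sk st e ≤ 1) :
    expo P sk st e ≤ Real.log (primalW P sk st e) - Real.log (st.w e) ∧
    Real.log (primalW P sk st e) - Real.log (st.w e) ≤ expo P sk st e + expo P sk st e ^ 2 := by
  have h1 : Real.log (primalW P sk st e) - Real.log (st.w e) = Real.log (grow (expo P sk st e)) := by
    rw [primalW_eq P sk st hP.hε0 hP.hα0, Real.log_mul (h.w_pos e).ne' (grow_pos _).ne']
    ring
  rw [h1]
  exact ⟨le_log_grow hz, log_grow_le _⟩

theorem sum_expo_sq_le (hC : Function.Injective P.C.mulVec)
    (hd : IsLeast (Set.range fun x : Fin m → ℝ => ‖P.C.mulVec x - P.d‖) 1)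
    (hP : Nums P xbar Kmax) (h : Near P st) (hN : ∀ e, |noise P sk st e| ≤ xbar) :
    ∑ e, weight none st e * expo P sk st e ^ 2 ≤ (P.ε * P.α) ^ 2 * (9 / 2 + 2 * xbar ^ 2) := by
  obtain ⟨hp0, hp1⟩ := isWeight_none hC hd hP h
  have h1 := sum_weight_mul_sq_le hC hd hP h
  have h2 : ∀ e, weight none st e * expo P sk st e ^ 2 ≤
      (P.ε * P.α) ^ 2 * (2 * (weight none st e * resid P st e ^ 2) +
        2 * xbar ^ 2 * weight none st e) := by
    intro e
    have h3 : noise P sk st e ^ 2 ≤ xbar ^ 2 := by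
      rw [← sq_abs]; exact pow_le_pow_left₀ (abs_nonneg _) (hN e) 2
    have h4 : sketchedResid P sk st e ^ 2 ≤ 2 * resid P st e ^ 2 + 2 * xbar ^ 2 := by
      rw [sketchedResid_eq]
      nlinarith [sq_nonneg (resid P st e - noise P sk st e)]
    rw [expo, mul_pow]
    have := mul_le_mul_of_nonneg_left h4
      (mul_nonneg (hp0 e) (sq_nonneg (P.ε * P.α)))
    linarith
  refine (Finset.sum_le_sum fun e _ => h2 e).trans ?_
  rw [← Finset.mul_sum, Finset.sum_add_distrib, ← Finset.mul_sum, ← Finset.mul_sum, hp1]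
  refine mul_le_mul_of_nonneg_left ?_ (sq_nonneg _)
  have : (1 + P.ε) ^ 2 ≤ 9 / 4 := by nlinarith [hP.hε, hP.hε0]
  linarith

/-- The second order terms of a primal step. -/
theorem second_order_le (hP : Nums P xbar Kmax) :
    P.ε * P.α * (9 / 2 + 2 * xbar ^ 2) ≤ P.ε ^ 2 / 50 := by
  have h1 := hP.hx2
  have h2 : P.ε / (12800 * (1 + Real.log n) ^ 2) ≤ P.ε / 12800 := by
    have := hP.one_le_L
    refine div_le_div_of_nonneg_left hP.hε0.le (by norm_num) ?_
    nlinarith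
  have h3 := hP.hα
  have h4 : P.α * (9 / 2 + 2 * xbar ^ 2) ≤ P.ε / 50 := by linarith [hP.hε0]
  have := mul_le_mul_of_nonneg_left h4 hP.hε0.le
  linarith

theorem sum_primalW (hP : Nums P xbar Kmax) (h : Near P st) :
    ∑ e, primalW P sk st e = (∑ f, st.w f) * ∑ e, weight none st e * grow (expo P sk st e) := by
  rw [Finset.mul_sum]
  refine Finset.sum_congr rfl fun e _ => ?_
  have := (sum_w_pos hP h).ne'
  rw [primalW_eq P sk st hP.hε0 hP.hα0]
  simp only [weight]
  field_simp

theorem log_sum_primalW (hC : Function.Injective P.C.mulVec)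
    (hd : IsLeast (Set.range fun x : Fin m → ℝ => ‖P.C.mulVec x - P.d‖) 1)
    (hP : Nums P xbar Kmax) (h : Near P st) (hN : ∀ e, |noise P sk st e| ≤ xbar) :
    |Real.log (∑ e, primalW P sk st e) - Real.log (∑ e, st.w e) -
      P.ε * P.α * (∑ e, weight none st e * resid P st e + ∑ e, weight none st e * noise P sk st e)|
      ≤ P.ε * P.α * (P.ε ^ 2 / 50 / P.ε) := by
  obtain ⟨hp0, hp1⟩ := isWeight_none hC hd hP h
  have hεα : 0 < P.ε * P.α := mul_pos hP.hε0 hP.hα0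
  set q1 := ∑ e, weight none st e * expo P sk st e with hq1
  set q2 := ∑ e, weight none st e * expo P sk st e ^ 2 with hq2
  have hq1' : P.ε * P.α * (∑ e, weight none st e * resid P st e +
      ∑ e, weight none st e * noise P sk st e) = q1 := by
    rw [hq1, ← Finset.sum_add_distrib, Finset.mul_sum]
    refine Finset.sum_congr rfl fun e _ => ?_
    rw [expo, sketchedResid_eq]; ring
  have hq2' : q2 ≤ P.ε * P.α * (P.ε ^ 2 / 50 / P.ε) := by
    refine (sum_expo_sq_le hC hd hP h hN).trans ?_
    rw [sq, mul_assoc]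
    refine mul_le_mul_of_nonneg_left ?_ hεα.le
    have h1 := second_order_le hP
    have h2 : P.ε ^ 2 / 50 / P.ε = P.ε / 50 := by have := hP.hε0.ne'; field_simp
    rw [h2]
    have : P.ε ^ 2 ≤ P.ε := by nlinarith [hP.hε, hP.hε0]
    linarith
  have hq1a : |q1| ≤ 1 / 3 := by
    rw [← hq1', abs_mul, abs_of_pos hεα]
    have h1 := abs_sum_weight_mul_le hC hd hP h
    have h2 := abs_sum_mul_le hp0 hp1 hN
    have h3 := expo_small hP (u := 1 + P.ε) (by nlinarith [hP.hα, hP.hε, hP.hε0, hP.hα0])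
    have h4 := abs_add_le (∑ e, weight none st e * resid P st e)
      (∑ e, weight none st e * noise P sk st e)
    have h5 := mul_le_mul_of_nonneg_left (h4.trans (add_le_add h1 h2)) hεα.le
    linarith [hP.hε]
  have hpos := sum_w_pos hP h
  have hlow : 1 + q1 ≤ ∑ e, weight none st e * grow (expo P sk st e) := by
    rw [hq1, ← hp1, ← Finset.sum_add_distrib]
    refine Finset.sum_le_sum fun e _ => ?_
    have := mul_le_mul_of_nonneg_left (le_grow (expo P sk st e)) (hp0 e)
    linarith
  have hup : ∑ e, weight none st e * grow (expo P sk st e) ≤ 1 + q1 + q2 := by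
    rw [hq1, hq2, ← hp1, ← Finset.sum_add_distrib, ← Finset.sum_add_distrib]
    refine Finset.sum_le_sum fun e _ => ?_
    have := mul_le_mul_of_nonneg_left (grow_le (expo P sk st e)) (hp0 e)
    linarith
  have h1q : 0 < 1 + q1 := by linarith [(abs_le.1 hq1a).1]
  have hgpos := h1q.trans_le hlow
  rw [hq1', sum_primalW hP h, Real.log_mul hpos.ne' hgpos.ne']
  have h2 := sub_sq_le_log_one_add hq1a
  have h3 := Real.log_le_log h1q hlow
  have h4 := Real.log_le_sub_one_of_pos hgpos
  have h5 : q1 ^ 2 ≤ q2 := sq_sum_mul_le hp0 hp1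
  rw [abs_le]
  constructor <;> linarith

theorem abs_log_ratio_le {a a' c c' K : ℝ} (ha : 0 < a) (ha' : 0 < a') (hc : 0 < c) (hc' : 0 < c')
    (h1 : |Real.log a' - Real.log a| ≤ K) (h2 : |Real.log c' - Real.log c| ≤ K) :
    |Real.log (a' + c') - Real.log (a + c)| ≤ K := by
  obtain ⟨p1, p2⟩ := abs_log_sub_le ha' ha h1 le_rfl
  obtain ⟨p3, p4⟩ := abs_log_sub_le hc' hc h2 le_rfl
  have hK := Real.exp_pos K
  have e1 : a' + c' ≤ Real.exp K * (a + c) := by linarith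
  have e2 : a + c ≤ Real.exp K * (a' + c') := by linarith
  have l1 := Real.log_le_log (by positivity) e1
  have l2 := Real.log_le_log (by positivity) e2
  rw [Real.log_mul hK.ne' (by positivity), Real.log_exp] at l1 l2
  rw [abs_le]
  constructor <;> linarith

theorem log_r_step {S S' : State n m} (hn : 0 < n) (hε : 0 < P.ε) {e : Coord n}
    (hw : ∀ f, 0 < S.w f) (hw' : ∀ f, 0 < S'.w f)
    (hr : S.r e = S.w e + P.ε / (2 * n) * ∑ f, S.w f)
    (hr' : S'.r e = S'.w e + P.ε / (2 * n) * ∑ f, S'.w f) {K : ℝ}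
    (h1 : |Real.log (S'.w e) - Real.log (S.w e)| ≤ K)
    (h2 : |Real.log (∑ f, S'.w f) - Real.log (∑ f, S.w f)| ≤ K) :
    |Real.log (S'.r e) - Real.log (S.r e)| ≤ K := by
  have hn' : (0 : ℝ) < n := by exact_mod_cast hn
  have : Nonempty (Coord n) := ⟨e⟩
  have hs : 0 < ∑ f, S.w f := Finset.sum_pos (fun f _ => hw f) Finset.univ_nonempty
  have hs' : 0 < ∑ f, S'.w f := Finset.sum_pos (fun f _ => hw' f) Finset.univ_nonempty
  have hc : 0 < P.ε / (2 * n) := by positivity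
  rw [hr, hr']
  refine abs_log_ratio_le (hw e) (hw' e) (mul_pos hc hs) (mul_pos hc hs') h1 ?_
  rw [Real.log_mul hc.ne' hs.ne', Real.log_mul hc.ne' hs'.ne']
  simpa using h2

theorem primalStep_log_r (hC : Function.Injective P.C.mulVec)
    (hd : IsLeast (Set.range fun x : Fin m → ℝ => ‖P.C.mulVec x - P.d‖) 1)
    (hP : Nums P xbar Kmax) (h : Near P st) (ht : PrimalTest P st)
    (hN : ∀ e, |noise P sk st e| ≤ xbar) (e : Coord n) :
    |Real.log ((primalStep P sk st).r e) - Real.log (st.r e)| ≤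
      2 * P.ε * P.α * |resid P st e| + 2 * P.ε * P.α * (xbar + 2) := by
  have hεα : 0 < P.ε * P.α := mul_pos hP.hε0 hP.hα0
  have hz := abs_expo_le hP hN e
  have hz2 := expo_small hP (alpha_mul_resid_le hC hd hP h ht e)
  have hε := hP.hε
  have hε0 := hP.hε0
  have hz3 := abs_le.1 (hz.trans hz2)
  have hx0 := hP.hx0
  have hu0 := abs_nonneg (resid P st e)
  have hux : 0 ≤ P.ε * P.α * (|resid P st e| + xbar) := by positivity
  refine log_r_step (S := st) (S' := primalStep P sk st) (by have := hP.hn; omega) hP.hε0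
    h.w_pos (primalW_pos P sk hP.hε0 hP.hα0 h.w_pos) (h.r_eq e) rfl ?_ ?_
  · obtain ⟨h1, h2⟩ := log_primalW hP h (sk := sk) (e := e) (by linarith)
    change |Real.log (primalW P sk st e) - Real.log (st.w e)| ≤ _
    have h3 : expo P sk st e ^ 2 ≤ P.ε * P.α * (|resid P st e| + xbar) := by
      rw [← sq_abs]
      nlinarith [abs_nonneg (expo P sk st e)]
    obtain ⟨h4, h5⟩ := abs_le.1 hz
    rw [abs_le]
    constructor <;> nlinarith
  · have h1 := abs_le.1 (log_sum_primalW hC hd hP h hN)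
    change |Real.log (∑ e, primalW P sk st e) - Real.log (∑ e, st.w e)| ≤ _
    obtain ⟨hp0, hp1⟩ := isWeight_none hC hd hP h
    have h2 := abs_le.1 (abs_sum_weight_mul_le hC hd hP h)
    have h3 := abs_le.1 (abs_sum_mul_le hp0 hp1 hN)
    have h4 : P.ε ^ 2 / 50 / P.ε = P.ε / 50 := by have := hP.hε0.ne'; field_simp
    rw [h4] at h1
    set a := ∑ e, weight none st e * resid P st e
    set c := ∑ e, weight none st e * noise P sk st e
    have h5 : P.ε * P.α * (a + c) ≤ P.ε * P.α * (3 / 2 + xbar) :=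
      mul_le_mul_of_nonneg_left (by linarith) hεα.le
    have h6 : P.ε * P.α * (-(3 / 2 + xbar)) ≤ P.ε * P.α * (a + c) :=
      mul_le_mul_of_nonneg_left (by linarith) hεα.le
    have h7 : P.ε * P.α * (P.ε / 50) ≤ P.ε * P.α * (1 / 2) :=
      mul_le_mul_of_nonneg_left (by linarith) hεα.le
    have h8 : 0 ≤ P.ε * P.α * xbar := by positivity
    have h9 : 0 ≤ P.ε * P.α * |resid P st e| := by positivity
    rw [abs_le]
    constructor <;> linarith

theorem primal_cost_le (hC : Function.Injective P.C.mulVec)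
    (hd : IsLeast (Set.range fun x : Fin m → ℝ => ‖P.C.mulVec x - P.d‖) 1)
    (hP : Nums P xbar Kmax) (h : Near P st) (ht : PrimalTest P st) (e : Coord n) :
    2 * P.ε * P.α * |resid P st e| + 2 * P.ε * P.α * (xbar + 2) ≤ P.ε / 100 := by
  have h1 := expo_small hP (alpha_mul_resid_le hC hd hP h ht e)
  have h2 : P.ε * P.α ≤ P.ε * (1 / 2000) :=
    mul_le_mul_of_nonneg_left (by linarith [hP.hα, hP.hε]) hP.hε0.le
  linarith [hP.hε0]

end Primal

section Width

variable {P : Params n m} {xbar Kmax : ℝ} {st : State n m} {rule : Rule n m}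

theorem abs_resid_lt (hC : Function.Injective P.C.mulVec)
    (hd : IsLeast (Set.range fun x : Fin m → ℝ => ‖P.C.mulVec x - P.d‖) 1)
    (hP : Nums P xbar Kmax) (h : Near P st) (e : Coord n) :
    |resid P st e| < 2 * √(n / P.ε) := by
  have h1 := resid_sq_lt hC hd hP h e
  have h2 := hP.n_pos
  have h3 := hP.hε0
  refine abs_lt_of_sq_lt_sq ?_ (by positivity)
  rw [mul_pow, Real.sq_sqrt (by positivity)]
  calc _ < _ := h1
    _ = _ := by ring

theorem rho_le_of_not_primalTest (hC : Function.Injective P.C.mulVec)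
    (hd : IsLeast (Set.range fun x : Fin m → ℝ => ‖P.C.mulVec x - P.d‖) 1)
    (hP : Nums P xbar Kmax) (h : Near P st) (ht : ¬ PrimalTest P st) :
    P.ρ ≤ √(n / P.ε) := by
  by_contra! hlt
  apply ht
  unfold PrimalTest psi
  rw [Finset.mul_sum]
  refine Finset.sum_le_sum fun e _ => ?_
  have h1 := abs_resid_lt hC hd hP h e
  have h2 : |resid P st e| ≤ P.C₃ * P.ρ := by nlinarith [hP.hC, hP.hρ]
  have h3 := mul_le_mul_of_nonneg_left h2
    (mul_nonneg (h.rbar_pos e).le (sq_nonneg (|resid P st e|)))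
  calc st.rbar e * |resid P st e| ^ 3 = st.rbar e * |resid P st e| ^ 2 * |resid P st e| := by ring
    _ ≤ _ := h3
    _ = P.C₃ * P.ρ * (st.rbar e * resid P st e ^ 2) := by rw [sq_abs]; ring

theorem cRho_spec (hP : Nums P xbar Kmax) : √(n / P.ε) ≤ 2 ^ cRho P * P.ρ := by
  refine Nat.sInf_mem (s := {c : ℕ | √(n / P.ε) ≤ 2 ^ c * P.ρ}) ?_
  obtain ⟨c, hc⟩ := pow_unbounded_of_one_lt (√(n / P.ε)) (one_lt_two (α := ℝ))
  refine ⟨c, hc.le.trans ?_⟩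
  exact le_mul_of_one_le_right (by positivity) hP.hρ

theorem cRho_add_one_le (hP : Nums P xbar Kmax) (h : P.ρ ≤ √(n / P.ε)) :
    (cRho P : ℝ) + 1 ≤ Real.logb 2 (n / (P.ε * P.ρ)) := by
  have hρ := hP.hρ
  have hε := hP.hε0
  have hn := hP.n_pos
  have h4 := hP.hwide h
  set q := √(n / P.ε) with hq
  have hq2 : q ^ 2 = n / P.ε := Real.sq_sqrt (by positivity)
  have h5 : (n : ℝ) / (P.ε * P.ρ) = q ^ 2 / P.ρ := by rw [hq2]; field_simp
  rw [Real.le_logb_iff_rpow_le one_lt_two (by positivity), h5, le_div_iff₀ (by linarith)]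
  have h6 : (2 : ℝ) ^ ((cRho P : ℝ) + 1) = 2 ^ (cRho P + 1) := by
    rw [← Real.rpow_natCast]; push_cast; rfl
  rw [h6]
  rcases Nat.eq_zero_or_pos (cRho P) with h0 | h0
  · rw [h0]; norm_num; nlinarith
  · have h7 : ¬ (q ≤ 2 ^ (cRho P - 1) * P.ρ) := by
      intro h8
      have : cRho P ≤ cRho P - 1 := Nat.sInf_le h8
      omega
    push Not at h7
    have h9 : (2 : ℝ) ^ (cRho P + 1) = 4 * 2 ^ (cRho P - 1) := by
      rw [show cRho P + 1 = (cRho P - 1) + 2 by omega, pow_add]; ring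
    rw [h9]
    nlinarith

theorem sum_large_rbar_le (hP : Nums P xbar Kmax) (h : Near P st) :
    ∑ e ∈ large P st, st.rbar e ≤ P.τ⁻¹ * psi P st := by
  have hC3 := hP.hC
  have hρ := hP.hρ
  have hpsi := psi_nonneg P h.rbar_pos
  have h1 : (P.ρ / (2 * P.C₃)) ^ 2 * ∑ e ∈ large P st, st.rbar e ≤ psi P st := by
    refine le_trans ?_ (sum_rbar_sq_le_psi h (large P st))
    rw [Finset.mul_sum]
    refine Finset.sum_le_sum fun e he => ?_
    have h2 : P.ρ / (2 * P.C₃) ≤ |resid P st e| := (Finset.mem_filter.1 he).2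
    rw [mul_comm, ← sq_abs (resid P st e)]
    exact mul_le_mul_of_nonneg_left (pow_le_pow_left₀ (by positivity) h2 2) (h.rbar_pos e).le
  have h3 : P.τ ≤ (P.ρ / (2 * P.C₃)) ^ 2 := by
    rw [div_pow, le_div_iff₀ (by positivity)]
    nlinarith [hP.hτρ]
  have h4 : 0 ≤ ∑ e ∈ large P st, st.rbar e := Finset.sum_nonneg fun e _ => (h.rbar_pos e).le
  rw [inv_mul_eq_div, le_div_iff₀ hP.hτ0]
  nlinarith

theorem card_large_le (hC : Function.Injective P.C.mulVec)
    (hd : IsLeast (Set.range fun x : Fin m → ℝ => ‖P.C.mulVec x - P.d‖) 1)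
    (hP : Nums P xbar Kmax) (h : Near P st) :
    P.ε * P.ρ ^ 2 * (large P st).card ≤ 16 * P.C₃ ^ 2 * n := by
  have hC3 := hP.hC
  have hρ := hP.hρ
  have hpsi := psi_pos hd hP h
  have h1 := sum_resid_sq_le hC hd hP h (large P st)
  have h2 := sum_rbar_sq_le_psi h (large P st)
  have h3 : ((large P st).card : ℝ) * (P.ρ / (2 * P.C₃)) ^ 2 ≤
      ∑ e ∈ large P st, resid P st e ^ 2 := by
    rw [← nsmul_eq_mul]
    refine Finset.card_nsmul_le_sum _ _ _ fun e he => ?_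
    have h2 : P.ρ / (2 * P.C₃) ≤ |resid P st e| := (Finset.mem_filter.1 he).2
    rw [← sq_abs (resid P st e)]
    exact pow_le_pow_left₀ (by positivity) h2 2
  have h4 : P.ε * ∑ e ∈ large P st, resid P st e ^ 2 ≤ 4 * n := by
    have : psi P st * (P.ε * ∑ e ∈ large P st, resid P st e ^ 2) ≤ psi P st * (4 * n) := by
      have := mul_le_mul_of_nonneg_left h2 (by positivity : (0 : ℝ) ≤ 4 * n)
      linarith
    exact le_of_mul_le_mul_left this hpsi
  have h5 := mul_le_mul_of_nonneg_left h3 hP.hε0.le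
  have h6 : P.ε * ((large P st).card * (P.ρ / (2 * P.C₃)) ^ 2) * (4 * P.C₃ ^ 2) =
      P.ε * P.ρ ^ 2 * (large P st).card := by
    field_simp
    ring
  rw [← h6]
  calc _ ≤ 4 * n * (4 * P.C₃ ^ 2) := mul_le_mul_of_nonneg_right (h5.trans h4) (by positivity)
    _ = _ := by ring

theorem rule_H_eq_large (hP : Nums P xbar Kmax) (hrule : rule.Valid P) (h : Near P st) :
    rule.H st = large P st := by
  obtain ⟨h1, -⟩ := hrule st (psi_nonneg P h.rbar_pos)
  exact le_antisymm h1.prop.1 (h1.2 ⟨subset_rfl, sum_large_rbar_le hP h⟩ h1.prop.1)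

theorem exists_hit (hC : Function.Injective P.C.mulVec)
    (hd : IsLeast (Set.range fun x : Fin m → ℝ => ‖P.C.mulVec x - P.d‖) 1)
    (hP : Nums P xbar Kmax) (h : Near P st) (ht : ¬ PrimalTest P st) :
    ∃ j, Hit P (large P st) st j := by
  classical
  by_contra! hno
  have hρ := hP.hρ
  have hC3 := hP.hC
  have hpsi := psi_pos hd hP h
  have hc := cRho_add_one_le hP (rho_le_of_not_primalTest hC hd hP h ht)
  set lg := Real.logb 2 (n / (P.ε * P.ρ)) with hlg
  have hlg0 : 0 < lg := by have : (0 : ℝ) ≤ cRho P := Nat.cast_nonneg _; linarith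
  set f : Coord n → ℝ := fun e => st.rbar e * |resid P st e| ^ 3 with hf
  have hf0 : ∀ e, 0 ≤ f e := fun e => mul_nonneg (h.rbar_pos e).le (by positivity)
  have h1 : ∀ j ∈ Finset.range (cRho P + 1), ∑ e ∈ bucket P (large P st) st j, f e ≤
      P.ρ * psi P st / lg := by
    intro j hj
    by_contra! h2
    exact hno j ⟨by simpa [Nat.lt_succ_iff] using hj, h2.le⟩
  have h2 : ∀ e, P.ρ ≤ |resid P st e| → ∃ j ∈ Finset.range (cRho P + 1),
      e ∈ bucket P (large P st) st j := by
    intro e he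
    have hex : ∃ j, |resid P st e| < 2 * (2 ^ j * P.ρ) :=
      ⟨cRho P, (abs_resid_lt hC hd hP h e).trans_le (by linarith [cRho_spec hP])⟩
    refine ⟨Nat.find hex, ?_, ?_⟩
    · rw [Finset.mem_range, Nat.lt_succ_iff]
      exact Nat.find_min' hex ((abs_resid_lt hC hd hP h e).trans_le (by linarith [cRho_spec hP]))
    · unfold bucket large
      rw [Finset.mem_filter, Finset.mem_filter]
      refine ⟨⟨Finset.mem_univ _, le_trans ?_ he⟩, ?_, Nat.find_spec hex⟩
      · rw [div_le_iff₀ (by linarith)]; nlinarith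
      · rcases Nat.eq_zero_or_pos (Nat.find hex) with h0 | h0
        · rw [h0]; simpa using he
        · have h3 := Nat.find_min hex (m := Nat.find hex - 1) (by omega)
          push Not at h3
          refine le_trans (le_of_eq ?_) h3
          conv_lhs => rw [show Nat.find hex = (Nat.find hex - 1) + 1 by omega, pow_succ]
          ring
  have h3 : ∀ e, f e ≤ P.ρ * (st.rbar e * resid P st e ^ 2) +
      ∑ j ∈ Finset.range (cRho P + 1), if e ∈ bucket P (large P st) st j then f e else 0 := by
    intro e
    have hs : 0 ≤ ∑ j ∈ Finset.range (cRho P + 1),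
        if e ∈ bucket P (large P st) st j then f e else 0 :=
      Finset.sum_nonneg fun j _ => by split_ifs; exacts [hf0 e, le_rfl]
    have hr : 0 ≤ st.rbar e * resid P st e ^ 2 := mul_nonneg (h.rbar_pos e).le (sq_nonneg _)
    by_cases he : P.ρ ≤ |resid P st e|
    · obtain ⟨j, hj, hej⟩ := h2 e he
      have := Finset.single_le_sum (f := fun j =>
        if e ∈ bucket P (large P st) st j then f e else 0)
        (fun j _ => by split_ifs; exacts [hf0 e, le_rfl]) hj
      simp only [if_pos hej] at this
      have : 0 ≤ P.ρ * (st.rbar e * resid P st e ^ 2) := by positivity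
      linarith
    · push Not at he
      have : f e ≤ P.ρ * (st.rbar e * resid P st e ^ 2) := by
        have := mul_le_mul_of_nonneg_left he.le hr
        calc f e = st.rbar e * |resid P st e| ^ 2 * |resid P st e| := by simp only [hf]; ring
          _ ≤ _ := by rw [sq_abs]; linarith
      linarith
  have h4 : ∑ e, f e ≤ P.ρ * psi P st + (cRho P + 1) * (P.ρ * psi P st / lg) := by
    refine (Finset.sum_le_sum fun e _ => h3 e).trans ?_
    rw [Finset.sum_add_distrib, ← Finset.mul_sum, ← psi, Finset.sum_comm]
    gcongr
    refine (Finset.sum_le_sum (g := fun _ => P.ρ * psi P st / lg) fun j hj => ?_).trans ?_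
    · rw [← Finset.sum_filter]
      refine le_trans (le_of_eq ?_) (h1 j hj)
      congr 1
      ext e; simp
    · simp
  have h5 : ((cRho P : ℝ) + 1) * (P.ρ * psi P st / lg) ≤ P.ρ * psi P st := by
    rw [mul_div_assoc', div_le_iff₀ hlg0, mul_comm]
    exact mul_le_mul_of_nonneg_left hc (by positivity)
  apply ht
  unfold PrimalTest
  have : 0 ≤ P.ρ * psi P st := by positivity
  nlinarith

/-- The relative energy of the coordinates that a width reduction step updates. -/
noncomputable def energy (P : Params n m) (rule : Rule n m) (st : State n m) : ℝ :=
  (∑ e ∈ widthSet P rule st, st.rbar e * resid P st e ^ 2) / psi P st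

theorem widthSet_eq (hC : Function.Injective P.C.mulVec)
    (hd : IsLeast (Set.range fun x : Fin m → ℝ => ‖P.C.mulVec x - P.d‖) 1)
    (hP : Nums P xbar Kmax) (hrule : rule.Valid P) (h : Near P st) (ht : ¬ PrimalTest P st) :
    ∃ j, Hit P (large P st) st j ∧ widthSet P rule st = bucket P (large P st) st j := by
  have h1 := rule_H_eq_large hP hrule h
  have h2 := exists_hit hC hd hP h ht
  refine ⟨sInf {j | Hit P (large P st) st j}, Nat.sInf_mem h2, ?_⟩
  rw [widthSet, if_neg (not_not.2 h1), h1, if_pos h2]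

theorem energy_le_one (hd : IsLeast (Set.range fun x : Fin m → ℝ => ‖P.C.mulVec x - P.d‖) 1)
    (hP : Nums P xbar Kmax) (h : Near P st) : energy P rule st ≤ 1 :=
  (div_le_one (psi_pos hd hP h)).2 (sum_rbar_sq_le_psi h _)

theorem energy_nonneg (h : Near P st) : 0 ≤ energy P rule st :=
  div_nonneg (Finset.sum_nonneg fun e _ => mul_nonneg (h.rbar_pos e).le (sq_nonneg _))
    (psi_nonneg P h.rbar_pos)

theorem energy_bounds (hC : Function.Injective P.C.mulVec)
    (hd : IsLeast (Set.range fun x : Fin m → ℝ => ‖P.C.mulVec x - P.d‖) 1)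
    (hP : Nums P xbar Kmax) (hrule : rule.Valid P) (h : Near P st) (ht : ¬ PrimalTest P st) :
    P.ρ ^ 2 * P.ε ≤ energy P rule st ^ 3 * (64 * n * (1 + Real.log n) ^ 2) ∧
    P.ρ ^ 2 * P.ε * (widthSet P rule st).card ≤
      64 * n * (1 + Real.log n) ^ 2 * energy P rule st ^ 2 := by
  obtain ⟨j, hj, hG⟩ := widthSet_eq hC hd hP hrule h ht
  have hx0 := energy_nonneg (rule := rule) h
  have hx1 := energy_le_one (rule := rule) hd hP h
  have hρ := hP.hρ
  have hε := hP.hε0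
  have hn := hP.n_pos
  have hL := hP.one_le_L
  have hpsi := psi_pos hd hP h
  have hlg := hP.hlog
  have hc := cRho_add_one_le hP (rho_le_of_not_primalTest hC hd hP h ht)
  set lg := Real.logb 2 (n / (P.ε * P.ρ))
  have hlg0 : 0 < lg := by have : (0 : ℝ) ≤ cRho P := Nat.cast_nonneg _; linarith
  set G := widthSet P rule st with hGdef
  set x := energy P rule st with hx
  set ζ : ℝ := 2 ^ j * P.ρ with hζ
  have hζ0 : 0 < ζ := by positivity
  have hxG : ∑ e ∈ G, st.rbar e * resid P st e ^ 2 = x * psi P st := by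
    rw [hx, energy, div_mul_cancel₀ _ hpsi.ne']
  have hmem : ∀ e ∈ G, ζ ≤ |resid P st e| ∧ |resid P st e| < 2 * ζ := by
    intro e he
    rw [hG] at he
    exact (Finset.mem_filter.1 he).2
  have h1 : P.ρ * psi P st / lg ≤ 2 * ζ * (x * psi P st) := by
    refine hj.2.trans ?_
    rw [← hG, ← hxG, Finset.mul_sum]
    refine Finset.sum_le_sum fun e he => ?_
    have h2 := mul_le_mul_of_nonneg_left (hmem e he).2.le
      (mul_nonneg (h.rbar_pos e).le (sq_nonneg (|resid P st e|)))
    calc st.rbar e * |resid P st e| ^ 3 = st.rbar e * |resid P st e| ^ 2 * |resid P st e| := by ring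
      _ ≤ _ := h2
      _ = _ := by rw [sq_abs]; ring
  have h2 : P.ρ ≤ 4 * ζ * x * (1 + Real.log n) := by
    rw [div_le_iff₀ hlg0] at h1
    have h3 : psi P st * P.ρ ≤ psi P st * (2 * ζ * x * lg) := by linarith
    have h4 := le_of_mul_le_mul_left h3 hpsi
    have h5 := mul_le_mul_of_nonneg_left hlg (by positivity : 0 ≤ 2 * ζ * x)
    linarith
  have h3 : P.ε * ζ ^ 2 * G.card ≤ 4 * n * x := by
    have h4 := sum_resid_sq_le hC hd hP h G
    rw [hxG] at h4
    have h5 : (G.card : ℝ) * ζ ^ 2 ≤ ∑ e ∈ G, resid P st e ^ 2 := by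
      rw [← nsmul_eq_mul]
      refine Finset.card_nsmul_le_sum _ _ _ fun e he => ?_
      rw [← sq_abs (resid P st e)]
      exact pow_le_pow_left₀ hζ0.le (hmem e he).1 2
    have h6 := mul_le_mul_of_nonneg_left h5 (mul_nonneg hε.le hpsi.le)
    have h7 : psi P st * (P.ε * ζ ^ 2 * G.card) ≤ psi P st * (4 * n * x) := by linarith
    exact le_of_mul_le_mul_left h7 hpsi
  have hG1 : (1 : ℝ) ≤ G.card := by
    have : G.Nonempty := by
      rw [Finset.nonempty_iff_ne_empty]
      intro h0
      rw [h0] at hxG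
      have h0' : x = 0 := by
        rcases mul_eq_zero.1 hxG.symm with h' | h'
        · exact h'
        · exact absurd h' hpsi.ne'
      rw [h0'] at h2
      linarith
    exact_mod_cast this.card_pos
  have h2sq : P.ρ ^ 2 ≤ (4 * ζ * x * (1 + Real.log n)) ^ 2 := pow_le_pow_left₀ (by linarith) h2 2
  have h8 : P.ρ ^ 2 * P.ε * G.card ≤ energy P rule st ^ 3 * (64 * n * (1 + Real.log n) ^ 2) := by
    rw [← hx]
    calc P.ρ ^ 2 * P.ε * G.card ≤ (4 * ζ * x * (1 + Real.log n)) ^ 2 * P.ε * G.card := by gcongr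
      _ = 16 * x ^ 2 * (1 + Real.log n) ^ 2 * (P.ε * ζ ^ 2 * G.card) := by ring
      _ ≤ 16 * x ^ 2 * (1 + Real.log n) ^ 2 * (4 * n * x) := by gcongr
      _ = _ := by ring
  refine ⟨le_trans (le_mul_of_one_le_right (by positivity) hG1) h8, h8.trans ?_⟩
  rw [← hx]
  calc x ^ 3 * (64 * n * (1 + Real.log n) ^ 2) =
      x * (x ^ 2 * (64 * n * (1 + Real.log n) ^ 2)) := by ring
    _ ≤ x ^ 2 * (64 * n * (1 + Real.log n) ^ 2) := mul_le_of_le_one_left (by positivity) hx1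
    _ = _ := by ring

theorem phi_eq {w : Coord n → ℝ} (hw : ∀ e, 0 < w e) : phi w = ∑ e, w e :=
  Finset.sum_congr rfl fun e _ => abs_of_pos (hw e)

open Classical in
theorem widthW_eq (h : Near P st) (e : Coord n) :
    widthW P rule st e = st.w e + if e ∈ widthSet P rule st then P.ε * st.r e else 0 := by
  unfold widthW
  split_ifs
  · rw [phi_eq h.w_pos, h.r_eq]; ring
  · simp

theorem le_widthW (hP : Nums P xbar Kmax) (h : Near P st) (e : Coord n) :
    st.w e ≤ widthW P rule st e := by
  classical
  rw [widthW_eq h]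
  have := h.r_pos hP e
  have := hP.hε0
  split_ifs
  · have : 0 < P.ε * st.r e := by positivity
    linarith
  · simp

theorem widthW_pos (hP : Nums P xbar Kmax) (h : Near P st) (e : Coord n) :
    0 < widthW P rule st e := (h.w_pos e).trans_le (le_widthW hP h e)

theorem widthR_eq (hP : Nums P xbar Kmax) (h : Near P st) (e : Coord n) :
    widthR P rule st e = widthW P rule st e + P.ε / (2 * n) * ∑ f, widthW P rule st f := by
  rw [widthR, phi_eq (widthW_pos hP h)]

theorem sum_widthW_eq (h : Near P st) :
    ∑ e, widthW P rule st e = ∑ e, st.w e + P.ε * ∑ e ∈ widthSet P rule st, st.r e := by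
  classical
  simp_rw [widthW_eq h]
  rw [Finset.sum_add_distrib, ← Finset.sum_filter, Finset.mul_sum]
  congr 2
  ext e; simp

theorem log_sum_widthW (hC : Function.Injective P.C.mulVec)
    (hd : IsLeast (Set.range fun x : Fin m → ℝ => ‖P.C.mulVec x - P.d‖) 1)
    (hP : Nums P xbar Kmax) (hrule : rule.Valid P) (h : Near P st) (ht : ¬ PrimalTest P st) :
    Real.log (∑ e, st.w e) ≤ Real.log (∑ e, widthW P rule st e) ∧
    Real.log (∑ e, widthW P rule st e) ≤ Real.log (∑ e, st.w e) + 4 * P.ε / P.τ := by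
  have hpos := sum_w_pos hP h
  have hε := hP.hε0
  have hε2 := hP.hε
  refine ⟨Real.log_le_log hpos (Finset.sum_le_sum fun e _ => le_widthW hP h e), ?_⟩
  obtain ⟨j, -, hG⟩ := widthSet_eq hC hd hP hrule h ht
  have hsub : widthSet P rule st ⊆ large P st := by
    rw [hG]; exact Finset.filter_subset _ _
  have h1 : ∑ e ∈ widthSet P rule st, st.r e ≤ (1 + P.ε / 40) * (P.τ⁻¹ * psi P st) := by
    calc _ ≤ ∑ e ∈ widthSet P rule st, (1 + P.ε / 40) * st.rbar e :=
          Finset.sum_le_sum fun e _ => (h.rbar_le hP e).2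
      _ = (1 + P.ε / 40) * ∑ e ∈ widthSet P rule st, st.rbar e := by rw [Finset.mul_sum]
      _ ≤ (1 + P.ε / 40) * (P.τ⁻¹ * psi P st) := by
          refine mul_le_mul_of_nonneg_left (le_trans ?_ (sum_large_rbar_le hP h)) (by positivity)
          exact Finset.sum_le_sum_of_subset_of_nonneg hsub fun e _ _ => (h.rbar_pos e).le
  have h2 := psi_le_phi hC hd hP h
  set Φ := ∑ e, st.w e
  have h3 : ∑ e ∈ widthSet P rule st, st.r e ≤ 4 / P.τ * Φ := by
    refine h1.trans ?_
    have hτ := hP.hτ0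
    have h4 : (1 + P.ε / 40) * psi P st ≤ 4 * Φ := by
      have h5 := mul_le_mul_of_nonneg_left h2 (by positivity : 0 ≤ 1 + P.ε / 40)
      have h6 : (1 + P.ε / 40) * ((1 + P.ε / 40) * (1 + P.ε)) ≤ 4 := by
        have a1 : 1 + P.ε / 40 ≤ 81 / 80 := by linarith
        have a2 : 1 + P.ε ≤ 3 / 2 := by linarith
        have a3 : (1 + P.ε / 40) * ((1 + P.ε / 40) * (1 + P.ε)) ≤
            81 / 80 * (81 / 80 * (3 / 2)) := by gcongr
        linarith
      have h7 := mul_le_mul_of_nonneg_right h6 hpos.le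
      linarith
    calc _ = P.τ⁻¹ * ((1 + P.ε / 40) * psi P st) := by ring
      _ ≤ P.τ⁻¹ * (4 * Φ) := mul_le_mul_of_nonneg_left h4 (by positivity)
      _ = _ := by ring
  have h4 : ∑ e, widthW P rule st e ≤ (1 + 4 * P.ε / P.τ) * Φ := by
    rw [sum_widthW_eq h]
    have := mul_le_mul_of_nonneg_left h3 hε.le
    calc _ ≤ Φ + P.ε * (4 / P.τ * Φ) := by linarith
      _ = _ := by ring
  have hτ := hP.hτ0
  have hpos1 : 0 < 1 + 4 * P.ε / P.τ := by positivity
  have hpos2 : 0 < ∑ e, widthW P rule st e :=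
    hpos.trans_le (Finset.sum_le_sum fun e _ => le_widthW hP h e)
  have h5 := Real.log_le_log hpos2 h4
  rw [Real.log_mul hpos1.ne' hpos.ne'] at h5
  have h6 := Real.log_le_sub_one_of_pos hpos1
  linarith

theorem le_widthR (hP : Nums P xbar Kmax) (h : Near P st) (e : Coord n) :
    st.r e ≤ widthR P rule st e := by
  rw [h.r_eq, widthR_eq hP h]
  have h1 := le_widthW (rule := rule) hP h e
  have h2 : ∑ f, st.w f ≤ ∑ f, widthW P rule st f :=
    Finset.sum_le_sum fun f _ => le_widthW hP h f
  have := hP.hε0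
  gcongr

theorem le_widthR_of_mem (hP : Nums P xbar Kmax) (h : Near P st) {e : Coord n}
    (he : e ∈ widthSet P rule st) : (1 + P.ε) * st.r e ≤ widthR P rule st e := by
  classical
  rw [widthR_eq hP h, widthW_eq h, if_pos he]
  have h2 : ∑ f, st.w f ≤ ∑ f, widthW P rule st f :=
    Finset.sum_le_sum fun f _ => le_widthW hP h f
  have h3 := mul_le_mul_of_nonneg_left h2
    (by have := hP.hε0; positivity : 0 ≤ P.ε / (2 * n))
  have h4 := h.r_eq e
  linarith

theorem widthStep_log_r (hC : Function.Injective P.C.mulVec)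
    (hd : IsLeast (Set.range fun x : Fin m → ℝ => ‖P.C.mulVec x - P.d‖) 1)
    (hP : Nums P xbar Kmax) (hrule : rule.Valid P) (h : Near P st) (ht : ¬ PrimalTest P st)
    {e : Coord n} (he : e ∉ widthSet P rule st) :
    |Real.log ((widthStep P rule st).r e) - Real.log (st.r e)| ≤ 4 * P.ε / P.τ := by
  classical
  have h1 := log_sum_widthW hC hd hP hrule h ht
  have h0 : 0 ≤ 4 * P.ε / P.τ := by linarith
  refine log_r_step (S := st) (S' := widthStep P rule st) (by have := hP.hn; omega) hP.hε0
    h.w_pos (widthW_pos hP h) (h.r_eq e) (widthR_eq hP h e) ?_ ?_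
  · change |Real.log (widthW P rule st e) - Real.log (st.w e)| ≤ _
    rw [widthW_eq h, if_neg he]
    simpa using h0
  · change |Real.log (∑ e, widthW P rule st e) - Real.log (∑ e, st.w e)| ≤ _
    rw [abs_le]
    constructor <;> linarith

theorem log_psi_widthStep (hC : Function.Injective P.C.mulVec)
    (hd : IsLeast (Set.range fun x : Fin m → ℝ => ‖P.C.mulVec x - P.d‖) 1)
    (hP : Nums P xbar Kmax) (h : Near P st) :
    Real.log (psi P st) + P.ε / 4 * energy P rule st ≤
      Real.log (psi P (widthStep P rule st)) := by
  classical
  have hε := hP.hε0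
  have hε2 := hP.hε
  have hpsi := psi_pos hd hP h
  have hr : ∀ e, (1 + P.ε / 2) * st.rbar e ≤ widthR P rule st e ∨ e ∉ widthSet P rule st := by
    intro e
    by_cases he : e ∈ widthSet P rule st
    · left
      refine le_trans ?_ (le_widthR_of_mem hP h he)
      have h1 := (h.rbar_le hP e).1
      have h2 := h.r_pos hP e
      have h3 : (1 + P.ε / 2) * (1 + P.ε / 40) ≤ 1 + P.ε := by nlinarith
      calc _ ≤ (1 + P.ε / 2) * ((1 + P.ε / 40) * st.r e) := by gcongr
        _ = (1 + P.ε / 2) * (1 + P.ε / 40) * st.r e := by ring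
        _ ≤ _ := by gcongr
    · exact Or.inr he
  have hrb : ∀ e, (widthStep P rule st).rbar e =
      if e ∈ widthSet P rule st then widthR P rule st e else st.rbar e := fun e => rfl
  have hr' : ∀ e, 0 < (widthStep P rule st).rbar e := by
    intro e
    rw [hrb]
    split_ifs
    · exact (h.r_pos hP e).trans_le (le_widthR hP h e)
    · exact h.rbar_pos e
  have h1 := psi_add_le_psi P hC h.rbar_pos hr'
  have h2 : P.ε / 3 * ∑ e ∈ widthSet P rule st, st.rbar e * resid P st e ^ 2 ≤
      ∑ e, (1 - st.rbar e / (widthStep P rule st).rbar e) *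
        (st.rbar e * resid P st e ^ 2) := by
    rw [Finset.mul_sum, ← Finset.sum_subset (Finset.subset_univ (widthSet P rule st))]
    · refine Finset.sum_le_sum fun e he => ?_
      refine mul_le_mul_of_nonneg_right ?_ (mul_nonneg (h.rbar_pos e).le (sq_nonneg _))
      have h3 := (hr e).resolve_right (not_not.2 he)
      have h4 := hr' e
      rw [hrb, if_pos he] at h4 ⊢
      have h5 : st.rbar e / widthR P rule st e ≤ 1 / (1 + P.ε / 2) := by
        rw [div_le_div_iff₀ h4 (by positivity)]; linarith
      have h6 : 1 / (1 + P.ε / 2) ≤ 1 - P.ε / 3 := by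
        rw [div_le_iff₀ (by positivity)]; nlinarith
      linarith
    · intro e _ he
      rw [hrb, if_neg he, div_self (h.rbar_pos e).ne']
      ring
  have h3 : ∑ e ∈ widthSet P rule st, st.rbar e * resid P st e ^ 2 =
      energy P rule st * psi P st := by
    rw [energy, div_mul_cancel₀ _ hpsi.ne']
  rw [h3] at h2
  set x := energy P rule st with hx
  have hx0 : 0 ≤ x := energy_nonneg h
  have hx1 : x ≤ 1 := energy_le_one hd hP h
  have h4 : (1 + P.ε / 3 * x) * psi P st ≤ psi P (widthStep P rule st) := by linarith
  have h5 : 0 < 1 + P.ε / 3 * x := by positivity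
  have h6 := Real.log_le_log (mul_pos h5 hpsi) h4
  rw [Real.log_mul h5.ne' hpsi.ne'] at h6
  have hy : P.ε / 3 * x ≤ 1 / 6 := by nlinarith
  have h7 := sub_sq_le_log_one_add (y := P.ε / 3 * x) (by rw [abs_of_nonneg (by positivity)]; linarith)
  have h8 : (P.ε / 3 * x) ^ 2 ≤ 1 / 6 * (P.ε / 3 * x) := by
    rw [sq]; exact mul_le_mul_of_nonneg_right hy (by positivity)
  have h9 : 0 ≤ P.ε * x := by positivity
  linarith

end Width

section Dyadic

variable {f : ℕ → ℝ} {θ : ℝ} {a i D : ℕ}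

theorem abs_sub_le_of_dyadic_up (hθ : 0 ≤ θ)
    (hstep : ∀ l < D, ∀ x, a ≤ x → x + 2 ^ l ≤ i → 2 ^ l ∣ x + 2 ^ l → |f (x + 2 ^ l) - f x| ≤ θ) :
    ∀ h ≤ D, ∀ x y, a ≤ x → 2 ^ h ∣ x → x ≤ y → y ≤ i → y < x + 2 ^ h → |f y - f x| ≤ h * θ := by
  intro h
  induction h with
  | zero =>
    intro _ x y _ _ h1 _ h2
    have : y = x := by simp at h2; omega
    simp [this]
  | succ h ih =>
    intro hD x y hax hdvd hxy hyi hlt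
    have hd : 2 ^ h ∣ x := (pow_dvd_pow 2 h.le_succ).trans hdvd
    push_cast
    by_cases hy : y < x + 2 ^ h
    · linarith [ih (by omega) x y hax hd hxy hyi hy]
    · have h1 := hstep h hD x hax (by omega) (hd.add (dvd_refl _))
      have h2 := ih (by omega) (x + 2 ^ h) y (by omega) (hd.add (dvd_refl _)) (by omega) hyi
        (by rw [pow_succ] at hlt; omega)
      linarith [abs_sub_le (f y) (f (x + 2 ^ h)) (f x)]

theorem abs_sub_le_of_dyadic_down (hθ : 0 ≤ θ)
    (hstep : ∀ l < D, ∀ x, a ≤ x → x + 2 ^ l ≤ i → 2 ^ l ∣ x + 2 ^ l → |f (x + 2 ^ l) - f x| ≤ θ) :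
    ∀ h ≤ D, ∀ x y, a ≤ x → 2 ^ h ∣ y → x ≤ y → y ≤ i → y < x + 2 ^ h → |f y - f x| ≤ h * θ := by
  intro h
  induction h with
  | zero =>
    intro _ x y _ _ h1 _ h2
    have : y = x := by simp at h2; omega
    simp [this]
  | succ h ih =>
    intro hD x y hax hdvd hxy hyi hlt
    have hd : 2 ^ h ∣ y := (pow_dvd_pow 2 h.le_succ).trans hdvd
    push_cast
    by_cases hy : y < x + 2 ^ h
    · linarith [ih (by omega) x y hax hd hxy hyi hy]
    · have hy' : y - 2 ^ h + 2 ^ h = y := by omega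
      have h1 := hstep h hD (y - 2 ^ h) (by omega) (by omega) (by rw [hy']; exact hd)
      rw [hy'] at h1
      have h2 := ih (by omega) x (y - 2 ^ h) hax (Nat.dvd_sub hd (dvd_refl _)) (by omega)
        (by omega) (by rw [pow_succ] at hlt; omega)
      linarith [abs_sub_le (f y) (f (y - 2 ^ h)) (f x)]

/-- An interval without multiples of `2 ^ D` splits into at most `2 * D` dyadic intervals. -/
theorem abs_sub_le_of_dyadic (hθ : 0 ≤ θ)
    (hstep : ∀ l < D, ∀ x, a ≤ x → x + 2 ^ l ≤ i → 2 ^ l ∣ x + 2 ^ l → |f (x + 2 ^ l) - f x| ≤ θ) :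
    ∀ h ≤ D, ∀ x y, a ≤ x → x ≤ y → y ≤ i → (∀ z, x < z → z ≤ y → ¬ 2 ^ h ∣ z) →
      |f y - f x| ≤ 2 * h * θ := by
  intro h
  induction h with
  | zero =>
    intro _ x y _ h1 _ h2
    have : y = x := by
      by_contra h3
      exact h2 y (by omega) le_rfl (by simp)
    simp [this]
  | succ h ih =>
    intro hD x y hax hxy hyi hno
    push_cast
    by_cases hz : ∀ z, x < z → z ≤ y → ¬ 2 ^ h ∣ z
    · linarith [ih (by omega) x y hax hxy hyi hz]
    push Not at hz
    obtain ⟨z, hxz, hzy, hdz⟩ := hz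
    have hodd : ¬ 2 ^ (h + 1) ∣ z := hno z hxz hzy
    obtain ⟨q, hq⟩ := hdz
    have hq2 : q % 2 = 1 := by
      by_contra h2
      apply hodd
      obtain ⟨r, hr⟩ : 2 ∣ q := by omega
      exact ⟨r, by rw [hq, hr, pow_succ]; ring⟩
    have hup : y < z + 2 ^ h := by
      by_contra h1
      apply hno (z + 2 ^ h) (by omega) (by omega)
      refine ⟨(q + 1) / 2, ?_⟩
      have : q + 1 = 2 * ((q + 1) / 2) := by omega
      rw [pow_succ, mul_assoc, ← this, hq]; ring
    have hpos : 0 < 2 ^ h := by positivity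
    have hdown : z ≤ x + 2 ^ h := by
      by_contra h1
      apply hno (z - 2 ^ h) (by omega) (by omega)
      refine ⟨q / 2, ?_⟩
      have h3 : q = 2 * (q / 2) + 1 := by omega
      have h4 : 2 ^ h * q = 2 ^ (h + 1) * (q / 2) + 2 ^ h := by
        conv_lhs => rw [h3]
        rw [pow_succ]; ring
      omega
    have h1 := abs_sub_le_of_dyadic_up hθ hstep h (by omega) z y (by omega) ⟨q, hq⟩ hzy hyi hup
    have h2 : |f z - f x| ≤ (h + 1) * θ := by
      rcases Nat.eq_or_lt_of_le hdown with h3 | h3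
      · have h4 := hstep h hD x hax (by omega) (by rw [← h3]; exact ⟨q, hq⟩)
        rw [← h3] at h4
        nlinarith [Nat.cast_nonneg (α := ℝ) h]
      · have h4 := abs_sub_le_of_dyadic_down hθ hstep h (by omega) x z hax ⟨q, hq⟩ hxz.le
          (by omega) h3
        linarith
    have h3 := abs_sub_le (f y) (f z) (f x)
    linarith

end Dyadic

section Loss

variable {N ℓ : ℕ} {ψ c g : ℕ → ℝ} {i : ℕ → ℕ} {Pr : ℕ → Prop} [DecidablePred Pr] {κ : ℝ}

/-- The costs in the dyadic windows that end with the primal step `t`. -/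
def windowCost (ℓ : ℕ) (i : ℕ → ℕ) (c : ℕ → ℝ) (t : ℕ) : ℝ :=
  ∑ l ∈ Finset.range ℓ, if 2 ^ l ∣ i t + 1 then
    ∑ t' ∈ Finset.range (t + 1), if i t + 1 ≤ i t' + 2 ^ l then c t' else 0 else 0

theorem windowCost_nonneg (hc : ∀ t, 0 ≤ c t) (t : ℕ) : 0 ≤ windowCost ℓ i c t := by
  refine Finset.sum_nonneg fun l _ => ?_
  split_ifs
  · exact Finset.sum_nonneg fun t' _ => by split_ifs; exacts [hc t', le_rfl]
  · exact le_rfl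

theorem eq_of_dvd_of_near {a x y k : ℕ} (hx : k ∣ x) (hy : k ∣ y) (h1 : a < x)
    (h2 : x ≤ a + k) (h3 : a < y) (h4 : y ≤ a + k) : x = y := by
  obtain ⟨p, rfl⟩ := hx
  obtain ⟨q, rfl⟩ := hy
  have h5 : p < q + 1 := by
    by_contra h
    have : k * (q + 1) ≤ k * p := Nat.mul_le_mul_left k (by omega)
    rw [mul_add] at this
    omega
  have h6 : q < p + 1 := by
    by_contra h
    have : k * (p + 1) ≤ k * q := Nat.mul_le_mul_left k (by omega)
    rw [mul_add] at this
    omega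
  have : p = q := by omega
  rw [this]

/-- Every time lies in at most one window of each length. -/
theorem sum_windowCost_le (hc : ∀ t, 0 ≤ c t) (hmono : Monotone i) {Q R : Finset ℕ}
    (hinj : ∀ t ∈ Q, ∀ t' ∈ Q, i t = i t' → t = t')
    (hR : ∀ t ∈ Q, ∀ l < ℓ, 2 ^ l ∣ i t + 1 → ∀ t' ≤ t, i t + 1 ≤ i t' + 2 ^ l → t' ∈ R) :
    ∑ t ∈ Q, windowCost ℓ i c t ≤ ℓ * ∑ t' ∈ R, c t' := by
  classical
  unfold windowCost
  rw [Finset.sum_comm]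
  have h1 : ∀ l ∈ Finset.range ℓ, ∑ t ∈ Q, (if 2 ^ l ∣ i t + 1 then
      ∑ t' ∈ Finset.range (t + 1), if i t + 1 ≤ i t' + 2 ^ l then c t' else 0 else 0) ≤
      ∑ t' ∈ R, c t' := by
    intro l hl
    have hl' := Finset.mem_range.1 hl
    have h2 : ∀ t ∈ Q, (if 2 ^ l ∣ i t + 1 then
        ∑ t' ∈ Finset.range (t + 1), if i t + 1 ≤ i t' + 2 ^ l then c t' else 0 else 0) =
        ∑ t' ∈ R, if 2 ^ l ∣ i t + 1 ∧ t' ≤ t ∧ i t + 1 ≤ i t' + 2 ^ l then c t' else 0 := by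
      intro t ht
      by_cases hd : 2 ^ l ∣ i t + 1
      · rw [if_pos hd, ← Finset.sum_filter, ← Finset.sum_filter]
        refine Finset.sum_congr ?_ fun _ _ => rfl
        ext t'
        simp only [Finset.mem_filter, Finset.mem_range, Nat.lt_succ_iff, hd, true_and]
        constructor
        · rintro ⟨h3, h4⟩
          exact ⟨hR t ht l hl' hd t' h3 h4, h3, h4⟩
        · rintro ⟨-, h3, h4⟩
          exact ⟨h3, h4⟩
      · rw [if_neg hd]
        simp [hd]
    rw [Finset.sum_congr rfl h2, Finset.sum_comm]
    refine Finset.sum_le_sum fun t' _ => ?_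
    rw [← Finset.sum_filter, Finset.sum_const]
    have hcard : (Q.filter fun t => 2 ^ l ∣ i t + 1 ∧ t' ≤ t ∧ i t + 1 ≤ i t' + 2 ^ l).card ≤ 1 := by
      rw [Finset.card_le_one]
      intro x hx y hy
      rw [Finset.mem_filter] at hx hy
      obtain ⟨hxQ, hx1, hx2, hx3⟩ := hx
      obtain ⟨hyQ, hy1, hy2, hy3⟩ := hy
      have hx4 := hmono hx2
      have hy4 := hmono hy2
      refine hinj x hxQ y hyQ ?_
      have := eq_of_dvd_of_near (a := i t') hx1 hy1 (by omega) hx3 (by omega) hy3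
      omega
    rw [nsmul_eq_mul]
    refine mul_le_of_le_one_left (hc t') ?_
    exact_mod_cast hcard
  refine (Finset.sum_le_sum h1).trans (le_of_eq ?_)
  simp

theorem div_eq_of_window (hmono : Monotone i) {t l : ℕ} (hl : l < ℓ) (hd : 2 ^ l ∣ i t + 1) {t' : ℕ}
    (ht' : t' ≤ t) (h1 : i t + 1 ≤ i t' + 2 ^ l) : i t' / 2 ^ ℓ = i t / 2 ^ ℓ := by
  refine le_antisymm (Nat.div_le_div_right (hmono ht')) ?_
  rw [Nat.le_div_iff_mul_le (by positivity)]
  have h2 : 2 ^ l ∣ i t / 2 ^ ℓ * 2 ^ ℓ := (pow_dvd_pow 2 hl.le).mul_left _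
  have h3 : i t / 2 ^ ℓ * 2 ^ ℓ ≤ i t := Nat.div_mul_le_self _ _
  have h4 : 2 ^ l ≤ i t + 1 - i t / 2 ^ ℓ * 2 ^ ℓ :=
    Nat.le_of_dvd (by omega) (Nat.dvd_sub hd h2)
  omega

theorem le_windowCost (hc : ∀ t, 0 ≤ c t) {t l : ℕ} (hl : l < ℓ) (hd : 2 ^ l ∣ i t + 1) :
    ∑ t' ∈ Finset.range (t + 1), (if i t + 1 ≤ i t' + 2 ^ l then c t' else 0) ≤
      windowCost ℓ i c t := by
  have h := Finset.single_le_sum (s := Finset.range ℓ) (f := fun l => if 2 ^ l ∣ i t + 1 then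
    ∑ t' ∈ Finset.range (t + 1), if i t + 1 ≤ i t' + 2 ^ l then c t' else 0 else 0)
    (fun l _ => by
      split_ifs
      · exact Finset.sum_nonneg fun t' _ => by split_ifs; exacts [hc t', le_rfl]
      · exact le_rfl) (Finset.mem_range.2 hl)
  rw [if_pos hd] at h
  exact h

theorem sum_mul_windowCost_le {ι : Type*} [Fintype ι] {a : ι → ℝ} {f : ι → ℕ → ℝ} {K : ℝ} {t : ℕ}
    (h : ∀ l < ℓ, 2 ^ l ∣ i t + 1 → ∀ t' ≤ t, i t + 1 ≤ i t' + 2 ^ l →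
      ∑ e, a e * f e t' ≤ c t' * K) :
    ∑ e, a e * windowCost ℓ i (f e) t ≤ windowCost ℓ i c t * K := by
  unfold windowCost
  simp_rw [Finset.mul_sum]
  rw [Finset.sum_comm, Finset.sum_mul]
  refine Finset.sum_le_sum fun l hl => ?_
  by_cases hd : 2 ^ l ∣ i t + 1
  · simp only [if_pos hd]
    simp_rw [Finset.mul_sum]
    rw [Finset.sum_comm, Finset.sum_mul]
    refine Finset.sum_le_sum fun t' ht' => ?_
    by_cases h1 : i t + 1 ≤ i t' + 2 ^ l
    · simp only [if_pos h1]
      exact h l (Finset.mem_range.1 hl) hd t' (by have := Finset.mem_range.1 ht'; omega) h1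
    · simp only [if_neg h1, mul_zero, zero_mul, Finset.sum_const_zero, le_refl]
  · simp [if_neg hd]

theorem sum_gain_le (hc : ∀ t, 0 ≤ c t) (hg : ∀ t, 0 ≤ g t)
    (hi : ∀ t, i (t + 1) = if Pr t then i t + 1 else i t)
    (hw : ∀ t < N, ¬ Pr t → ψ t + g t ≤ ψ (t + 1))
    (hcoarse : ∀ t < N, Pr t → 2 ^ ℓ ∣ i t + 1 → ψ t - κ ≤ ψ (t + 1))
    (hfine : ∀ t < N, Pr t → ¬ 2 ^ ℓ ∣ i t + 1 →
      (∀ t' ≤ t, Pr t' → i t' / 2 ^ ℓ = i t / 2 ^ ℓ → ψ t' ≤ ψ t + Real.log 2) →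
      ψ t - windowCost ℓ i c t ≤ ψ (t + 1))
    (hblock : ∀ B, ℓ * ∑ t' ∈ (Finset.range N).filter (fun t' => i t' / 2 ^ ℓ = B), c t' ≤
      Real.log 2) :
    ∑ t ∈ (Finset.range N).filter (fun t => ¬ Pr t), g t ≤ ψ N - ψ 0 +
      κ * ((Finset.range N).filter fun t => Pr t ∧ 2 ^ ℓ ∣ i t + 1).card +
      ℓ * ∑ t ∈ Finset.range N, c t := by
  classical
  have hmono : Monotone i := monotone_nat_of_le_succ fun t => by rw [hi]; split_ifs <;> omega
  have hinj : ∀ t, Pr t → ∀ t', Pr t' → i t = i t' → t = t' := by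
    intro t ht t' ht' h
    rcases lt_trichotomy t t' with h1 | h1 | h1
    · have := hmono (show t + 1 ≤ t' from h1)
      rw [hi, if_pos ht] at this; omega
    · exact h1
    · have := hmono (show t' + 1 ≤ t from h1)
      rw [hi, if_pos ht'] at this; omega
  have hwc := windowCost_nonneg (ℓ := ℓ) (i := i) hc
  have hlow : ∀ t l, l < ℓ → 2 ^ l ∣ i t + 1 → ∀ t' ≤ t, i t + 1 ≤ i t' + 2 ^ l →
      i t' / 2 ^ ℓ = i t / 2 ^ ℓ := by
    intro t l hl hd t' ht' h1
    exact div_eq_of_window hmono hl hd ht' h1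
  have hratio : ∀ t < N, Pr t → ∀ t' ≤ t, Pr t' → i t' / 2 ^ ℓ = i t / 2 ^ ℓ →
      ψ t' ≤ ψ t + Real.log 2 := by
    intro t
    induction t using Nat.strong_induction_on with
    | _ t ih =>
      intro htN htP t' ht't ht'P hblk
      have key : ∀ t₁, t' ≤ t₁ → t₁ ≤ t → ψ t' ≤ ψ t₁ +
          ∑ x ∈ (Finset.Ico t' t₁).filter Pr, windowCost ℓ i c x := by
        intro t₁ h1
        induction t₁, h1 using Nat.le_induction with
        | base => intro _; simp
        | succ t₁ h1 ih1 =>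
          intro h2
          have h3 := ih1 (by omega)
          rw [← Finset.insert_Ico_right_eq_Ico_add_one h1, Finset.filter_insert]
          by_cases hp : Pr t₁
          · rw [if_pos hp, Finset.sum_insert (by simp)]
            have h4 : i t₁ + 1 ≤ i t := by
              have := hmono h2; rwa [hi, if_pos hp] at this
            have h5 : i t' ≤ i t₁ := hmono h1
            have h6 : i t₁ / 2 ^ ℓ = i t / 2 ^ ℓ :=
              le_antisymm (Nat.div_le_div_right (by omega))
                (hblk ▸ Nat.div_le_div_right h5)
            have h7 : ¬ 2 ^ ℓ ∣ i t₁ + 1 := by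
              rintro ⟨q, hq⟩
              have h8 : (i t₁ + 1) / 2 ^ ℓ = q := by rw [hq]; simp
              have h9 : (i t₁ + 1) / 2 ^ ℓ ≤ i t / 2 ^ ℓ := Nat.div_le_div_right h4
              have h10 : i t / 2 ^ ℓ * 2 ^ ℓ ≤ i t' := by
                rw [← hblk]; exact Nat.div_mul_le_self _ _
              have h11 : q * 2 ^ ℓ ≤ i t / 2 ^ ℓ * 2 ^ ℓ := Nat.mul_le_mul_right _ (h8 ▸ h9)
              rw [mul_comm] at hq
              omega
            have h12 := hfine t₁ (by omega) hp h7 (fun t₂ ht₂ hp₂ hb₂ =>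
              ih t₁ (by omega) (by omega) hp t₂ ht₂ hp₂ hb₂)
            linarith
          · rw [if_neg hp]
            have := hw t₁ (by omega) hp
            linarith [hg t₁]
      have h1 := key t ht't le_rfl
      refine h1.trans (add_le_add_right ?_ _)
      refine le_trans ?_ (hblock (i t / 2 ^ ℓ))
      refine sum_windowCost_le hc hmono ?_ ?_
      · intro x hx y hy
        exact hinj x (Finset.mem_filter.1 hx).2 y (Finset.mem_filter.1 hy).2
      · intro x hx l hl hd x' hx' h2
        obtain ⟨hx1, hx2⟩ := Finset.mem_filter.1 hx
        rw [Finset.mem_Ico] at hx1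
        rw [Finset.mem_filter, Finset.mem_range]
        refine ⟨by omega, ?_⟩
        rw [hlow x l hl hd x' hx' h2]
        exact le_antisymm (Nat.div_le_div_right (hmono hx1.2.le))
          (hblk ▸ Nat.div_le_div_right (hmono hx1.1))
  have htotal : ∀ M ≤ N, ∑ t ∈ (Finset.range M).filter (fun t => ¬ Pr t), g t ≤ ψ M - ψ 0 +
      κ * ((Finset.range M).filter fun t => Pr t ∧ 2 ^ ℓ ∣ i t + 1).card +
      ∑ t ∈ (Finset.range M).filter (fun t => Pr t ∧ ¬ 2 ^ ℓ ∣ i t + 1), windowCost ℓ i c t := by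
    intro M
    induction M with
    | zero => intro _; simp
    | succ M ih =>
      intro hM
      have ih' := ih (by omega)
      rw [Finset.range_add_one, Finset.filter_insert, Finset.filter_insert, Finset.filter_insert]
      by_cases hp : Pr M
      · by_cases hd : 2 ^ ℓ ∣ i M + 1
        · rw [if_neg (by simpa using hp), if_pos ⟨hp, hd⟩, if_neg (by tauto),
            Finset.card_insert_of_notMem (by simp)]
          have := hcoarse M hM hp hd
          push_cast
          linarith
        · rw [if_neg (by simpa using hp), if_neg (by tauto), if_pos ⟨hp, hd⟩,
            Finset.sum_insert (by simp)]
          have := hfine M hM hp hd (hratio M hM hp)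
          linarith
      · rw [if_pos hp, if_neg (by tauto), if_neg (by tauto), Finset.sum_insert (by simp)]
        have := hw M hM hp
        linarith
  have h1 := htotal N le_rfl
  have h2 : ∑ t ∈ (Finset.range N).filter (fun t => Pr t ∧ ¬ 2 ^ ℓ ∣ i t + 1), windowCost ℓ i c t ≤
      ℓ * ∑ t ∈ Finset.range N, c t := by
    refine sum_windowCost_le hc hmono ?_ ?_
    · intro x hx y hy
      exact hinj x (Finset.mem_filter.1 hx).2.1 y (Finset.mem_filter.1 hy).2.1
    · intro x hx l hl hd x' hx' h2
      have := Finset.mem_range.1 (Finset.mem_filter.1 hx).1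
      rw [Finset.mem_range]
      omega
  linarith

end Loss

/-- Coordinate `e` is refreshed by `selectVector` after a primal step to index `i` with vector
`r`. -/
def Selected (P : Params n m) (i : ℕ) (st : State n m) (r : Coord n → ℝ) (e : Coord n) : Prop :=
  2 ^ Nat.log 2 n ∣ i ∨
    ∃ l < Nat.log 2 n, 2 ^ l ∣ i ∧
      P.δ / (2 * Real.logb 2 n) ≤ |Real.log (r e / st.rHist (i - 2 ^ l) e)| ∧
      ∀ j ∈ st.lastWidth e, j + 2 ^ l ≤ i

open Classical in
theorem primalStep_rbar (P : Params n m) (sk : Matrix (Fin P.b) (Coord n) ℝ) (st : State n m)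
    (e : Coord n) : (primalStep P sk st).rbar e =
      if Selected P (st.i + 1) st (primalStep P sk st).r e then (primalStep P sk st).r e
      else st.rbar e := by
  change selectVector P.δ (st.i + 1) st.rHist st.lastWidth (primalR P sk st) st.rbar e = _
  unfold selectVector
  by_cases h : Selected P (st.i + 1) st (primalR P sk st) e
  · exact (if_pos h).trans (if_pos h).symm
  · exact (if_neg h).trans (if_neg h).symm

section Run

variable (P : Params n m) (rule : Rule n m) (s : Signs P)

open Classical in
theorem card_isWidth (t : ℕ) :
    ((Finset.range t).filter fun t' => IsWidth P (run P rule s t')).card = (run P rule s t).k := by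
  induction t with
  | zero => rfl
  | succ t ih =>
    rw [Finset.range_add_one, Finset.filter_insert]
    rcases step_cases P (run P rule s t) with h | h | h
    · rw [if_neg (fun h' => h'.2 h.2), ih, run_succ_of_isPrimal P rule s h]; rfl
    · rw [if_pos h, Finset.card_insert_of_notMem (by simp), ih, run_succ_of_isWidth P rule s h]; rfl
    · rw [if_neg (fun h' => absurd h'.1 (not_lt.2 h)), ih, run_succ_of_le P rule s h]

theorem exists_hit_time (t a : ℕ) (ha : a ≤ (run P rule s t).i) :
    ∃ t' ≤ t, (run P rule s t').i = a ∧ (run P rule s t).rHist a = (run P rule s t').r ∧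
      ∀ t'' < t', (run P rule s t'').i < a := by
  induction t with
  | zero =>
    have h0 : a = 0 := Nat.le_zero.1 ha
    exact ⟨0, le_rfl, h0.symm, rfl, fun t'' h => absurd h (by omega)⟩
  | succ t ih =>
    rcases step_cases P (run P rule s t) with h | h | h
    · have h1 := run_succ_of_isPrimal P rule s h
      by_cases h2 : a ≤ (run P rule s t).i
      · obtain ⟨t', h3, h4, h5, h6⟩ := ih h2
        refine ⟨t', by omega, h4, ?_, h6⟩
        rw [h1, ← h5]
        change Function.update _ _ _ a = _
        rw [Function.update_of_ne (by omega)]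
      · have h3 := run_i_succ_of_isPrimal P rule s h
        have h4 : a = (run P rule s t).i + 1 := by omega
        refine ⟨t + 1, le_rfl, by omega, ?_, ?_⟩
        · rw [h1, h4]
          change Function.update _ _ _ _ = _
          rw [Function.update_self]; rfl
        · intro t'' ht''
          have := run_i_mono P rule s (show t'' ≤ t by omega)
          simp only at this
          omega
    · have h1 := run_succ_of_isWidth P rule s h
      rw [h1] at ha
      obtain ⟨t', h3, h4, h5, h6⟩ := ih ha
      exact ⟨t', by omega, h4, by rw [h1, ← h5]; rfl, h6⟩
    · rw [run_succ_of_le P rule s h] at ha ⊢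
      obtain ⟨t', h3, h4, h5, h6⟩ := ih ha
      exact ⟨t', by omega, h4, h5, h6⟩

theorem widthStep_lastWidth_of_mem {st : State n m} {e : Coord n} (he : e ∈ widthSet P rule st) :
    (widthStep P rule st).lastWidth e = some st.i := if_pos he

theorem widthStep_lastWidth_of_notMem {st : State n m} {e : Coord n}
    (he : e ∉ widthSet P rule st) : (widthStep P rule st).lastWidth e = st.lastWidth e := if_neg he

theorem lastWidth_of_mem {t t' : ℕ} (ht : t' < t) (h : IsWidth P (run P rule s t')) {e : Coord n}
    (he : e ∈ widthSet P rule (run P rule s t')) :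
    ∃ j, (run P rule s t).lastWidth e = some j ∧ (run P rule s t').i ≤ j := by
  induction t, (show t' + 1 ≤ t from ht) using Nat.le_induction with
  | base =>
    refine ⟨_, ?_, le_rfl⟩
    rw [run_succ_of_isWidth P rule s h, widthStep_lastWidth_of_mem P rule he]
  | succ t ht1 ih =>
    obtain ⟨j, h1, h2⟩ := ih (by omega)
    rcases step_cases P (run P rule s t) with h' | h' | h'
    · exact ⟨j, by rw [run_succ_of_isPrimal P rule s h']; exact h1, h2⟩
    · rw [run_succ_of_isWidth P rule s h']
      by_cases he' : e ∈ widthSet P rule (run P rule s t)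
      · exact ⟨_, widthStep_lastWidth_of_mem P rule he',
          run_i_mono P rule s (show t' ≤ t by omega)⟩
      · exact ⟨j, by rw [widthStep_lastWidth_of_notMem P rule he']; exact h1, h2⟩
    · exact ⟨j, by rw [run_succ_of_le P rule s h']; exact h1, h2⟩

theorem exists_of_lastWidth {t j : ℕ} {e : Coord n} (h : (run P rule s t).lastWidth e = some j) :
    ∃ t' < t, IsWidth P (run P rule s t') ∧ (run P rule s t').i = j ∧
      e ∈ widthSet P rule (run P rule s t') := by
  induction t with
  | zero => exact absurd h (by simp [run_zero, init])
  | succ t ih =>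
    have old : (run P rule s t).lastWidth e = some j → ∃ t' < t + 1, IsWidth P (run P rule s t') ∧
        (run P rule s t').i = j ∧ e ∈ widthSet P rule (run P rule s t') := fun h' => by
      obtain ⟨t', h1, h2⟩ := ih h'
      exact ⟨t', by omega, h2⟩
    rcases step_cases P (run P rule s t) with h' | h' | h'
    · rw [run_succ_of_isPrimal P rule s h'] at h; exact old h
    · rw [run_succ_of_isWidth P rule s h'] at h
      by_cases he' : e ∈ widthSet P rule (run P rule s t)
      · rw [widthStep_lastWidth_of_mem P rule he'] at h
        exact ⟨t, by omega, h', Option.some.inj h, he'⟩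
      · rw [widthStep_lastWidth_of_notMem P rule he'] at h; exact old h
    · rw [run_succ_of_le P rule s h'] at h; exact old h

theorem lastWidth_le {t j : ℕ} {e : Coord n} (h : (run P rule s t).lastWidth e = some j) :
    j ≤ (run P rule s t).i := by
  obtain ⟨t', h1, -, h2, -⟩ := exists_of_lastWidth P rule s h
  rw [← h2]
  exact run_i_mono P rule s h1.le

open Classical in
/-- The effect of the recent width reduction steps on the coordinates that they do not update. -/
noncomputable def drift (t : ℕ) : ℝ :=
  4 * P.ε / P.τ * ((Finset.range t).filter fun t' =>
    IsWidth P (run P rule s t') ∧ (run P rule s t').i = (run P rule s t).i).card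

/-- Since primal index `a`, when `rbar e` was copied from `r e`, coordinate `e` was updated
neither by a width reduction step nor by `selectVector`. -/
structure Fresh (t : ℕ) (e : Coord n) (a : ℕ) : Prop where
  le : a ≤ (run P rule s t).i
  rbar_eq : (run P rule s t).rbar e = (run P rule s t).rHist a e
  width_lt : ∀ j ∈ (run P rule s t).lastWidth e, j < a
  rbar_const : ∀ t' ≤ t, a ≤ (run P rule s t').i →
    (run P rule s t').rbar e = (run P rule s t).rbar e
  not_top : ∀ x, a < x → x ≤ (run P rule s t).i → ¬ 2 ^ Nat.log 2 n ∣ x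
  small : ∀ x, a < x → x ≤ (run P rule s t).i → ∀ l < Nat.log 2 n, 2 ^ l ∣ x → a + 2 ^ l ≤ x →
    |Real.log ((run P rule s t).rHist x e / (run P rule s t).rHist (x - 2 ^ l) e)| <
      P.δ / (2 * Real.logb 2 n)
  le_r : (run P rule s t).rHist (run P rule s t).i e ≤ (run P rule s t).r e
  r_le : Real.log ((run P rule s t).r e) ≤
    Real.log ((run P rule s t).rHist (run P rule s t).i e) + drift P rule s t

/-- Coordinate `e` was updated by a width reduction step at the current primal index. -/
structure Widened (t : ℕ) (e : Coord n) : Prop where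
  width_eq : (run P rule s t).lastWidth e = some (run P rule s t).i
  le_rbar : (1 + P.ε) * (run P rule s t).rHist (run P rule s t).i e ≤ (run P rule s t).rbar e
  le_r : (run P rule s t).rbar e ≤ (run P rule s t).r e
  r_le : Real.log ((run P rule s t).r e) ≤
    Real.log ((run P rule s t).rbar e) + drift P rule s t

/-- The invariant of `rbar`. -/
def Inv (t : ℕ) : Prop := ∀ e, (∃ a, Fresh P rule s t e a) ∨ Widened P rule s t e

variable {P rule s} {xbar Kmax : ℝ}

theorem drift_nonneg (hP : Nums P xbar Kmax) (t : ℕ) : 0 ≤ drift P rule s t := by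
  have := hP.hε0
  have := hP.hτ0
  unfold drift
  positivity

theorem drift_le (hP : Nums P xbar Kmax) {t : ℕ} (hk : ((run P rule s t).k : ℝ) ≤ Kmax + 1) :
    drift P rule s t ≤ P.ε / 10 ^ 4 := by
  classical
  have h1 := hP.hε0
  have h2 := hP.hτ0
  have h3 := hP.one_le_L
  calc drift P rule s t ≤ 4 * P.ε / P.τ * (run P rule s t).k := by
        unfold drift
        refine mul_le_mul_of_nonneg_left ?_ (by positivity)
        rw [← card_isWidth]
        refine Nat.cast_le.2 (Finset.card_le_card ?_)
        intro t' ht'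
        simp only [Finset.mem_filter] at ht' ⊢
        exact ⟨ht'.1, ht'.2.1⟩
    _ ≤ 4 * P.ε / P.τ * (Kmax + 1) := mul_le_mul_of_nonneg_left hk (by positivity)
    _ ≤ P.ε / (10 ^ 4 * (1 + Real.log n) ^ 2) := hP.hK
    _ ≤ P.ε / 10 ^ 4 := by
        refine div_le_div_of_nonneg_left h1.le (by norm_num) ?_
        nlinarith

theorem drift_succ_of_isWidth {t : ℕ} (h : IsWidth P (run P rule s t)) :
    drift P rule s (t + 1) = drift P rule s t + 4 * P.ε / P.τ := by
  classical
  unfold drift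
  have hi : (run P rule s (t + 1)).i = (run P rule s t).i :=
    run_i_succ_of_not_isPrimal P rule s h.not_isPrimal
  rw [hi, Finset.range_add_one, Finset.filter_insert, if_pos ⟨h, rfl⟩,
    Finset.card_insert_of_notMem (by simp)]
  push_cast
  ring

theorem logb_facts (hP : Nums P xbar Kmax) : 1 ≤ Real.logb 2 n ∧
    Real.logb 2 n ≤ 2 * (1 + Real.log n) ∧ (Nat.log 2 n : ℝ) ≤ Real.logb 2 n ∧
    1 ≤ Nat.log 2 n := by
  have h2 := hP.two_le_n
  have h1 : (1 : ℝ) ≤ Real.logb 2 n := by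
    rw [Real.le_logb_iff_rpow_le one_lt_two (by linarith)]; simpa using h2
  refine ⟨h1, ?_, ?_, ?_⟩
  · have h3 := Real.log_two_gt_d9
    have h4 := hP.one_le_L
    rw [Real.logb, div_le_iff₀ (by linarith)]
    nlinarith
  · rw [Real.le_logb_iff_rpow_le one_lt_two (by linarith), Real.rpow_natCast]
    exact_mod_cast Nat.pow_log_le_self 2 (by have := hP.hn; omega)
  · exact Nat.log_pos one_lt_two hP.hn

theorem rHist_pos (hP : Nums P xbar Kmax) {t : ℕ} (hnear : ∀ t' ≤ t, Near P (run P rule s t'))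
    {a : ℕ} (ha : a ≤ (run P rule s t).i) (e : Coord n) : 0 < (run P rule s t).rHist a e := by
  obtain ⟨t', h1, -, h2, -⟩ := exists_hit_time P rule s t a ha
  rw [h2]
  exact (hnear t' h1).r_pos hP e

theorem Fresh.abs_log_sub_le (hP : Nums P xbar Kmax) {t a : ℕ} {e : Coord n}
    (hpos : ∀ a ≤ (run P rule s t).i, 0 < (run P rule s t).rHist a e)
    (h : Fresh P rule s t e a) {x : ℕ} (hax : a ≤ x) (hx : x ≤ (run P rule s t).i) :
    |Real.log ((run P rule s t).rHist x e) - Real.log ((run P rule s t).rHist a e)| ≤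
      2 * Nat.log 2 n * (P.δ / (2 * Real.logb 2 n)) := by
  obtain ⟨h1, -, h3, -⟩ := logb_facts hP
  have hε := hP.hε0
  have hθ0 : 0 ≤ P.δ / (2 * Real.logb 2 n) := by rw [hP.hδ]; positivity
  exact abs_sub_le_of_dyadic (f := fun x => Real.log ((run P rule s t).rHist x e))
    (a := a) (i := (run P rule s t).i) (D := Nat.log 2 n) hθ0 (by
      intro l hl x hax hxi hdvd
      have h4 := h.small (x + 2 ^ l) (by have : 0 < 2 ^ l := by positivity
                                         omega) hxi l hl hdvd (by omega)
      rw [Nat.add_sub_cancel, Real.log_div (hpos _ hxi).ne' (hpos _ (by omega)).ne'] at h4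
      exact h4.le) (Nat.log 2 n) le_rfl a x le_rfl hax hx
    fun z h1 h2 => h.not_top z h1 (h2.trans hx)

theorem Fresh.abs_log_le (hP : Nums P xbar Kmax) {t a : ℕ} {e : Coord n}
    (hpos : ∀ a ≤ (run P rule s t).i, 0 < (run P rule s t).rHist a e)
    (h : Fresh P rule s t e a) :
    |Real.log ((run P rule s t).rHist (run P rule s t).i e) -
      Real.log ((run P rule s t).rHist a e)| ≤ P.ε / 100 := by
  obtain ⟨h1, -, h3, -⟩ := logb_facts hP
  have hε := hP.hε0
  refine (h.abs_log_sub_le hP hpos h.le le_rfl).trans ?_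
  have hθ0 : 0 ≤ P.δ / (2 * Real.logb 2 n) := by rw [hP.hδ]; positivity
  have h5 := mul_le_mul_of_nonneg_right h3 hθ0
  have h6 : Real.logb 2 n * (P.δ / (2 * Real.logb 2 n)) = P.ε / 200 := by
    rw [hP.hδ]
    field_simp
    ring
  linarith

/-- The invariant implies that `rbar` is a good approximation of `r`. -/
theorem Inv.near (hP : Nums P xbar Kmax) {t : ℕ} (hinv : Inv P rule s t)
    (hw : ∀ e, 0 < (run P rule s t).w e)
    (hr : ∀ e, (run P rule s t).r e =
      (run P rule s t).w e + P.ε / (2 * n) * ∑ f, (run P rule s t).w f)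
    (hpos : ∀ a ≤ (run P rule s t).i, ∀ e, 0 < (run P rule s t).rHist a e)
    (hk : ((run P rule s t).k : ℝ) ≤ Kmax + 1) : Near P (run P rule s t) := by
  have hε := hP.hε0
  have hdr := drift_le hP hk
  have hdr0 := drift_nonneg (rule := rule) (s := s) hP t
  have hpr : ∀ e, 0 < (run P rule s t).rbar e := by
    intro e
    rcases hinv e with ⟨a, h⟩ | h
    · rw [h.rbar_eq]; exact hpos a h.le e
    · have := hpos _ le_rfl e
      exact lt_of_lt_of_le (by positivity) h.le_rbar
  refine ⟨hw, hr, hpr, fun e => ?_⟩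
  rcases hinv e with ⟨a, h⟩ | h
  · have h1 := abs_le.1 (h.abs_log_le hP (fun a ha => hpos a ha e))
    rw [h.rbar_eq]
    have h2 := Real.log_le_log (hpos _ le_rfl e) h.le_r
    have h3 := h.r_le
    rw [abs_le]
    constructor <;> linarith
  · have h2 := Real.log_le_log (hpr e) h.le_r
    have h3 := h.r_le
    rw [abs_le]
    constructor <;> linarith

theorem near_init (hP : Nums P xbar Kmax) : Near P (run P rule s 0) := by
  have hε := hP.hε0
  have hn := hP.n_pos
  refine ⟨fun e => one_pos, fun e => ?_, fun e => ?_, fun e => ?_⟩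
  · simp only [run_zero, init, Finset.sum_const, Finset.card_univ, Fintype.card_sum,
      Fintype.card_fin, nsmul_eq_mul]
    push_cast
    field_simp
    ring
  · simp only [run_zero, init]; linarith
  · simp only [run_zero, init, sub_self, abs_zero]; positivity

theorem inv_init (hP : Nums P xbar Kmax) : Inv P rule s 0 := by
  intro e
  refine Or.inl ⟨0, le_rfl, rfl, ?_, ?_, ?_, ?_, le_rfl, ?_⟩
  · intro j hj; simp [run_zero, init] at hj
  · intro t' ht' _
    rw [Nat.le_zero.1 ht']
  · intro x h1 h2; simp [run_zero, init] at h2; omega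
  · intro x h1 h2; simp [run_zero, init] at h2; omega
  · have := drift_nonneg (rule := rule) (s := s) hP 0
    simp only [run_zero, init] at this ⊢
    linarith

theorem inv_succ_of_isWidth (hC : Function.Injective P.C.mulVec)
    (hd : IsLeast (Set.range fun x : Fin m → ℝ => ‖P.C.mulVec x - P.d‖) 1)
    (hP : Nums P xbar Kmax) (hrule : rule.Valid P) {t : ℕ} (hnear : Near P (run P rule s t))
    (hinv : Inv P rule s t) (h : IsWidth P (run P rule s t)) : Inv P rule s (t + 1) := by
  have hs := run_succ_of_isWidth P rule s h
  have hdr := drift_succ_of_isWidth h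
  have hε := hP.hε0
  intro e
  have hle : (run P rule s t).r e ≤ (run P rule s (t + 1)).r e := by
    rw [hs]; exact le_widthR hP hnear e
  have hi : (run P rule s (t + 1)).i = (run P rule s t).i := by rw [hs]; rfl
  have hH : (run P rule s (t + 1)).rHist = (run P rule s t).rHist := by rw [hs]; rfl
  by_cases he : e ∈ widthSet P rule (run P rule s t)
  · right
    have hrb : (run P rule s (t + 1)).rbar e = (run P rule s (t + 1)).r e := by
      rw [hs]; exact if_pos he
    refine ⟨?_, ?_, hrb.le, ?_⟩
    · rw [hi, hs]; exact widthStep_lastWidth_of_mem P rule he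
    · rw [hi, hH, hrb]
      have h1 : (1 + P.ε) * (run P rule s t).r e ≤ (run P rule s (t + 1)).r e := by
        rw [hs]; exact le_widthR_of_mem hP hnear he
      refine le_trans (mul_le_mul_of_nonneg_left ?_ (by linarith)) h1
      rcases hinv e with ⟨a, h2⟩ | h2
      · exact h2.le_r
      · by_cases h3 : 0 ≤ (run P rule s t).rHist (run P rule s t).i e
        · have := h2.le_rbar
          have := h2.le_r
          nlinarith
        · have := hnear.r_pos hP e
          linarith
    · rw [hrb]
      linarith [drift_nonneg (rule := rule) (s := s) hP (t + 1)]
  · have hlog : |Real.log ((run P rule s (t + 1)).r e) - Real.log ((run P rule s t).r e)| ≤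
        4 * P.ε / P.τ := by
      rw [hs]; exact widthStep_log_r hC hd hP hrule hnear h.2 he
    have hlog := abs_le.1 hlog
    have hrb : (run P rule s (t + 1)).rbar e = (run P rule s t).rbar e := by
      rw [hs]; exact if_neg he
    have hlw : (run P rule s (t + 1)).lastWidth e = (run P rule s t).lastWidth e := by
      rw [hs]; exact widthStep_lastWidth_of_notMem P rule he
    rcases hinv e with ⟨a, h2⟩ | h2
    · left
      refine ⟨a, by rw [hi]; exact h2.le, by rw [hrb, hH]; exact h2.rbar_eq,
        by rw [hlw]; exact h2.width_lt, ?_, by rw [hi]; exact h2.not_top,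
        by rw [hi, hH]; exact h2.small, by rw [hi, hH]; exact h2.le_r.trans hle, ?_⟩
      · intro t' ht' hat'
        rcases Nat.eq_or_lt_of_le ht' with h3 | h3
        · rw [h3]
        · rw [hrb]; exact h2.rbar_const t' (by omega) hat'
      · rw [hi, hH, hdr]
        linarith [h2.r_le]
    · right
      refine ⟨by rw [hi, hlw]; exact h2.width_eq, by rw [hi, hH, hrb]; exact h2.le_rbar,
        by rw [hrb]; exact h2.le_r.trans hle, ?_⟩
      rw [hrb, hdr]
      linarith [h2.r_le]

theorem Widened.selected (hP : Nums P xbar Kmax) {t : ℕ} {e : Coord n}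
    (hpos : 0 < (run P rule s t).rHist (run P rule s t).i e)
    {r' : Coord n → ℝ} (hr'pos : 0 < r' e)
    (hlog : |Real.log (r' e) - Real.log ((run P rule s t).r e)| ≤ P.ε / 100)
    (h : Widened P rule s t e) : Selected P ((run P rule s t).i + 1) (run P rule s t) r' e := by
  obtain ⟨h1, -, -, h3⟩ := logb_facts hP
  have hε := hP.hε0
  have hε2 := hP.hε
  refine Or.inr ⟨0, by omega, by simp, ?_, ?_⟩
  · rw [pow_zero, Nat.add_sub_cancel, Real.log_div hr'pos.ne' hpos.ne']
    have h4 := Real.log_le_log (by positivity) (h.le_rbar.trans h.le_r)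
    rw [Real.log_mul (by positivity) hpos.ne'] at h4
    have h5 := sub_sq_le_log_one_add (y := P.ε / 2) (by rw [abs_of_pos (by positivity)]; linarith)
    have h5' : Real.log (1 + P.ε / 2) ≤ Real.log (1 + P.ε) :=
      Real.log_le_log (by positivity) (by linarith)
    have h6 := (abs_le.1 hlog).1
    have h7 : P.δ / (2 * Real.logb 2 n) ≤ P.ε / 200 := by
      rw [hP.hδ, div_div]
      refine div_le_div_of_nonneg_left hε.le (by norm_num) (by linarith)
    refine h7.trans (le_trans ?_ (le_abs_self _))
    nlinarith
  · intro j hj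
    rw [h.width_eq, Option.mem_some_iff] at hj
    simp [← hj]

theorem inv_succ_of_isPrimal (hC : Function.Injective P.C.mulVec)
    (hd : IsLeast (Set.range fun x : Fin m → ℝ => ‖P.C.mulVec x - P.d‖) 1)
    (hP : Nums P xbar Kmax) {t : ℕ} (hnear : ∀ t' ≤ t, Near P (run P rule s t'))
    (hinv : Inv P rule s t) (h : IsPrimal P (run P rule s t))
    (hN : ∀ e, |noise P (sketch P s (run P rule s t).i) (run P rule s t) e| ≤ xbar) :
    Inv P rule s (t + 1) := by
  have hs := run_succ_of_isPrimal P rule s h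
  set sk := sketch P s (run P rule s t).i with hsk
  have hi : (run P rule s (t + 1)).i = (run P rule s t).i + 1 := by rw [hs]; rfl
  have hn' := hnear t le_rfl
  have hw' := primalW_pos P sk hP.hε0 hP.hα0 hn'.w_pos
  intro e
  have hH : (run P rule s (t + 1)).rHist ((run P rule s t).i + 1) e =
      (run P rule s (t + 1)).r e := by
    rw [hs]
    exact congrFun (Function.update_self ..) e
  have hHold : ∀ x ≤ (run P rule s t).i, (run P rule s (t + 1)).rHist x =
      (run P rule s t).rHist x := by
    intro x hx
    rw [hs]
    change Function.update _ _ _ x = _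
    rw [Function.update_of_ne (by omega)]
  have hlw : (run P rule s (t + 1)).lastWidth e = (run P rule s t).lastWidth e := by
    rw [hs]; rfl
  have hlog : |Real.log ((run P rule s (t + 1)).r e) - Real.log ((run P rule s t).r e)| ≤
      P.ε / 100 := by
    rw [hs]
    exact (primalStep_log_r hC hd hP hn' h.2 hN e).trans (primal_cost_le hC hd hP hn' h.2 e)
  have hrpos : 0 < (run P rule s (t + 1)).r e := by
    rw [hs]
    have h1 := hw' e
    have h2 : 0 ≤ P.ε / (2 * n) * ∑ f, primalW P sk (run P rule s t) f :=
      mul_nonneg (by have := hP.hε0; positivity) (Finset.sum_nonneg fun f _ => (hw' f).le)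
    exact add_pos_of_pos_of_nonneg h1 h2
  have hd0 := drift_nonneg (rule := rule) (s := s) hP (t + 1)
  left
  by_cases hsel : Selected P ((run P rule s t).i + 1) (run P rule s t) (run P rule s (t + 1)).r e
  · refine ⟨(run P rule s t).i + 1, hi.ge, ?_, ?_, ?_, ?_, ?_, ?_, ?_⟩
    · rw [hH, hs, primalStep_rbar, ← hs, if_pos hsel]
    · intro j hj
      rw [hlw] at hj
      have := lastWidth_le P rule s hj
      omega
    · intro t' ht' h1
      rcases Nat.eq_or_lt_of_le ht' with h3 | h3
      · rw [h3]
      · have := run_i_mono P rule s (show t' ≤ t by omega)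
        simp only at this
        omega
    · intro x h1 h2; omega
    · intro x h1 h2; omega
    · rw [hi, hH]
    · rw [hi, hH]; linarith
  · have hpos := rHist_pos hP hnear le_rfl e
    rcases hinv e with ⟨a, h2⟩ | h2
    · have hrb : (run P rule s (t + 1)).rbar e = (run P rule s t).rbar e := by
        rw [hs, primalStep_rbar, ← hs, if_neg hsel]
      unfold Selected at hsel
      push Not at hsel
      refine ⟨a, by rw [hi]; have := h2.le; omega,
        by rw [hrb, hHold a h2.le]; exact h2.rbar_eq, by rw [hlw]; exact h2.width_lt, ?_, ?_, ?_,
        ?_, ?_⟩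
      · intro t' ht' hat'
        rcases Nat.eq_or_lt_of_le ht' with h3 | h3
        · rw [h3]
        · rw [hrb]; exact h2.rbar_const t' (by omega) hat'
      · intro x h3 h4
        rcases Nat.eq_or_lt_of_le (hi ▸ h4) with h5 | h5
        · rw [h5]; exact hsel.1
        · exact h2.not_top x h3 (by omega)
      · intro x h3 h4 l hl hdvd h6
        have hp2 : 0 < 2 ^ l := by positivity
        rcases Nat.eq_or_lt_of_le (hi ▸ h4) with h5 | h5
        · subst h5
          rw [hH, hHold _ (by omega)]
          by_contra! h7
          obtain ⟨j, hj, hj2⟩ := hsel.2 l hl hdvd h7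
          have := h2.width_lt j hj
          omega
        · rw [hHold x (by omega), hHold _ (by omega)]
          exact h2.small x h3 (by omega) l hl hdvd h6
      · rw [hi, hH]
      · rw [hi, hH]; linarith
    · exact absurd (h2.selected hP hpos hrpos hlog) hsel

end Run

/-- The first `N` iterations of a run satisfy the invariants. -/
structure Tame (P : Params n m) (rule : Rule n m) (s : Signs P) (xbar Kmax : ℝ) (N : ℕ) :
    Prop where
  inj : Function.Injective P.C.mulVec
  least : IsLeast (Set.range fun x : Fin m → ℝ => ‖P.C.mulVec x - P.d‖) 1
  nums : Nums P xbar Kmax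
  valid : rule.Valid P
  near : ∀ t ≤ N, Near P (run P rule s t)
  inv : ∀ t ≤ N, Inv P rule s t
  noise_le : ∀ t < N, IsPrimal P (run P rule s t) →
    ∀ e, |noise P (sketch P s (run P rule s t).i) (run P rule s t) e| ≤ xbar
  k_le : ((run P rule s N).k : ℝ) ≤ Kmax + 1

open Classical in
/-- An upper bound for the change of `log (r e)` in the next step. -/
noncomputable def stepCost (P : Params n m) (xbar : ℝ) (st : State n m) (e : Coord n) : ℝ :=
  if IsPrimal P st then 2 * P.ε * P.α * |resid P st e| + 2 * P.ε * P.α * (xbar + 2)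
  else if IsWidth P st then 4 * P.ε / P.τ else 0

open Classical in
/-- The part of `stepCost` at time `t'` that can make `rbar e` inaccurate at time `t`. -/
noncomputable def pairCost (P : Params n m) (rule : Rule n m) (s : Signs P) (xbar : ℝ) (t : ℕ)
    (e : Coord n) (t' : ℕ) : ℝ :=
  if IsPrimal P (run P rule s t') ∧ (run P rule s t').rbar e ≠ (run P rule s t).rbar e then 0
  else stepCost P xbar (run P rule s t') e

open Classical in
/-- The average of `stepCost` with respect to the energies of the coordinates. -/
noncomputable def cost (P : Params n m) (st : State n m) : ℝ :=
  if IsPrimal P st then 8 * P.ε * P.α * P.C₃ * P.ρ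
  else if IsWidth P st then 4 * P.ε / P.τ else 0

section Loss

variable {P : Params n m} {rule : Rule n m} {s : Signs P} {xbar Kmax : ℝ} {N : ℕ}

theorem stepCost_nonneg (hP : Nums P xbar Kmax) (st : State n m) (e : Coord n) :
    0 ≤ stepCost P xbar st e := by
  have := hP.hε0
  have := hP.hα0
  have := hP.hτ0
  have := hP.hx0
  unfold stepCost
  split_ifs <;> positivity

theorem pairCost_nonneg (hP : Nums P xbar Kmax) (t : ℕ) (e : Coord n) (t' : ℕ) :
    0 ≤ pairCost P rule s xbar t e t' := by
  unfold pairCost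
  split_ifs
  · exact le_rfl
  · exact stepCost_nonneg hP _ _

theorem Tame.abs_log_r_succ_sub_le (h : Tame P rule s xbar Kmax N) {t : ℕ} (ht : t < N)
    {e : Coord n} (he : IsWidth P (run P rule s t) → e ∉ widthSet P rule (run P rule s t)) :
    |Real.log ((run P rule s (t + 1)).r e) - Real.log ((run P rule s t).r e)| ≤
      stepCost P xbar (run P rule s t) e := by
  unfold stepCost
  rcases step_cases P (run P rule s t) with hp | hw | hf
  · rw [if_pos hp, run_succ_of_isPrimal P rule s hp]
    exact primalStep_log_r h.inj h.least h.nums (h.near t ht.le) hp.2 (h.noise_le t ht hp) e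
  · rw [if_neg hw.not_isPrimal, if_pos hw, run_succ_of_isWidth P rule s hw]
    exact widthStep_log_r h.inj h.least h.nums h.valid (h.near t ht.le) hw.2 (he hw)
  · rw [run_succ_of_le P rule s hf, sub_self, abs_zero]
    exact stepCost_nonneg h.nums _ _

theorem Tame.abs_log_r_sub_le (h : Tame P rule s xbar Kmax N) {t₀ t₁ : ℕ} (h01 : t₀ ≤ t₁)
    (ht₁ : t₁ ≤ N) {e : Coord n} (he : ∀ t, t₀ ≤ t → t < t₁ → IsWidth P (run P rule s t) →
      e ∉ widthSet P rule (run P rule s t)) :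
    |Real.log ((run P rule s t₁).r e) - Real.log ((run P rule s t₀).r e)| ≤
      ∑ t ∈ Finset.Ico t₀ t₁, stepCost P xbar (run P rule s t) e := by
  induction t₁, h01 using Nat.le_induction with
  | base => simp
  | succ t₁ h01 ih =>
    have h1 := ih (by omega) fun t h2 h3 => he t h2 (by omega)
    have h2 := h.abs_log_r_succ_sub_le (show t₁ < N by omega) (he t₁ h01 (by omega))
    rw [Finset.sum_Ico_succ_top h01]
    have h3 := abs_sub_le (Real.log ((run P rule s (t₁ + 1)).r e)) (Real.log ((run P rule s t₁).r e))
      (Real.log ((run P rule s t₀).r e))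
    linarith

theorem Tame.abs_log_window_le (h : Tame P rule s xbar Kmax N) {t a b : ℕ} (ht : t < N)
    (hp : IsPrimal P (run P rule s t)) {e : Coord n} (hf : Fresh P rule s t e a) (hab : a ≤ b)
    (hb : b ≤ (run P rule s t).i) :
    |Real.log ((run P rule s (t + 1)).r e) - Real.log ((run P rule s t).rHist b e)| ≤
      ∑ t' ∈ Finset.range (t + 1), if b ≤ (run P rule s t').i then
        pairCost P rule s xbar t e t' else 0 := by
  obtain ⟨t₀, h1, h2, h3, -⟩ := exists_hit_time P rule s t b hb
  rw [h3]
  have hmono := run_i_mono P rule s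
  refine (h.abs_log_r_sub_le (show t₀ ≤ t + 1 by omega) ht ?_).trans ?_
  · intro t' h4 h5 h6 h7
    rcases Nat.eq_or_lt_of_le (Nat.lt_succ_iff.1 h5) with h8 | h8
    · rw [h8] at h6
      exact h6.not_isPrimal hp
    · obtain ⟨j, h9, h10⟩ := lastWidth_of_mem P rule s h8 h6 h7
      have := hf.width_lt j h9
      have := hmono h4
      simp only at this
      omega
  · have h4 : ∀ t' ∈ Finset.Ico t₀ (t + 1), stepCost P xbar (run P rule s t') e =
        if b ≤ (run P rule s t').i then pairCost P rule s xbar t e t' else 0 := by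
      intro t' ht'
      rw [Finset.mem_Ico] at ht'
      have h5 := hmono ht'.1
      simp only at h5
      rw [if_pos (by omega), pairCost, if_neg]
      rw [not_and_not_right]
      exact fun _ => hf.rbar_const t' (by omega) (by omega)
    rw [Finset.sum_congr rfl h4]
    refine Finset.sum_le_sum_of_subset_of_nonneg ?_ fun t' _ _ => ?_
    · intro t' ht'
      rw [Finset.mem_Ico] at ht'
      exact Finset.mem_range.2 ht'.2
    · split_ifs
      · exact pairCost_nonneg h.nums _ _ _
      · exact le_rfl

theorem Tame.rHist_pos (h : Tame P rule s xbar Kmax N) {t : ℕ} (ht : t ≤ N)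
    {a : ℕ} (ha : a ≤ (run P rule s t).i) (e : Coord n) : 0 < (run P rule s t).rHist a e :=
  NonMonotoneMWU.rHist_pos h.nums (fun t' ht' => h.near t' (ht'.trans ht)) ha e

theorem Tame.abs_log_selected_le (h : Tame P rule s xbar Kmax N) {t ℓ : ℕ} (ht : t < N)
    (hp : IsPrimal P (run P rule s t)) (hℓ : ℓ ≤ Nat.log 2 n)
    (hnd : ¬ 2 ^ ℓ ∣ (run P rule s t).i + 1) {e : Coord n}
    (hsel : Selected P ((run P rule s t).i + 1) (run P rule s t) (run P rule s (t + 1)).r e) :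
    |Real.log ((run P rule s (t + 1)).r e) - Real.log ((run P rule s t).rbar e)| ≤
      3 * Real.logb 2 n *
        windowCost ℓ (fun t => (run P rule s t).i) (pairCost P rule s xbar t e) t := by
  obtain ⟨hlg1, -, hD, -⟩ := logb_facts h.nums
  have hpos : ∀ a ≤ (run P rule s t).i, 0 < (run P rule s t).rHist a e :=
    fun a ha => h.rHist_pos ht.le ha e
  have hc := pairCost_nonneg (rule := rule) (s := s) h.nums t e
  have hW0 := windowCost_nonneg (ℓ := ℓ) (i := fun t => (run P rule s t).i) hc t
  rcases hsel with h1 | ⟨l, hl, hd, hth, hlast⟩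
  · exact absurd ((pow_dvd_pow 2 hℓ).trans h1) hnd
  have hlℓ : l < ℓ := by
    by_contra h2
    exact hnd ((pow_dvd_pow 2 (by omega)).trans hd)
  have hWl := le_windowCost (ℓ := ℓ) (i := fun t => (run P rule s t).i) hc hlℓ hd
  set W := windowCost ℓ (fun t => (run P rule s t).i) (pairCost P rule s xbar t e) t
  have hle := Nat.le_of_dvd (by omega) hd
  have hp2 : 0 < 2 ^ l := by positivity
  have hW3 : W ≤ 3 * Real.logb 2 n * W := by nlinarith
  rcases h.inv t ht.le e with ⟨a, hf⟩ | hw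
  · rw [hf.rbar_eq]
    by_cases hab : a ≤ (run P rule s t).i + 1 - 2 ^ l
    · have h2 := h.abs_log_window_le ht hp hf hab (by omega)
      have h3 := hf.abs_log_sub_le h.nums hpos hab (by omega)
      rw [Real.log_div ((h.near (t + 1) ht).r_pos h.nums e).ne' (hpos _ (by omega)).ne'] at hth
      have h4 : ∑ t' ∈ Finset.range (t + 1), (if (run P rule s t).i + 1 - 2 ^ l ≤
          (run P rule s t').i then pairCost P rule s xbar t e t' else 0) ≤ W := by
        refine le_trans (le_of_eq (Finset.sum_congr rfl fun t' _ => ?_)) hWl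
        exact if_congr (by omega) rfl rfl
      have h5 := abs_sub_le (Real.log ((run P rule s (t + 1)).r e))
        (Real.log ((run P rule s t).rHist ((run P rule s t).i + 1 - 2 ^ l) e))
        (Real.log ((run P rule s t).rHist a e))
      have h6 : 2 * (Nat.log 2 n : ℝ) * (P.δ / (2 * Real.logb 2 n)) ≤ 2 * Real.logb 2 n * W :=
        mul_le_mul (by linarith) (by linarith)
          (by rw [h.nums.hδ]; have := h.nums.hε0; positivity) (by linarith)
      nlinarith
    · have h2 := h.abs_log_window_le ht hp hf le_rfl hf.le
      refine h2.trans (le_trans ?_ hW3)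
      refine le_trans (Finset.sum_le_sum fun t' _ => ?_) hWl
      split_ifs
      · exact le_rfl
      · omega
      · exact hc t'
      · exact le_rfl
  · have h2 := hlast _ hw.width_eq
    have hl0 : 2 ^ l = 1 := by omega
    rw [hl0] at hWl
    refine le_trans ?_ hW3
    refine le_trans ?_ hWl
    have h3 := h.abs_log_r_succ_sub_le ht (e := e) fun h' => absurd hp h'.not_isPrimal
    have h4 : |Real.log ((run P rule s t).r e) - Real.log ((run P rule s t).rbar e)| ≤
        drift P rule s t := by
      have h5 := Real.log_le_log ((h.near t ht.le).rbar_pos e) hw.le_r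
      rw [abs_of_nonneg (by linarith)]
      linarith [hw.r_le]
    have h5 := abs_sub_le (Real.log ((run P rule s (t + 1)).r e)) (Real.log ((run P rule s t).r e))
      (Real.log ((run P rule s t).rbar e))
    refine h5.trans ((add_le_add h3 h4).trans ?_)
    rw [Finset.sum_range_succ, if_pos le_rfl, add_comm]
    refine add_le_add ?_ (le_of_eq ?_)
    · classical
      unfold drift
      rw [mul_comm, ← nsmul_eq_mul, ← Finset.sum_const, Finset.sum_filter]
      refine Finset.sum_le_sum fun t' _ => ?_
      by_cases h6 : IsWidth P (run P rule s t') ∧ (run P rule s t').i = (run P rule s t).i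
      · rw [if_pos h6, if_pos (by omega), pairCost, if_neg (fun h7 => h6.1.not_isPrimal h7.1),
          stepCost, if_neg h6.1.not_isPrimal, if_pos h6.1]
      · rw [if_neg h6]
        split_ifs
        · exact hc t'
        · exact le_rfl
    · rw [pairCost, if_neg]
      simp

theorem log_psi_sub_le {st st' : State n m} (hC : Function.Injective P.C.mulVec)
    (hr : ∀ e, 0 < st.rbar e) (hr' : ∀ e, 0 < st'.rbar e) (hpsi : 0 < psi P st)
    (hy : ∀ e, |Real.log (st'.rbar e) - Real.log (st.rbar e)| ≤ 1 / 4) :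
    Real.log (psi P st) - 4 * ((∑ e, st.rbar e * resid P st e ^ 2 *
      |Real.log (st'.rbar e) - Real.log (st.rbar e)|) / psi P st) ≤ Real.log (psi P st') := by
  have h1 := psi_add_le_psi P hC hr hr'
  set y := fun e => |Real.log (st'.rbar e) - Real.log (st.rbar e)| with hydef
  set Y := ∑ e, st.rbar e * resid P st e ^ 2 * y e with hY
  have hY0 : 0 ≤ Y := Finset.sum_nonneg fun e _ =>
    mul_nonneg (mul_nonneg (hr e).le (sq_nonneg _)) (abs_nonneg _)
  have hY1 : Y ≤ 1 / 4 * psi P st := by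
    rw [hY, psi, Finset.mul_sum]
    refine Finset.sum_le_sum fun e _ => ?_
    rw [mul_comm]
    exact mul_le_mul_of_nonneg_right (hy e) (mul_nonneg (hr e).le (sq_nonneg _))
  have h2 : psi P st - 5 / 4 * Y ≤ psi P st' := by
    refine le_trans ?_ h1
    rw [hY, Finset.mul_sum, sub_eq_add_neg, ← Finset.sum_neg_distrib]
    refine add_le_add_right (Finset.sum_le_sum fun e _ => ?_) _
    have h3 : st.rbar e / st'.rbar e ≤ 1 + 5 / 4 * y e := by
      rw [← Real.exp_log (div_pos (hr e) (hr' e)), Real.log_div (hr e).ne' (hr' e).ne']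
      refine le_trans (Real.exp_le_exp.2 ?_) (exp_le_one_add (abs_nonneg _) (hy e))
      exact (le_abs_self _).trans (abs_sub_comm _ _).le
    have h4 : 0 ≤ st.rbar e * resid P st e ^ 2 := mul_nonneg (hr e).le (sq_nonneg _)
    nlinarith
  set x := Y / psi P st with hx
  have hx0 : 0 ≤ x := div_nonneg hY0 hpsi.le
  have hx1 : x ≤ 1 / 4 := (div_le_iff₀ hpsi).2 hY1
  have h5 : psi P st * (1 + -(5 / 4 * x)) ≤ psi P st' := by
    have : psi P st * x = Y := by rw [hx]; field_simp
    nlinarith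
  have h6 := sub_sq_le_log_one_add (y := -(5 / 4 * x)) (by
    rw [abs_neg, abs_of_nonneg (by positivity)]; linarith)
  have h7 := Real.log_le_log (mul_pos hpsi (by linarith)) h5
  rw [Real.log_mul hpsi.ne' (by linarith)] at h7
  nlinarith

theorem Tame.abs_log_rbar_succ_sub_le (h : Tame P rule s xbar Kmax N) {t : ℕ} (ht : t < N)
    (hp : IsPrimal P (run P rule s t)) (e : Coord n) :
    |Real.log ((run P rule s (t + 1)).rbar e) - Real.log ((run P rule s t).rbar e)| ≤
      P.ε / 25 := by
  have hε := h.nums.hε0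
  rw [run_succ_of_isPrimal P rule s hp, primalStep_rbar]
  split_ifs
  · have h1 := primalStep_log_r h.inj h.least h.nums (h.near t ht.le) hp.2 (h.noise_le t ht hp) e
    have h2 := primal_cost_le h.inj h.least h.nums (h.near t ht.le) hp.2 e
    have h3 := (h.near t ht.le).near e
    rw [abs_sub_comm] at h3
    refine (abs_sub_le _ (Real.log ((run P rule s t).r e)) _).trans ?_
    linarith
  · simp only [sub_self, abs_zero]; positivity

theorem Tame.log_psi_coarse (h : Tame P rule s xbar Kmax N) {t : ℕ} (ht : t < N)
    (hp : IsPrimal P (run P rule s t)) :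
    Real.log (psi P (run P rule s t)) - P.ε ≤ Real.log (psi P (run P rule s (t + 1))) := by
  have hε := h.nums.hε0
  have hε2 := h.nums.hε
  have hn := h.near t ht.le
  have hpsi := psi_pos h.least h.nums hn
  have h1 := h.abs_log_rbar_succ_sub_le ht hp
  refine le_trans ?_ (log_psi_sub_le h.inj hn.rbar_pos (h.near (t + 1) ht).rbar_pos hpsi
    fun e => (h1 e).trans (by linarith))
  have h2 : (∑ e, (run P rule s t).rbar e * resid P (run P rule s t) e ^ 2 *
      |Real.log ((run P rule s (t + 1)).rbar e) - Real.log ((run P rule s t).rbar e)|) /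
        psi P (run P rule s t) ≤ P.ε / 25 := by
    rw [div_le_iff₀ hpsi, psi, Finset.mul_sum]
    refine Finset.sum_le_sum fun e _ => ?_
    rw [mul_comm]
    exact mul_le_mul_of_nonneg_right (h1 e) (mul_nonneg (hn.rbar_pos e).le (sq_nonneg _))
  linarith

theorem mul_sq_le_cube_add_cube {a b : ℝ} (ha : 0 ≤ a) (hb : 0 ≤ b) :
    a * b ^ 2 ≤ a ^ 3 + b ^ 3 := by
  rcases le_total a b with h | h
  · nlinarith [mul_le_mul_of_nonneg_right h (sq_nonneg b), pow_nonneg ha 3]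
  · nlinarith [mul_le_mul_of_nonneg_left (pow_le_pow_left₀ hb h 2) ha, pow_nonneg hb 3]

theorem Tame.sum_pairCost_le (h : Tame P rule s xbar Kmax N) {t t' : ℕ} (ht : t < N) (ht' : t' ≤ t)
    (hp : IsPrimal P (run P rule s t))
    (hψ : IsPrimal P (run P rule s t') →
      psi P (run P rule s t') ≤ 2 * psi P (run P rule s t)) :
    ∑ e, (run P rule s t).rbar e * resid P (run P rule s t) e ^ 2 *
      pairCost P rule s xbar t e t' ≤
      cost P (run P rule s t') * psi P (run P rule s t) := by
  have hε := h.nums.hε0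
  have hα := h.nums.hα0
  have hpsi := psi_pos h.least h.nums (h.near t ht.le)
  have hr := (h.near t ht.le).rbar_pos
  have hr' := (h.near t' (by omega)).rbar_pos
  unfold cost
  by_cases hp' : IsPrimal P (run P rule s t')
  · rw [if_pos hp']
    have h1 : ∀ e, (run P rule s t).rbar e * resid P (run P rule s t) e ^ 2 *
        pairCost P rule s xbar t e t' ≤ 2 * P.ε * P.α *
        ((run P rule s t').rbar e * |resid P (run P rule s t') e| ^ 3 +
          (run P rule s t).rbar e * |resid P (run P rule s t) e| ^ 3) +
        2 * P.ε * P.α * (xbar + 2) *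
          ((run P rule s t).rbar e * resid P (run P rule s t) e ^ 2) := by
      intro e
      have a1 := hr e
      have a2 := hr' e
      have a3 := h.nums.hx0
      unfold pairCost
      split_ifs with h2
      · rw [mul_zero]; positivity
      · push Not at h2
        rw [h2 hp', stepCost, if_pos hp']
        have h3 := mul_sq_le_cube_add_cube (abs_nonneg (resid P (run P rule s t') e))
          (abs_nonneg (resid P (run P rule s t) e))
        rw [sq_abs] at h3
        have h4 := mul_le_mul_of_nonneg_left h3
          (by positivity : 0 ≤ 2 * P.ε * P.α * (run P rule s t).rbar e)
        nlinarith
    refine (Finset.sum_le_sum fun e _ => h1 e).trans ?_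
    rw [Finset.sum_add_distrib, ← Finset.mul_sum, ← Finset.mul_sum, Finset.sum_add_distrib, ← psi]
    have h2 := hp'.2
    have h3 := hp.2
    unfold PrimalTest at h2 h3
    have h4 := hψ hp'
    have h5 := h.nums.hβ
    have hCρ : 0 ≤ P.C₃ * P.ρ := by
      have := h.nums.hC
      have := h.nums.hρ
      positivity
    have h6 : P.C₃ * P.ρ * psi P (run P rule s t') ≤
        P.C₃ * P.ρ * (2 * psi P (run P rule s t)) := mul_le_mul_of_nonneg_left h4 hCρ
    have h7 := mul_le_mul_of_nonneg_right h5 hpsi.le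
    have h8 := mul_le_mul_of_nonneg_left (show
      (∑ e, (run P rule s t').rbar e * |resid P (run P rule s t') e| ^ 3) +
        (∑ e, (run P rule s t).rbar e * |resid P (run P rule s t) e| ^ 3) +
        (xbar + 2) * psi P (run P rule s t) ≤ 4 * (P.C₃ * P.ρ * psi P (run P rule s t)) by linarith)
      (by positivity : 0 ≤ 2 * P.ε * P.α)
    linarith
  · rw [if_neg hp']
    have h1 : ∀ e, pairCost P rule s xbar t e t' =
        open Classical in if IsWidth P (run P rule s t') then 4 * P.ε / P.τ else 0 := by
      intro e
      rw [pairCost, if_neg (fun h => hp' h.1), stepCost, if_neg hp']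
    simp_rw [h1]
    rw [← Finset.sum_mul, ← psi, mul_comm]

theorem Tame.log_psi_fine (h : Tame P rule s xbar Kmax N) {t ℓ : ℕ} (ht : t < N)
    (hp : IsPrimal P (run P rule s t)) (hℓ : ℓ ≤ Nat.log 2 n)
    (hnd : ¬ 2 ^ ℓ ∣ (run P rule s t).i + 1)
    (hψ : ∀ t' ≤ t, IsPrimal P (run P rule s t') →
      (run P rule s t').i / 2 ^ ℓ = (run P rule s t).i / 2 ^ ℓ →
      Real.log (psi P (run P rule s t')) ≤ Real.log (psi P (run P rule s t)) + Real.log 2) :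
    Real.log (psi P (run P rule s t)) - 12 * Real.logb 2 n *
      windowCost ℓ (fun t => (run P rule s t).i) (fun t => cost P (run P rule s t)) t ≤
      Real.log (psi P (run P rule s (t + 1))) := by
  have hε := h.nums.hε0
  have hε2 := h.nums.hε
  have hn := h.near t ht.le
  have hpsi := psi_pos h.least h.nums hn
  have h1 := h.abs_log_rbar_succ_sub_le ht hp
  obtain ⟨hlg1, -, -, -⟩ := logb_facts h.nums
  refine le_trans ?_ (log_psi_sub_le h.inj hn.rbar_pos (h.near (t + 1) ht).rbar_pos hpsi
    fun e => (h1 e).trans (by linarith))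
  have h2 : ∀ e, |Real.log ((run P rule s (t + 1)).rbar e) -
      Real.log ((run P rule s t).rbar e)| ≤ 3 * Real.logb 2 n *
        windowCost ℓ (fun t => (run P rule s t).i) (pairCost P rule s xbar t e) t := by
    intro e
    by_cases hsel : Selected P ((run P rule s t).i + 1) (run P rule s t)
        (run P rule s (t + 1)).r e
    · have h3 : (run P rule s (t + 1)).rbar e = (run P rule s (t + 1)).r e := by
        rw [run_succ_of_isPrimal P rule s hp] at hsel ⊢
        rw [primalStep_rbar, if_pos hsel]
      rw [h3]
      exact h.abs_log_selected_le ht hp hℓ hnd hsel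
    · have h3 : (run P rule s (t + 1)).rbar e = (run P rule s t).rbar e := by
        rw [run_succ_of_isPrimal P rule s hp] at hsel ⊢
        rw [primalStep_rbar, if_neg hsel]
      rw [h3, sub_self, abs_zero]
      exact mul_nonneg (by linarith) (windowCost_nonneg (pairCost_nonneg h.nums t e) t)
  have h3 : (∑ e, (run P rule s t).rbar e * resid P (run P rule s t) e ^ 2 *
      |Real.log ((run P rule s (t + 1)).rbar e) - Real.log ((run P rule s t).rbar e)|) /
        psi P (run P rule s t) ≤ 3 * Real.logb 2 n *
      windowCost ℓ (fun t => (run P rule s t).i) (fun t => cost P (run P rule s t)) t := by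
    rw [div_le_iff₀ hpsi, mul_assoc]
    refine le_trans (Finset.sum_le_sum fun e _ => mul_le_mul_of_nonneg_left (h2 e)
      (mul_nonneg (hn.rbar_pos e).le (sq_nonneg _))) ?_
    simp_rw [mul_left_comm _ (3 * Real.logb 2 n)]
    rw [← Finset.mul_sum]
    refine mul_le_mul_of_nonneg_left (sum_mul_windowCost_le ?_) (by linarith)
    intro l hl hd t' ht' h4
    refine h.sum_pairCost_le ht ht' hp fun hp' => ?_
    have h5 := hψ t' ht' hp' (div_eq_of_window (i := fun t => (run P rule s t).i)
      (run_i_mono P rule s) hl hd ht' h4)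
    rw [add_comm, ← Real.log_mul two_ne_zero hpsi.ne'] at h5
    exact (Real.log_le_log_iff (psi_pos h.least h.nums (h.near t' (by omega))) (by positivity)).1 h5
  linarith

end Loss

theorem exists_scale (D : ℕ) {A : ℝ} (hD : 1 / 2 ^ D ≤ 2 * A) :
    ∃ ℓ ≤ D, (ℓ = 0 ∨ 2 ^ ℓ * A ≤ 1) ∧ 1 / 2 ^ ℓ ≤ 2 * A := by
  induction D with
  | zero => exact ⟨0, le_rfl, Or.inl rfl, hD⟩
  | succ D ih =>
    by_cases h : 2 ^ (D + 1) * A ≤ 1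
    · exact ⟨D + 1, le_rfl, Or.inr h, hD⟩
    · push Not at h
      obtain ⟨ℓ, h1, h2⟩ := ih (by
        rw [div_le_iff₀ (by positivity)]
        rw [pow_succ] at h
        linarith)
      exact ⟨ℓ, by omega, h2⟩

section Counting

variable (P : Params n m) (rule : Rule n m) (s : Signs P)

theorem eq_of_isPrimal {t t' : ℕ} (ht : IsPrimal P (run P rule s t))
    (ht' : IsPrimal P (run P rule s t')) (h : (run P rule s t).i = (run P rule s t').i) :
    t = t' := by
  have hmono := run_i_mono P rule s
  rcases lt_trichotomy t t' with h1 | h1 | h1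
  · have := hmono (show t + 1 ≤ t' from h1)
    simp only [run_i_succ_of_isPrimal P rule s ht] at this
    omega
  · exact h1
  · have := hmono (show t' + 1 ≤ t from h1)
    simp only [run_i_succ_of_isPrimal P rule s ht'] at this
    omega

theorem card_le_of_isPrimal {S : Finset ℕ} (hS : ∀ t ∈ S, IsPrimal P (run P rule s t))
    {R : Finset ℕ} (hR : ∀ t ∈ S, (run P rule s t).i ∈ R) : S.card ≤ R.card :=
  Finset.card_le_card_of_injOn (fun t => (run P rule s t).i) hR fun _ ht _ ht' h =>
    eq_of_isPrimal P rule s (hS _ ht) (hS _ ht') h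

theorem card_dvd_le {S : Finset ℕ} (hS : ∀ t ∈ S, IsPrimal P (run P rule s t)) {q : ℕ}
    (hq : ∀ t ∈ S, q ∣ (run P rule s t).i + 1) : S.card ≤ P.T / q := by
  rw [← Nat.Ioc_filter_dvd_card_eq_div]
  refine Finset.card_le_card_of_injOn (fun t => (run P rule s t).i + 1) (fun t ht => ?_)
    fun t ht t' ht' h => eq_of_isPrimal P rule s (hS _ ht) (hS _ ht') (Nat.succ_injective h)
  have := (hS t ht).1
  simp only [Finset.coe_filter, Set.mem_ofPred_eq, Finset.mem_Ioc]
  exact ⟨by omega, hq t ht⟩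

open Classical in
theorem sum_cost_le {S : Finset ℕ} :
    ∑ t ∈ S, cost P (run P rule s t) =
      8 * P.ε * P.α * P.C₃ * P.ρ * (S.filter fun t => IsPrimal P (run P rule s t)).card +
      4 * P.ε / P.τ * (S.filter fun t => IsWidth P (run P rule s t)).card := by
  rw [mul_comm _ (Nat.cast _), mul_comm _ (Nat.cast _), ← nsmul_eq_mul, ← nsmul_eq_mul,
    ← Finset.sum_const, ← Finset.sum_const, Finset.sum_filter, Finset.sum_filter, ← Finset.sum_add_distrib]
  refine Finset.sum_congr rfl fun t _ => ?_
  unfold cost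
  by_cases h : IsPrimal P (run P rule s t)
  · have h' : ¬ IsWidth P (run P rule s t) := fun h' => h'.not_isPrimal h
    simp [h, h']
  · simp [h]

end Counting

section Potential

variable {P : Params n m} {rule : Rule n m} {s : Signs P} {xbar Kmax v : ℝ} {N : ℕ}

theorem obs_some {t : ℕ} (hp : IsPrimal P (run P rule s t)) (hok : Ok P (run P rule s t))
    (e : Coord n) : obs P rule (weight (some e)) s t =
      noise P (sketch P s (run P rule s t).i) (run P rule s t) e := by
  unfold obs
  rw [if_pos ⟨hp, hok⟩]
  simp [weight, Pi.single_apply]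

theorem obs_none {t : ℕ} (hp : IsPrimal P (run P rule s t)) (hok : Ok P (run P rule s t)) :
    obs P rule (weight none) s t = ∑ e, weight none (run P rule s t) e *
      noise P (sketch P s (run P rule s t).i) (run P rule s t) e := by
  unfold obs
  rw [if_pos ⟨hp, hok⟩]

theorem obs_of_not_isPrimal (p : State n m → Coord n → ℝ) {t : ℕ}
    (hp : ¬ IsPrimal P (run P rule s t)) : obs P rule p s t = 0 := by
  unfold obs
  rw [if_neg fun h => hp h.1]

theorem Tame.ok (h : Tame P rule s xbar Kmax N) {t : ℕ} (ht : t ≤ N) : Ok P (run P rule s t) :=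
  (h.near t ht).ok h.inj h.least h.nums

theorem Tame.log_phi_le (h : Tame P rule s xbar Kmax N) {t : ℕ} (ht : t ≤ N) :
    Real.log (∑ e, (run P rule s t).w e) ≤ Real.log (2 * n) +
      (run P rule s t).i * (P.ε * P.α * (1 + 2 * P.ε)) +
      P.ε * P.α * ∑ t' ∈ Finset.range t, obs P rule (weight none) s t' +
      4 * P.ε / P.τ * (run P rule s t).k := by
  have hε := h.nums.hε0
  have hα := h.nums.hα0
  induction t with
  | zero =>
    simp [run_zero, init, ← two_mul]
  | succ t ih =>
    have ih' := ih (by omega)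
    rw [Finset.sum_range_succ]
    rcases step_cases P (run P rule s t) with hp | hw | hf
    · rw [obs_none hp (h.ok (by omega)), run_succ_of_isPrimal P rule s hp]
      have h1 := (abs_le.1 (log_sum_primalW h.inj h.least h.nums (h.near t (by omega))
        (h.noise_le t ht hp))).2
      have h2 := (abs_le.1 (abs_sum_weight_mul_le h.inj h.least h.nums (h.near t (by omega)))).2
      have h3 : P.ε ^ 2 / 50 / P.ε = P.ε / 50 := by field_simp
      rw [h3] at h1
      have h4 := mul_le_mul_of_nonneg_left h2 (by positivity : 0 ≤ P.ε * P.α)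
      have h5 : 0 ≤ P.ε * P.α * (P.ε * (49 / 50)) := by positivity
      simp only [primalStep]
      push_cast
      linarith
    · rw [obs_of_not_isPrimal _ hw.not_isPrimal, run_succ_of_isWidth P rule s hw]
      have h1 := (log_sum_widthW h.inj h.least h.nums h.valid (h.near t (by omega)) hw.2).2
      simp only [widthStep]
      push_cast
      linarith
    · rw [obs_of_not_isPrimal _ (fun h' => absurd h'.1 (not_lt.2 hf)),
        run_succ_of_le P rule s hf]
      linarith

theorem Tame.log_phi_le' (h : Tame P rule s xbar Kmax N) (hs : SmallNoise P rule s N v xbar)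
    (hv : P.ε * P.α * v ≤ P.ε / (25600 * (1 + Real.log n))) :
    Real.log (∑ e, (run P rule s N).w e) ≤ Real.log (2 * n) +
      P.T * (P.ε * P.α * (1 + 2 * P.ε)) + P.ε / 1000 := by
  have hε := h.nums.hε0
  have hα := h.nums.hα0
  have hτ := h.nums.hτ0
  have hL := h.nums.one_le_L
  have h1 := h.log_phi_le le_rfl
  have h2 := mul_le_mul_of_nonneg_left ((le_abs_self _).trans (hs.1 none N le_rfl))
    (by positivity : 0 ≤ P.ε * P.α)
  have h3 : ((run P rule s N).i : ℝ) * (P.ε * P.α * (1 + 2 * P.ε)) ≤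
      P.T * (P.ε * P.α * (1 + 2 * P.ε)) :=
    mul_le_mul_of_nonneg_right (by exact_mod_cast run_i_le P rule s N) (by positivity)
  have h4 : 4 * P.ε / P.τ * (run P rule s N).k ≤ P.ε / (10 ^ 4 * (1 + Real.log n) ^ 2) :=
    (mul_le_mul_of_nonneg_left h.k_le (by positivity)).trans h.nums.hK
  have h5 : P.ε / (10 ^ 4 * (1 + Real.log n) ^ 2) ≤ P.ε / 10 ^ 4 := by
    refine div_le_div_of_nonneg_left hε.le (by norm_num) ?_
    nlinarith
  have h6 : P.ε / (25600 * (1 + Real.log n)) ≤ P.ε / 25600 := by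
    refine div_le_div_of_nonneg_left hε.le (by norm_num) (by linarith)
  linarith

theorem Tame.log_psi_le (h : Tame P rule s xbar Kmax N) (hs : SmallNoise P rule s N v xbar)
    (hv : P.ε * P.α * v ≤ P.ε / (25600 * (1 + Real.log n))) :
    Real.log (psi P (run P rule s N)) ≤ 4 * (1 + Real.log n) / P.ε := by
  have hε := h.nums.hε0
  have hε2 := h.nums.hε
  have hL := h.nums.one_le_L
  have hn := h.near N le_rfl
  have h1 := h.log_phi_le' hs hv
  have hΦ := sum_w_pos h.nums hn
  have h2 := Real.log_le_log (psi_pos h.least h.nums hn) (psi_le_phi h.inj h.least h.nums hn)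
  have h3 : (1 + P.ε / 40) * ((1 + P.ε) * ∑ f, (run P rule s N).w f) ≤
      Real.exp 1 * ∑ f, (run P rule s N).w f := by
    rw [← mul_assoc]
    refine mul_le_mul_of_nonneg_right ?_ hΦ.le
    have := Real.exp_one_gt_d9
    nlinarith
  have h4 := h2.trans (Real.log_le_log (by positivity) h3)
  rw [Real.log_mul (Real.exp_pos 1).ne' hΦ.ne', Real.log_exp] at h4
  have h5 : (P.T : ℝ) * (P.ε * P.α * (1 + 2 * P.ε)) ≤ (1 + Real.log n) / P.ε * (1 + 2 * P.ε) := by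
    have := mul_le_mul_of_nonneg_right h.nums.hT (by positivity : 0 ≤ 1 + 2 * P.ε)
    linarith
  have h6 : (1 + Real.log n) / P.ε * (1 + 2 * P.ε) = (1 + Real.log n) / P.ε +
      2 * (1 + Real.log n) := by
    field_simp
  have h7 : 2 * (1 + Real.log n) ≤ (1 + Real.log n) / P.ε := by
    rw [le_div_iff₀ hε]
    nlinarith
  rw [Real.log_mul two_ne_zero h.nums.n_pos.ne'] at h1
  have h8 := Real.log_two_lt_d9
  have h9 : 4 * (1 + Real.log n) / P.ε = 4 * ((1 + Real.log n) / P.ε) := by ring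
  rw [h9]
  linarith

theorem Tame.log_psi_zero (h : Tame P rule s xbar Kmax N) :
    0 ≤ Real.log (psi P (run P rule s 0)) := by
  refine Real.log_nonneg ?_
  have hn := h.near 0 (Nat.zero_le _)
  obtain ⟨e, he⟩ := exists_one_le_abs_resid P (by have := h.nums.hn; omega) h.least (run P rule s 0)
  have h1 := rbar_mul_sq_le_psi P hn.rbar_pos e
  have h2 : (run P rule s 0).rbar e = 1 + P.ε := rfl
  rw [h2, ← sq_abs] at h1
  have hε := h.nums.hε0
  nlinarith

open Classical in
theorem Tame.sum_energy_le (h : Tame P rule s xbar Kmax N) (hs : SmallNoise P rule s N v xbar)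
    (hv : P.ε * P.α * v ≤ P.ε / (25600 * (1 + Real.log n))) :
    ∑ t ∈ (Finset.range N).filter (fun t => IsWidth P (run P rule s t)),
      energy P rule (run P rule s t) ≤ 16004 * P.C₃ * (1 + Real.log n) ^ 3 * P.ρ / P.ε ^ 2 := by
  have hε := h.nums.hε0
  have hε2 := h.nums.hε
  have hα := h.nums.hα0
  have hτ := h.nums.hτ0
  have hL := h.nums.one_le_L
  have hρ := h.nums.hρ
  have hC := h.nums.hC
  obtain ⟨hlg1, hlg2, hD, -⟩ := logb_facts h.nums
  set L := 1 + Real.log n with hLdef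
  set κ := 2 * P.ε * P.α * P.C₃ * P.ρ with hκdef
  have hκ0 : 0 < κ := by positivity
  set γ := 4 * P.ε / P.τ with hγdef
  have hγ0 : 0 < γ := by positivity
  have hγK : γ * (Kmax + 1) ≤ P.ε / (10 ^ 4 * L ^ 2) := h.nums.hK
  have hγK' : 48 * L ^ 2 * (γ * (Kmax + 1)) ≤ P.ε / 200 := by
    calc 48 * L ^ 2 * (γ * (Kmax + 1)) ≤ 48 * L ^ 2 * (P.ε / (10 ^ 4 * L ^ 2)) := by gcongr
      _ = 48 / 10 ^ 4 * P.ε := by field_simp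
      _ ≤ P.ε / 200 := by linarith
  obtain ⟨ℓ, hℓD, hℓ1, hℓ2⟩ := exists_scale (Nat.log 2 n) (A := 1152 * L ^ 2 * κ) (by
    have h1 : (1 : ℝ) / 2 ^ Nat.log 2 n ≤ 2 / n := by
      rw [div_le_div_iff₀ (by positivity) h.nums.n_pos]
      have := Nat.lt_pow_succ_log_self one_lt_two n
      have h2 : (n : ℝ) ≤ 2 ^ (Nat.log 2 n + 1) := by exact_mod_cast this.le
      rw [pow_succ] at h2
      linarith
    refine h1.trans (h.nums.hκ.trans ?_)
    have h3 : κ * 1 ≤ κ * (2 * 1152 * L ^ 2) := by gcongr; nlinarith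
    linarith)
  have hℓL : (ℓ : ℝ) ≤ 2 * L := by
    have : (ℓ : ℝ) ≤ Nat.log 2 n := by exact_mod_cast hℓD
    linarith
  have hlg0 : 0 ≤ 12 * Real.logb 2 n := by linarith
  have hcoef : (ℓ : ℝ) * (12 * Real.logb 2 n) ≤ 48 * L ^ 2 := by
    calc (ℓ : ℝ) * (12 * Real.logb 2 n) ≤ (2 * L) * (12 * (2 * L)) := by gcongr
      _ = 48 * L ^ 2 := by ring
  have hc0 : ∀ t, 0 ≤ 12 * Real.logb 2 n * cost P (run P rule s t) := by
    intro t
    refine mul_nonneg hlg0 ?_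
    unfold cost
    split_ifs <;> positivity
  have hwcard : ∀ S ⊆ Finset.range N, γ * ((S.filter fun t => IsWidth P (run P rule s t)).card : ℝ)
      ≤ γ * (Kmax + 1) := by
    intro S hS
    refine mul_le_mul_of_nonneg_left (le_trans ?_ h.k_le) hγ0.le
    rw [← card_isWidth]
    exact_mod_cast Finset.card_le_card (Finset.filter_subset_filter _ hS)
  set g : ℕ → ℝ := fun t => if IsWidth P (run P rule s t) ∧ Near P (run P rule s t) then
    P.ε / 4 * energy P rule (run P rule s t) else 0 with hg
  have main := sum_gain_le (N := N) (ℓ := ℓ) (ψ := fun t => Real.log (psi P (run P rule s t)))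
    (c := fun t => 12 * Real.logb 2 n * cost P (run P rule s t)) (g := g)
    (i := fun t => (run P rule s t).i) (Pr := fun t => IsPrimal P (run P rule s t)) (κ := P.ε)
    hc0 ?_ ?_ ?_ ?_ ?_ ?_
  · have h1 : ∑ t ∈ (Finset.range N).filter (fun t => IsWidth P (run P rule s t)),
        P.ε / 4 * energy P rule (run P rule s t) ≤
        ∑ t ∈ (Finset.range N).filter (fun t => ¬ IsPrimal P (run P rule s t)), g t := by
      calc _ = ∑ t ∈ (Finset.range N).filter (fun t => IsWidth P (run P rule s t)), g t := by
            refine Finset.sum_congr rfl fun t ht => ?_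
            rw [Finset.mem_filter, Finset.mem_range] at ht
            rw [hg]
            simp only
            rw [if_pos ⟨ht.2, h.near t ht.1.le⟩]
        _ ≤ _ := by
            refine Finset.sum_le_sum_of_subset_of_nonneg ?_ fun t _ _ => ?_
            · intro t ht
              rw [Finset.mem_filter] at ht ⊢
              exact ⟨ht.1, ht.2.not_isPrimal⟩
            · rw [hg]
              simp only
              split_ifs with h1
              · exact mul_nonneg (by positivity) (energy_nonneg h1.2)
              · exact le_rfl
    rw [← Finset.mul_sum] at h1
    have h2 := h.log_psi_le hs hv
    have h3 := h.log_psi_zero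
    have hTκ : P.T * κ ≤ 2 * P.C₃ * P.ρ * (L / P.ε) := by
      have := mul_le_mul_of_nonneg_left h.nums.hT (by positivity : 0 ≤ 2 * P.C₃ * P.ρ)
      linarith
    have h4 : P.ε * (((Finset.range N).filter fun t => IsPrimal P (run P rule s t) ∧
        2 ^ ℓ ∣ (run P rule s t).i + 1).card : ℝ) ≤ 4608 * (P.C₃ * P.ρ * L ^ 3) := by
      have h5 := card_dvd_le P rule s (S := (Finset.range N).filter fun t =>
        IsPrimal P (run P rule s t) ∧ 2 ^ ℓ ∣ (run P rule s t).i + 1) (q := 2 ^ ℓ)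
        (fun t ht => (Finset.mem_filter.1 ht).2.1) (fun t ht => (Finset.mem_filter.1 ht).2.2)
      have h6 : (((Finset.range N).filter fun t => IsPrimal P (run P rule s t) ∧
          2 ^ ℓ ∣ (run P rule s t).i + 1).card : ℝ) ≤ P.T * (1 / 2 ^ ℓ) := by
        refine (Nat.cast_le.2 h5).trans (Nat.cast_div_le.trans (le_of_eq ?_))
        push_cast
        ring
      calc _ ≤ P.ε * (P.T * (2 * (1152 * L ^ 2 * κ))) := by
            refine mul_le_mul_of_nonneg_left (h6.trans ?_) hε.le
            gcongr
        _ = 2304 * L ^ 2 * P.ε * (P.T * κ) := by ring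
        _ ≤ 2304 * L ^ 2 * P.ε * (2 * P.C₃ * P.ρ * (L / P.ε)) := by gcongr
        _ = 4608 * (P.C₃ * P.ρ * L ^ 3) := by field_simp; ring
    have h5 : (ℓ : ℝ) * ∑ t ∈ Finset.range N, 12 * Real.logb 2 n * cost P (run P rule s t) ≤
        384 * (P.C₃ * P.ρ * L ^ 3 / P.ε) + 1 := by
      rw [← Finset.mul_sum, ← mul_assoc, sum_cost_le, card_isPrimal]
      have h6 : 8 * P.ε * P.α * P.C₃ * P.ρ * ((run P rule s N).i : ℝ) ≤
          8 * P.C₃ * P.ρ * (L / P.ε) := by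
        calc 8 * P.ε * P.α * P.C₃ * P.ρ * ((run P rule s N).i : ℝ) ≤
            8 * P.ε * P.α * P.C₃ * P.ρ * P.T := by
              gcongr
              exact_mod_cast run_i_le P rule s N
          _ = 4 * (P.T * κ) := by rw [hκdef]; ring
          _ ≤ 4 * (2 * P.C₃ * P.ρ * (L / P.ε)) := by gcongr
          _ = 8 * P.C₃ * P.ρ * (L / P.ε) := by ring
      have h7 := hwcard (Finset.range N) subset_rfl
      calc _ ≤ 48 * L ^ 2 * (8 * P.C₃ * P.ρ * (L / P.ε) + γ * (Kmax + 1)) := by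
            have := h.nums.hK0
            gcongr
        _ ≤ 384 * (P.C₃ * P.ρ * L ^ 3 / P.ε) + 1 := by
            rw [mul_add]
            have : 48 * L ^ 2 * (8 * P.C₃ * P.ρ * (L / P.ε)) =
              384 * (P.C₃ * P.ρ * L ^ 3 / P.ε) := by ring
            rw [this]
            linarith
    have h8 : P.ε / 4 * ∑ t ∈ (Finset.range N).filter (fun t => IsWidth P (run P rule s t)),
        energy P rule (run P rule s t) ≤ 4001 * (P.C₃ * P.ρ * L ^ 3 / P.ε) := by
      set X := P.C₃ * P.ρ * L ^ 3 with hX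
      have hLX : 2 * L ≤ X := by
        have e1 : 2 * 1 * L ≤ P.C₃ * P.ρ * L ^ 3 := by
          refine mul_le_mul (mul_le_mul hC hρ (by norm_num) (by linarith)) ?_ (by linarith)
            (by positivity)
          nlinarith [mul_le_mul hL hL zero_le_one (by linarith)]
        linarith
      have e2 : 4 * L / P.ε ≤ 2 * (X / P.ε) := by
        rw [← mul_div_assoc]
        exact div_le_div_of_nonneg_right (by linarith) hε.le
      have e3 : 2 * X ≤ X / P.ε := by
        rw [le_div_iff₀ hε]
        nlinarith
      linarith
    rw [le_div_iff₀ (by positivity)]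
    have h9 := mul_le_mul_of_nonneg_right h8 (by positivity : 0 ≤ 4 * P.ε)
    have e4 : 4001 * (P.C₃ * P.ρ * L ^ 3 / P.ε) * (4 * P.ε) =
        16004 * P.C₃ * L ^ 3 * P.ρ := by field_simp; ring
    rw [e4] at h9
    linarith
  · intro t
    rw [hg]
    simp only
    split_ifs with h1
    · exact mul_nonneg (by positivity) (energy_nonneg h1.2)
    · exact le_rfl
  · intro t
    split_ifs with h1
    · exact run_i_succ_of_isPrimal P rule s h1
    · exact run_i_succ_of_not_isPrimal P rule s h1
  · intro t ht h1
    have hn := h.near t ht.le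
    rcases step_cases P (run P rule s t) with hp | hw | hf
    · exact absurd hp h1
    · have h2 := log_psi_widthStep (rule := rule) h.inj h.least h.nums hn
      rw [← run_succ_of_isWidth P rule s hw] at h2
      rw [hg]
      simp only
      rw [if_pos ⟨hw, hn⟩]
      exact h2
    · rw [hg]
      simp only
      rw [run_succ_of_le P rule s hf, if_neg (fun h' => absurd h'.1.1 (not_lt.2 hf)), add_zero]
  · intro t ht hp _
    exact h.log_psi_coarse ht hp
  · intro t ht hp hnd hψ
    have h1 := h.log_psi_fine ht hp hℓD hnd hψ
    have h2 : windowCost ℓ (fun t => (run P rule s t).i)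
        (fun t => 12 * Real.logb 2 n * cost P (run P rule s t)) t = 12 * Real.logb 2 n *
        windowCost ℓ (fun t => (run P rule s t).i) (fun t => cost P (run P rule s t)) t := by
      unfold windowCost
      rw [Finset.mul_sum]
      refine Finset.sum_congr rfl fun l _ => ?_
      rw [mul_ite, mul_zero, Finset.mul_sum]
      simp_rw [mul_ite, mul_zero]
    rw [h2]
    exact h1
  · intro B
    rcases hℓ1 with h0 | h0
    · rw [h0]
      simp only [Nat.cast_zero, zero_mul]
      exact Real.log_nonneg one_le_two
    rw [← Finset.mul_sum, ← mul_assoc, sum_cost_le]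
    set S := (Finset.range N).filter fun t' => (run P rule s t').i / 2 ^ ℓ = B with hS
    have h1 : ((S.filter fun t => IsPrimal P (run P rule s t)).card : ℝ) ≤ 2 ^ ℓ := by
      have h2 := card_le_of_isPrimal P rule s (S := S.filter fun t => IsPrimal P (run P rule s t))
        (fun t ht => (Finset.mem_filter.1 ht).2) (R := Finset.Ico (B * 2 ^ ℓ) (B * 2 ^ ℓ + 2 ^ ℓ))
        (fun t ht => by
          have h3 := (Finset.mem_filter.1 (Finset.mem_filter.1 ht).1).2
          rw [Finset.mem_Ico, ← h3]
          have h4 := Nat.div_add_mod (run P rule s t).i (2 ^ ℓ)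
          have h5 := Nat.mod_lt (run P rule s t).i (show 0 < 2 ^ ℓ by positivity)
          rw [mul_comm] at h4
          omega)
      rw [Nat.card_Ico, Nat.add_sub_cancel_left] at h2
      exact_mod_cast h2
    have h2 := hwcard S (Finset.filter_subset _ _)
    have hK0 := h.nums.hK0
    calc _ ≤ 48 * L ^ 2 * (8 * P.ε * P.α * P.C₃ * P.ρ * 2 ^ ℓ + γ * (Kmax + 1)) := by gcongr
      _ = 1 / 6 * (2 ^ ℓ * (1152 * L ^ 2 * κ)) + 48 * L ^ 2 * (γ * (Kmax + 1)) := by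
          rw [hκdef]; ring
      _ ≤ 1 / 6 * 1 + P.ε / 200 := by gcongr
      _ ≤ Real.log 2 := by
          have := Real.log_two_gt_d9
          linarith

theorem Tame.k_le_Kmax (h : Tame P rule s xbar Kmax N) (hs : SmallNoise P rule s N v xbar)
    (hv : P.ε * P.α * v ≤ P.ε / (25600 * (1 + Real.log n))) :
    ((run P rule s N).k : ℝ) ≤ Kmax := by
  classical
  have h1 := h.sum_energy_le hs hv
  rw [← card_isWidth] at *
  set S := (Finset.range N).filter fun t => IsWidth P (run P rule s t) with hS
  rcases S.eq_empty_or_nonempty with h0 | h0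
  · rw [h0]; simpa using h.nums.hK0
  have hc : (0 : ℝ) < S.card := by exact_mod_cast h0.card_pos
  have hε := h.nums.hε0
  have hρ := h.nums.hρ
  set Y := 16004 * P.C₃ * (1 + Real.log n) ^ 3 * P.ρ / P.ε ^ 2 with hY
  obtain ⟨t, ht, h2⟩ := Finset.exists_le_of_sum_le h0
    (f := fun t => energy P rule (run P rule s t)) (g := fun _ => Y / S.card) (by
      rw [Finset.sum_const, nsmul_eq_mul, mul_div_cancel₀ _ hc.ne']
      exact h1)
  rw [hS, Finset.mem_filter, Finset.mem_range] at ht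
  have hn := h.near t ht.1.le
  have h3 := (energy_bounds h.inj h.least h.nums h.valid hn ht.2.2).1
  have h4 := energy_nonneg (rule := rule) hn
  rw [le_div_iff₀ hc] at h2
  have h5 := pow_le_pow_left₀ (mul_nonneg h4 hc.le) h2 3
  rw [mul_pow] at h5
  have hn0 := h.nums.n_pos
  have h6 := mul_le_mul_of_nonneg_right h5
    (by positivity : 0 ≤ 64 * (n : ℝ) * (1 + Real.log n) ^ 2)
  have h7 := mul_le_mul_of_nonneg_right h3 (by positivity : 0 ≤ (S.card : ℝ) ^ 3)
  have h8 : (S.card : ℝ) ^ 3 * (P.ρ ^ 2 * P.ε) < Kmax ^ 3 * (P.ρ ^ 2 * P.ε) := by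
    have := h.nums.hKx
    linarith
  have h9 := lt_of_mul_lt_mul_right h8 (by positivity)
  exact (lt_of_pow_lt_pow_left₀ 3 h.nums.hK0 h9).le

theorem SmallNoise.mono {N' : ℕ} (hs : SmallNoise P rule s N v xbar) (h : N' ≤ N) :
    SmallNoise P rule s N' v xbar :=
  ⟨fun q t ht => hs.1 q t (ht.trans h), fun t ht => hs.2 t (by omega)⟩

/-- Small sketching errors imply all the invariants. -/
theorem tame_of_smallNoise (hC : Function.Injective P.C.mulVec)
    (hd : IsLeast (Set.range fun x : Fin m → ℝ => ‖P.C.mulVec x - P.d‖) 1)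
    (hP : Nums P xbar Kmax) (hrule : rule.Valid P)
    (hv : P.ε * P.α * v ≤ P.ε / (25600 * (1 + Real.log n)))
    (hs : SmallNoise P rule s N v xbar) : Tame P rule s xbar Kmax N := by
  induction N with
  | zero =>
    refine ⟨hC, hd, hP, hrule, ?_, ?_, ?_, ?_⟩
    · intro t ht; rw [Nat.le_zero.1 ht]; exact near_init hP
    · intro t ht; rw [Nat.le_zero.1 ht]; exact inv_init hP
    · intro t ht; omega
    · have := hP.hK0
      simp only [run_zero, init, Nat.cast_zero]
      linarith
  | succ N ih =>
    have h := ih (hs.mono N.le_succ)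
    have hk := h.k_le_Kmax (hs.mono N.le_succ) hv
    have hε := hP.hε0
    have hnoise : ∀ t < N + 1, IsPrimal P (run P rule s t) →
        ∀ e, |noise P (sketch P s (run P rule s t).i) (run P rule s t) e| ≤ xbar := by
      intro t ht hp e
      rw [← obs_some hp (h.ok (by omega))]
      exact hs.2 t ht e
    have hn := h.near N le_rfl
    have hkey : Inv P rule s (N + 1) ∧ Near P (run P rule s (N + 1)) ∧
        ((run P rule s (N + 1)).k : ℝ) ≤ Kmax + 1 := by
      rcases step_cases P (run P rule s N) with hp | hw | hf
      · have hrun := run_succ_of_isPrimal P rule s hp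
        have hi := inv_succ_of_isPrimal hC hd hP h.near (h.inv N le_rfl) hp
          (hnoise N (by omega) hp)
        have hk' : ((run P rule s (N + 1)).k : ℝ) ≤ Kmax + 1 := by
          rw [hrun]; exact h.k_le
        have hw' := primalW_pos P (sketch P s (run P rule s N).i) hε hP.hα0 hn.w_pos
        have hr' : ∀ e, 0 < (run P rule s (N + 1)).r e := by
          intro e
          rw [hrun]
          have h2 : 0 ≤ P.ε / (2 * n) *
              ∑ f, primalW P (sketch P s (run P rule s N).i) (run P rule s N) f :=
            mul_nonneg (by positivity) (Finset.sum_nonneg fun f _ => (hw' f).le)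
          exact add_pos_of_pos_of_nonneg (hw' e) h2
        refine ⟨hi, hi.near hP ?_ ?_ ?_ hk', hk'⟩
        · rw [hrun]; exact hw'
        · rw [hrun]; exact fun e => rfl
        · intro a ha e
          rw [run_i_succ_of_isPrimal P rule s hp] at ha
          rcases Nat.eq_or_lt_of_le ha with h1 | h1
          · have h2 : (run P rule s (N + 1)).rHist a = (run P rule s (N + 1)).r := by
              rw [hrun, h1]
              exact Function.update_self ..
            rw [h2]
            exact hr' e
          · have h2 : (run P rule s (N + 1)).rHist a = (run P rule s N).rHist a := by
              rw [hrun]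
              exact Function.update_of_ne (by omega) ..
            rw [h2]
            exact h.rHist_pos le_rfl (by omega) e
      · have hrun := run_succ_of_isWidth P rule s hw
        have hi := inv_succ_of_isWidth hC hd hP hrule hn (h.inv N le_rfl) hw
        have hk' : ((run P rule s (N + 1)).k : ℝ) ≤ Kmax + 1 := by
          rw [hrun]
          simp only [widthStep]
          push_cast
          linarith
        refine ⟨hi, hi.near hP ?_ ?_ ?_ hk', hk'⟩
        · rw [hrun]; exact widthW_pos hP hn
        · rw [hrun]; exact fun e => widthR_eq hP hn e
        · intro a ha e
          rw [hrun] at ha ⊢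
          exact h.rHist_pos le_rfl ha e
      · have hrun := run_succ_of_le P rule s hf
        refine ⟨?_, by rw [hrun]; exact hn, by rw [hrun]; exact h.k_le⟩
        intro e
        have hdr : drift P rule s N ≤ drift P rule s (N + 1) := by
          classical
          unfold drift
          refine mul_le_mul_of_nonneg_left ?_ (by have := hP.hτ0; positivity)
          rw [hrun]
          exact_mod_cast Finset.card_le_card
            (Finset.filter_subset_filter _ (Finset.range_subset_range.2 N.le_succ))
        rcases h.inv N le_rfl e with ⟨a, hF⟩ | hW
        · left
          refine ⟨a, by rw [hrun]; exact hF.le, by rw [hrun]; exact hF.rbar_eq,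
            by rw [hrun]; exact hF.width_lt, ?_, by rw [hrun]; exact hF.not_top,
            by rw [hrun]; exact hF.small, by rw [hrun]; exact hF.le_r,
            by rw [hrun]; linarith [hF.r_le]⟩
          intro t' ht' h1
          rcases Nat.eq_or_lt_of_le ht' with h2 | h2
          · rw [h2]
          · rw [hrun]; exact hF.rbar_const t' (by omega) h1
        · right
          exact ⟨by rw [hrun]; exact hW.width_eq, by rw [hrun]; exact hW.le_rbar,
            by rw [hrun]; exact hW.le_r, by rw [hrun]; linarith [hW.r_le]⟩
    refine ⟨hC, hd, hP, hrule, ?_, ?_, hnoise, hkey.2.2⟩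
    · intro t ht
      rcases Nat.eq_or_lt_of_le ht with h1 | h1
      · rw [h1]; exact hkey.2.1
      · exact h.near t (by omega)
    · intro t ht
      rcases Nat.eq_or_lt_of_le ht with h1 | h1
      · rw [h1]; exact hkey.1
      · exact h.inv t (by omega)

end Potential

section Finish

variable {P : Params n m} {rule : Rule n m} {s : Signs P} {xbar Kmax v : ℝ} {N : ℕ}

theorem i_add_k_eq {t : ℕ} (h : ∀ t' < t, (run P rule s t').i < P.T) :
    (run P rule s t).i + (run P rule s t).k = t := by
  induction t with
  | zero => rfl
  | succ t ih =>
    have ih' := ih fun t' ht' => h t' (by omega)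
    rcases step_cases P (run P rule s t) with hp | hw | hf
    · rw [run_succ_of_isPrimal P rule s hp]
      simp only [primalStep]
      omega
    · rw [run_succ_of_isWidth P rule s hw]
      simp only [widthStep]
      omega
    · exact absurd (h t (by omega)) (not_lt.2 hf)

/-- The run ends once the number of width reduction steps is bounded. -/
theorem exists_finish (hk : ∀ t ≤ N, ((run P rule s t).k : ℝ) ≤ Kmax) (hN : P.T + Kmax < N) :
    ∃ K : ℕ, (K : ℝ) ≤ Kmax ∧ P.T + K ≤ N ∧ (run P rule s (P.T + K)).i = P.T ∧
      (run P rule s (P.T + K)).k = K ∧ ∀ t < P.T + K, (run P rule s t).i < P.T := by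
  classical
  have hex : ∃ t, t ≤ N ∧ P.T ≤ (run P rule s t).i := by
    by_contra! h
    have h1 := i_add_k_eq (P := P) (rule := rule) (s := s) (t := N) fun t' ht' => h t' ht'.le
    have h2 := h N le_rfl
    have h3 := hk N le_rfl
    have h4 : ((run P rule s N).i : ℝ) + (run P rule s N).k = N := by exact_mod_cast h1
    have h5 : ((run P rule s N).i : ℝ) ≤ P.T := by exact_mod_cast h2.le
    linarith
  obtain ⟨h1, h2⟩ := Nat.find_spec hex
  set t := Nat.find hex with ht
  have h3 : ∀ t' < t, (run P rule s t').i < P.T := by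
    intro t' ht'
    by_contra! h4
    exact Nat.find_min hex ht' ⟨by omega, h4⟩
  have h4 := i_add_k_eq h3
  have h5 := le_antisymm (run_i_le P rule s t) h2
  have h6 : P.T + (run P rule s t).k = t := by omega
  refine ⟨(run P rule s t).k, hk t h1, by omega, ?_⟩
  rw [h6]
  exact ⟨h5, rfl, h3⟩

open Classical in
theorem Ct_mulVec_x (t : ℕ) : Ct P *ᵥ (run P rule s t).x =
    ∑ t' ∈ (Finset.range t).filter (fun t' => IsPrimal P (run P rule s t')),
      (resid P (run P rule s t') + dt P) := by
  induction t with
  | zero => simp [run_zero, init]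
  | succ t ih =>
    rw [Finset.range_add_one, Finset.filter_insert]
    rcases step_cases P (run P rule s t) with hp | hw | hf
    · rw [if_pos hp, Finset.sum_insert (by simp), ← ih, run_succ_of_isPrimal P rule s hp]
      simp only [primalStep, resid, Matrix.mulVec_add]
      abel
    · rw [if_neg hw.not_isPrimal, ← ih, run_succ_of_isWidth P rule s hw]
      rfl
    · rw [if_neg (fun h' => absurd h'.1 (not_lt.2 hf)), ← ih, run_succ_of_le P rule s hf]

theorem Tame.expo_le_one (h : Tame P rule s xbar Kmax N) {t : ℕ} (ht : t < N)
    (hp : IsPrimal P (run P rule s t)) (e : Coord n) :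
    |expo P (sketch P s (run P rule s t).i) (run P rule s t) e| ≤ 1 := by
  have h1 := abs_expo_le h.nums (h.noise_le t ht hp) e
  have h2 := expo_small h.nums (alpha_mul_resid_le h.inj h.least h.nums (h.near t ht.le) hp.2 e)
  have := h.nums.hε
  linarith

open Classical in
theorem Tame.le_log_w (h : Tame P rule s xbar Kmax N) {t : ℕ} (ht : t ≤ N) (e : Coord n) :
    P.ε * P.α * (∑ t' ∈ (Finset.range t).filter (fun t' => IsPrimal P (run P rule s t')),
      resid P (run P rule s t') e + ∑ t' ∈ Finset.range t, obs P rule (weight (some e)) s t') ≤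
      Real.log ((run P rule s t).w e) := by
  induction t with
  | zero => simp [run_zero, init]
  | succ t ih =>
    have ih' := ih (by omega)
    rw [Finset.range_add_one, Finset.filter_insert, Finset.sum_insert (by simp)]
    rcases step_cases P (run P rule s t) with hp | hw | hf
    · rw [if_pos hp, Finset.sum_insert (by simp), obs_some hp (h.ok (by omega)),
        run_succ_of_isPrimal P rule s hp]
      have h1 := (log_primalW h.nums (h.near t (by omega)) (e := e)
        ((le_abs_self _).trans (h.expo_le_one ht hp e))).1
      rw [expo, sketchedResid_eq] at h1
      simp only [primalStep]
      linarith
    · rw [if_neg hw.not_isPrimal, obs_of_not_isPrimal _ hw.not_isPrimal,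
        run_succ_of_isWidth P rule s hw, zero_add]
      exact ih'.trans (Real.log_le_log ((h.near t (by omega)).w_pos e)
        (le_widthW h.nums (h.near t (by omega)) e))
    · have hp : ¬ IsPrimal P (run P rule s t) := fun h' => absurd h'.1 (not_lt.2 hf)
      rw [if_neg hp, obs_of_not_isPrimal _ hp, run_succ_of_le P rule s hf, zero_add]
      exact ih'

theorem T_pos (hP : Nums P xbar Kmax) : 0 < P.T := by
  by_contra h0
  have h1 : P.T = 0 := by omega
  have h2 := hP.hT'
  rw [h1, Nat.cast_zero, mul_zero] at h2
  have h3 : 0 < Real.log n := Real.log_pos (by linarith [hP.two_le_n])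
  have h4 := div_pos h3 hP.hε0
  linarith

theorem Tame.norm_le (h : Tame P rule s xbar Kmax N) (hs : SmallNoise P rule s N v xbar)
    (hv : P.ε * P.α * v ≤ P.ε / (25600 * (1 + Real.log n))) (hi : (run P rule s N).i = P.T) :
    ‖P.C *ᵥ ((P.T : ℝ)⁻¹ • (run P rule s N).x) - P.d‖ ≤ 1 + 6 * P.ε := by
  classical
  have hε := h.nums.hε0
  have hε2 := h.nums.hε
  have hα := h.nums.hα0
  have hL := h.nums.one_le_L
  have hn2 := h.nums.two_le_n
  have hT : (0 : ℝ) < P.T := by exact_mod_cast T_pos h.nums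
  set a := P.ε * P.α * P.T with ha
  have ha0 : 0 < a := by positivity
  have key : ∀ e, (Ct P *ᵥ ((P.T : ℝ)⁻¹ • (run P rule s N).x) - dt P) e ≤ 1 + 6 * P.ε := by
    intro e
    have h1 := h.le_log_w le_rfl e
    have h2 := h.log_phi_le' hs hv
    have hn := h.near N le_rfl
    have h3 := Real.log_le_log (hn.w_pos e)
      (Finset.single_le_sum (fun f _ => (hn.w_pos f).le) (Finset.mem_univ e))
    have h4 := mul_le_mul_of_nonneg_left ((abs_le.1 (hs.1 (some e) N le_rfl)).1)
      (by positivity : 0 ≤ P.ε * P.α)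
    have h5 : (Ct P *ᵥ ((P.T : ℝ)⁻¹ • (run P rule s N).x) - dt P) e = (P.T : ℝ)⁻¹ *
        ∑ t' ∈ (Finset.range N).filter (fun t' => IsPrimal P (run P rule s t')),
          resid P (run P rule s t') e := by
      rw [Matrix.mulVec_smul, Ct_mulVec_x, Finset.sum_add_distrib, Finset.sum_const, card_isPrimal,
        hi]
      simp only [Pi.sub_apply, Pi.smul_apply, Pi.add_apply, Finset.sum_apply, smul_eq_mul,
        nsmul_eq_mul, Pi.mul_apply, Pi.natCast_apply]
      field_simp
      ring
    rw [h5, inv_mul_le_iff₀ hT]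
    set U := ∑ t' ∈ (Finset.range N).filter (fun t' => IsPrimal P (run P rule s t')),
          resid P (run P rule s t') e
    have h6 : P.ε / (25600 * (1 + Real.log n)) ≤ P.ε / 25600 :=
      div_le_div_of_nonneg_left hε.le (by norm_num) (by linarith)
    have h7 : Real.log (2 * n) ≤ 2 * Real.log n := by
      rw [Real.log_mul two_ne_zero (by linarith)]
      linarith [Real.log_le_log two_pos hn2]
    have h8 : Real.log n ≤ P.ε * a := by
      have := h.nums.hT'
      rw [div_le_iff₀ hε] at this
      linarith
    have h9 : P.ε / 100 ≤ P.ε * a := by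
      have := Real.log_le_log two_pos hn2
      have := Real.log_two_gt_d9
      linarith
    have h10 : P.ε * P.α * U ≤ P.ε * P.α * (P.T * (1 + 6 * P.ε)) := by
      have e1 : (P.T : ℝ) * (P.ε * P.α * (1 + 2 * P.ε)) = a + 2 * (P.ε * a) := by rw [ha]; ring
      have e2 : P.ε * P.α * (P.T * (1 + 6 * P.ε)) = a + 6 * (P.ε * a) := by rw [ha]; ring
      rw [e2]
      rw [e1] at h2
      linarith
    exact le_of_mul_le_mul_left h10 (by positivity)
  rw [pi_norm_le_iff_of_nonneg (by positivity)]
  intro e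
  rw [Real.norm_eq_abs, abs_le]
  have h1 := key (Sum.inl e)
  have h2 := key (Sum.inr e)
  simp only [Pi.sub_apply, Ct_mulVec_inl, Ct_mulVec_inr, dt, Sum.elim_inl, Sum.elim_inr,
    Pi.neg_apply] at h1 h2 ⊢
  constructor <;> linarith

end Finish

theorem sqrt_sum_le_sum_sqrt {ι : Type*} (S : Finset ι) {f : ι → ℝ} (hf : ∀ i, 0 ≤ f i) :
    √(∑ i ∈ S, f i) ≤ ∑ i ∈ S, √(f i) := by
  classical
  induction S using Finset.induction_on with
  | empty => simp
  | insert a S ha ih =>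
    rw [Finset.sum_insert ha, Finset.sum_insert ha]
    refine le_trans ?_ (add_le_add_right ih _)
    have h1 := Finset.sum_nonneg fun i (_ : i ∈ S) => hf i
    rw [Real.sqrt_le_left (by positivity)]
    nlinarith [Real.sq_sqrt (hf a), Real.sq_sqrt h1, mul_nonneg (Real.sqrt_nonneg (f a))
      (Real.sqrt_nonneg (∑ i ∈ S, f i))]

section Changes

variable {P : Params n m} {rule : Rule n m} {s : Signs P} {xbar Kmax v : ℝ} {N : ℕ}

open Classical in
theorem updateRank_le {t : ℕ} {A : Finset (Coord n)}
    (hA : ∀ e, (run P rule s (t + 1)).rbar e ≠ (run P rule s t).rbar e → e ∈ A) :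
    updateRank P rule s t ≤ A.card := by
  unfold updateRank
  rw [Matrix.diagonal_sub, Matrix.rank_diagonal, Fintype.card_subtype]
  refine Finset.card_le_card fun e he => hA e ?_
  rw [Finset.mem_filter] at he
  exact sub_ne_zero.1 he.2

theorem updateRank_le_card (t : ℕ) : updateRank P rule s t ≤ 2 * n := by
  classical
  refine (updateRank_le (A := Finset.univ) fun e _ => Finset.mem_univ e).trans ?_
  simp [two_mul]

theorem updateRank_le_of_isWidth {t : ℕ} (h : IsWidth P (run P rule s t)) :
    updateRank P rule s t ≤ (widthSet P rule (run P rule s t)).card := by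
  refine updateRank_le fun e he => ?_
  by_contra h1
  apply he
  rw [run_succ_of_isWidth P rule s h]
  exact if_neg h1

open Classical in
theorem card_primal_Ico {t₀ t₁ : ℕ} (h : t₀ ≤ t₁) :
    (run P rule s t₀).i + ((Finset.Ico t₀ t₁).filter fun t => IsPrimal P (run P rule s t)).card =
      (run P rule s t₁).i := by
  rw [← card_isPrimal P rule s t₀, ← card_isPrimal P rule s t₁, ← Finset.card_union_of_disjoint]
  · rw [← Finset.filter_union]
    congr 2
    ext x
    simp only [Finset.mem_union, Finset.mem_range, Finset.mem_Ico]
    omega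
  · refine Finset.disjoint_filter_filter ?_
    rw [Finset.disjoint_left]
    intro x hx hx'
    rw [Finset.mem_range] at hx
    rw [Finset.mem_Ico] at hx'
    omega

theorem SmallNoise.abs_sum_Ico_le (hs : SmallNoise P rule s N v xbar) (q : Option (Coord n))
    {t₀ t₁ : ℕ} (h : t₀ ≤ t₁) (h1 : t₁ ≤ N) :
    |∑ t ∈ Finset.Ico t₀ t₁, obs P rule (weight q) s t| ≤ 2 * v := by
  rw [Finset.sum_Ico_eq_sub _ h]
  refine (abs_sub _ _).trans ?_
  linarith [hs.1 q t₀ (h.trans h1), hs.1 q t₁ h1]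

open Classical in
theorem Tame.abs_log_w_sub_le (h : Tame P rule s xbar Kmax N) {t₀ t₁ : ℕ} (h01 : t₀ ≤ t₁)
    (ht₁ : t₁ ≤ N) {e : Coord n} (he : ∀ t, t₀ ≤ t → t < t₁ → IsWidth P (run P rule s t) →
      e ∉ widthSet P rule (run P rule s t)) :
    |Real.log ((run P rule s t₁).w e) - Real.log ((run P rule s t₀).w e) -
      P.ε * P.α * ∑ t ∈ Finset.Ico t₀ t₁, obs P rule (weight (some e)) s t| ≤
      ∑ t ∈ (Finset.Ico t₀ t₁).filter (fun t => IsPrimal P (run P rule s t)),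
        (2 * (P.ε * P.α * |resid P (run P rule s t) e|) + 2 * (P.ε * P.α * xbar) ^ 2) := by
  have hε := h.nums.hε0
  have hε2 := h.nums.hε
  have hα := h.nums.hα0
  induction t₁, h01 using Nat.le_induction with
  | base => simp
  | succ t₁ h01 ih =>
    have ih' := ih (by omega) fun t h2 h3 => he t h2 (by omega)
    rw [Finset.sum_Ico_succ_top h01, ← Finset.insert_Ico_right_eq_Ico_add_one h01,
      Finset.filter_insert]
    rcases step_cases P (run P rule s t₁) with hp | hw | hf
    · rw [if_pos hp, Finset.sum_insert (by simp), obs_some hp (h.ok (by omega))]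
      have hn := h.near t₁ (by omega)
      have h1 := log_primalW h.nums hn (e := e)
        ((le_abs_self _).trans (h.expo_le_one (by omega) hp e))
      have h2 := abs_expo_le h.nums (h.noise_le t₁ (by omega) hp) e
      have h3 := alpha_mul_resid_le h.inj h.least h.nums hn hp.2 e
      have h4 : (run P rule s (t₁ + 1)).w e =
          primalW P (sketch P s (run P rule s t₁).i) (run P rule s t₁) e := by
        rw [run_succ_of_isPrimal P rule s hp]; rfl
      rw [← h4] at h1
      have h5 : expo P (sketch P s (run P rule s t₁).i) (run P rule s t₁) e = P.ε * P.α *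
          (resid P (run P rule s t₁) e +
            noise P (sketch P s (run P rule s t₁).i) (run P rule s t₁) e) := by
        rw [expo, sketchedResid_eq]
      set z := expo P (sketch P s (run P rule s t₁).i) (run P rule s t₁) e
      set u := resid P (run P rule s t₁) e
      have h6 : z ^ 2 ≤ 2 * (P.ε * P.α * |u|) ^ 2 + 2 * (P.ε * P.α * xbar) ^ 2 := by
        have := pow_le_pow_left₀ (abs_nonneg z) h2 2
        rw [sq_abs] at this
        nlinarith [sq_nonneg (P.ε * P.α * |u| - P.ε * P.α * xbar)]
      have h7 : 2 * (P.ε * P.α * |u|) ^ 2 ≤ P.ε * P.α * |u| := by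
        have h8 : P.ε * P.α * |u| ≤ 1 / 2 := by nlinarith
        have h9 : 0 ≤ P.ε * P.α * |u| := by positivity
        nlinarith
      have h8 : |P.ε * P.α * u| = P.ε * P.α * |u| := by
        rw [abs_mul, abs_of_pos (by positivity)]
      have h9 := abs_le.1 h8.le
      rw [abs_le] at ih' ⊢
      have h10 : 0 ≤ P.ε * P.α * |u| := by positivity
      constructor <;> nlinarith [sq_nonneg (P.ε * P.α * xbar)]
    · have h1 : (run P rule s (t₁ + 1)).w e = (run P rule s t₁).w e := by
        rw [run_succ_of_isWidth P rule s hw]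
        exact if_neg (he t₁ h01 (by omega) hw)
      rw [if_neg hw.not_isPrimal, obs_of_not_isPrimal _ hw.not_isPrimal, h1, add_zero]
      exact ih'
    · have hp : ¬ IsPrimal P (run P rule s t₁) := fun h' => absurd h'.1 (not_lt.2 hf)
      rw [if_neg hp, obs_of_not_isPrimal _ hp, run_succ_of_le P rule s hf, add_zero]
      exact ih'

open Classical in
theorem Tame.abs_log_phi_sub_le (h : Tame P rule s xbar Kmax N) {t₀ t₁ : ℕ} (h01 : t₀ ≤ t₁)
    (ht₁ : t₁ ≤ N) :
    |Real.log (∑ e, (run P rule s t₁).w e) - Real.log (∑ e, (run P rule s t₀).w e) -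
      P.ε * P.α * ∑ t ∈ Finset.Ico t₀ t₁, obs P rule (weight none) s t| ≤
      2 * P.ε * P.α * ((Finset.Ico t₀ t₁).filter fun t => IsPrimal P (run P rule s t)).card +
      4 * P.ε / P.τ * ((Finset.Ico t₀ t₁).filter fun t => IsWidth P (run P rule s t)).card := by
  have hε := h.nums.hε0
  have hε2 := h.nums.hε
  have hα := h.nums.hα0
  induction t₁, h01 using Nat.le_induction with
  | base => simp
  | succ t₁ h01 ih =>
    have ih' := ih (by omega)
    rw [Finset.sum_Ico_succ_top h01, ← Finset.insert_Ico_right_eq_Ico_add_one h01,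
      Finset.filter_insert, Finset.filter_insert]
    rcases step_cases P (run P rule s t₁) with hp | hw | hf
    · rw [if_pos hp, if_neg (fun h' => h'.not_isPrimal hp), obs_none hp (h.ok (by omega)),
        run_succ_of_isPrimal P rule s hp, Finset.card_insert_of_notMem (by simp)]
      have hn := h.near t₁ (by omega)
      have h1 := log_sum_primalW h.inj h.least h.nums hn (h.noise_le t₁ ht₁ hp)
      have h2 := abs_sum_weight_mul_le h.inj h.least h.nums hn
      have h3 : P.ε ^ 2 / 50 / P.ε = P.ε / 50 := by field_simp
      rw [h3] at h1
      have h4 : |P.ε * P.α * ∑ e, weight none (run P rule s t₁) e *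
          resid P (run P rule s t₁) e| ≤ P.ε * P.α * (1 + P.ε) := by
        rw [abs_mul, abs_of_pos (by positivity)]
        exact mul_le_mul_of_nonneg_left h2 (by positivity)
      have h5 : P.ε * P.α * (1 + P.ε) + P.ε * P.α * (P.ε / 50) ≤ 2 * P.ε * P.α := by
        have : 0 < P.ε * P.α := by positivity
        nlinarith
      simp only [primalStep]
      push_cast
      rw [abs_le] at ih' h1 h4 ⊢
      constructor <;> linarith
    · rw [if_neg hw.not_isPrimal, if_pos hw, obs_of_not_isPrimal _ hw.not_isPrimal,
        run_succ_of_isWidth P rule s hw, Finset.card_insert_of_notMem (by simp)]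
      have h1 := log_sum_widthW h.inj h.least h.nums h.valid (h.near t₁ (by omega)) hw.2
      simp only [widthStep]
      push_cast
      rw [abs_le] at ih' ⊢
      constructor <;> linarith
    · have hp : ¬ IsPrimal P (run P rule s t₁) := fun h' => absurd h'.1 (not_lt.2 hf)
      have hw : ¬ IsWidth P (run P rule s t₁) := fun h' => absurd h'.1 (not_lt.2 hf)
      rw [if_neg hp, if_neg hw, obs_of_not_isPrimal _ hp, run_succ_of_le P rule s hf, add_zero]
      exact ih'

open Classical in
/-- The primal steps in a window that ends with the primal step `t`. -/
noncomputable def window (P : Params n m) (rule : Rule n m) (s : Signs P) (t l : ℕ) : Finset ℕ :=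
  (Finset.range (t + 1)).filter fun t' =>
    IsPrimal P (run P rule s t') ∧ (run P rule s t).i + 1 ≤ (run P rule s t').i + 2 ^ l

theorem card_window_le (t l : ℕ) : (window P rule s t l).card ≤ 2 ^ l := by
  classical
  have h := card_le_of_isPrimal P rule s (S := window P rule s t l)
    (fun t' ht' => (Finset.mem_filter.1 ht').2.1)
    (R := Finset.Ico ((run P rule s t).i + 1 - 2 ^ l) ((run P rule s t).i + 1)) (fun t' ht' => by
      obtain ⟨h1, -, h2⟩ := Finset.mem_filter.1 ht'
      have h3 := run_i_mono P rule s (Nat.lt_succ_iff.1 (Finset.mem_range.1 h1))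
      simp only at h3
      rw [Finset.mem_Ico]
      omega)
  rw [Nat.card_Ico] at h
  exact h.trans tsub_tsub_le

/-- The reasons for which `selectVector` refreshes a coordinate. -/
theorem Tame.selected_cases (h : Tame P rule s xbar Kmax N) (hs : SmallNoise P rule s N v xbar)
    (hv : P.ε * P.α * v ≤ P.ε / (25600 * (1 + Real.log n))) {t l : ℕ} (ht : t < N)
    (hp : IsPrimal P (run P rule s t)) (hd : 2 ^ l ∣ (run P rule s t).i + 1) {e : Coord n}
    (hth : P.δ / (2 * Real.logb 2 n) ≤ |Real.log ((run P rule s (t + 1)).r e /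
      (run P rule s t).rHist ((run P rule s t).i + 1 - 2 ^ l) e)|)
    (hlast : ∀ j ∈ (run P rule s t).lastWidth e, j + 2 ^ l ≤ (run P rule s t).i + 1) :
    (∃ j, (run P rule s t).lastWidth e = some j ∧ j + 2 ^ l = (run P rule s t).i + 1) ∨
    1 ≤ 1600 * (1 + Real.log n) * P.α * 2 ^ l ∨
    P.ε / (1600 * (1 + Real.log n)) ≤
      P.ε * P.α * ∑ t' ∈ window P rule s t l, |resid P (run P rule s t') e| := by
  classical
  by_cases hW : ∃ j, (run P rule s t).lastWidth e = some j ∧ j + 2 ^ l = (run P rule s t).i + 1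
  · exact Or.inl hW
  right
  have hε := h.nums.hε0
  have hε2 := h.nums.hε
  have hα := h.nums.hα0
  have hL := h.nums.one_le_L
  obtain ⟨hlg1, hlg2, -, -⟩ := logb_facts h.nums
  have hle := Nat.le_of_dvd (by omega) hd
  have hp2 : 0 < 2 ^ l := by positivity
  obtain ⟨t₀, h1, h2, h3, -⟩ := exists_hit_time P rule s t ((run P rule s t).i + 1 - 2 ^ l)
    (by omega)
  have hn0 := h.near t₀ (by omega)
  have hn1 := h.near (t + 1) ht
  rw [h3, Real.log_div (hn1.r_pos h.nums e).ne' (hn0.r_pos h.nums e).ne'] at hth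
  set L := 1 + Real.log n with hLdef
  have hth' : P.ε / (400 * L) ≤ P.δ / (2 * Real.logb 2 n) := by
    rw [h.nums.hδ, div_div]
    refine div_le_div_of_nonneg_left hε.le (by positivity) (by linarith)
  have hno : ∀ t', t₀ ≤ t' → t' < t + 1 → IsWidth P (run P rule s t') →
      e ∉ widthSet P rule (run P rule s t') := by
    intro t' h4 h5 h6 h7
    rcases Nat.eq_or_lt_of_le (Nat.lt_succ_iff.1 h5) with h8 | h8
    · rw [h8] at h6
      exact h6.not_isPrimal hp
    · obtain ⟨j, h9, h10⟩ := lastWidth_of_mem P rule s h8 h6 h7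
      have h11 := run_i_mono P rule s h4
      simp only at h11
      have h12 := hlast j h9
      exact hW ⟨j, h9, by omega⟩
  have hcard := card_primal_Ico (P := P) (rule := rule) (s := s) (show t₀ ≤ t + 1 by omega)
  rw [run_i_succ_of_isPrimal P rule s hp, h2] at hcard
  have hcard' : ((Finset.Ico t₀ (t + 1)).filter fun t => IsPrimal P (run P rule s t)).card =
      2 ^ l := by omega
  have hww := h.abs_log_w_sub_le (show t₀ ≤ t + 1 by omega) ht hno
  have hphi := h.abs_log_phi_sub_le (show t₀ ≤ t + 1 by omega) ht
  have hobs : ∀ q, |P.ε * P.α * ∑ t ∈ Finset.Ico t₀ (t + 1), obs P rule (weight q) s t| ≤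
      P.ε / (12800 * L) := by
    intro q
    rw [abs_mul, abs_of_pos (by positivity)]
    have h4 := mul_le_mul_of_nonneg_left
      (hs.abs_sum_Ico_le q (show t₀ ≤ t + 1 by omega) ht) (by positivity : 0 ≤ P.ε * P.α)
    have h5 : P.ε / (12800 * L) = 2 * (P.ε / (25600 * L)) := by field_simp; norm_num
    rw [h5]
    linarith
  rw [hcard'] at hphi
  have hmax : P.ε / (400 * L) ≤
      max |Real.log ((run P rule s (t + 1)).w e) - Real.log ((run P rule s t₀).w e)|
      |Real.log (∑ e, (run P rule s (t + 1)).w e) - Real.log (∑ e, (run P rule s t₀).w e)| :=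
    (hth'.trans hth).trans (log_r_step (by have := h.nums.hn; omega) hε hn0.w_pos hn1.w_pos
      (hn0.r_eq e) (hn1.r_eq e) (le_max_left _ _) (le_max_right _ _))
  set y := P.ε / L with hy
  have hy0 : 0 < y := by positivity
  have ey : ∀ c : ℝ, P.ε / (c * L) = y / c := fun c => by rw [hy, div_div, mul_comm]
  rw [ey] at hmax ⊢
  simp only [ey] at hobs
  rcases le_max_iff.1 hmax with h4 | h4
  · right
    rw [Finset.sum_add_distrib, Finset.sum_const, hcard', ← Finset.mul_sum, ← Finset.mul_sum,
      nsmul_eq_mul] at hww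
    have h5 : ((2 ^ l : ℕ) : ℝ) * (2 * (P.ε * P.α * xbar) ^ 2) ≤ y / 6400 := by
      have e1 : ((2 ^ l : ℕ) : ℝ) ≤ P.T := by
        have := hp.1
        exact_mod_cast (by omega : 2 ^ l ≤ P.T)
      calc ((2 ^ l : ℕ) : ℝ) * (2 * (P.ε * P.α * xbar) ^ 2) ≤
          P.T * (2 * (P.ε * P.α * xbar) ^ 2) := by gcongr
        _ = 2 * P.ε * (P.ε * P.α * P.T) * (P.α * xbar ^ 2) := by ring
        _ ≤ 2 * P.ε * (L / P.ε) * (P.ε / (12800 * L ^ 2)) := by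
            have := h.nums.hT
            have := h.nums.hx2
            gcongr
        _ = y / 6400 := by rw [hy]; field_simp; norm_num
    have h6 : ∑ t' ∈ (Finset.Ico t₀ (t + 1)).filter (fun t => IsPrimal P (run P rule s t)),
        |resid P (run P rule s t') e| ≤
        ∑ t' ∈ window P rule s t l, |resid P (run P rule s t') e| := by
      refine Finset.sum_le_sum_of_subset_of_nonneg ?_ fun _ _ _ => abs_nonneg _
      intro t' ht'
      rw [Finset.mem_filter, Finset.mem_Ico] at ht'
      have h7 := run_i_mono P rule s ht'.1.1
      simp only at h7
      unfold window
      rw [Finset.mem_filter, Finset.mem_range]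
      exact ⟨ht'.1.2, ht'.2, by omega⟩
    have h7 := mul_le_mul_of_nonneg_left h6 (by positivity : 0 ≤ P.ε * P.α)
    have h8 := abs_sub_abs_le_abs_sub (Real.log ((run P rule s (t + 1)).w e) -
      Real.log ((run P rule s t₀).w e))
      (P.ε * P.α * ∑ t ∈ Finset.Ico t₀ (t + 1), obs P rule (weight (some e)) s t)
    have h9 := hobs (some e)
    linarith
  · left
    have h8 := abs_sub_abs_le_abs_sub (Real.log (∑ e, (run P rule s (t + 1)).w e) -
      Real.log (∑ e, (run P rule s t₀).w e))
      (P.ε * P.α * ∑ t ∈ Finset.Ico t₀ (t + 1), obs P rule (weight none) s t)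
    have h9 := hobs none
    have hτ := h.nums.hτ0
    have h10 : 4 * P.ε / P.τ *
        ((Finset.Ico t₀ (t + 1)).filter fun t => IsWidth P (run P rule s t)).card ≤ y / 10 ^ 4 := by
      have e1 : (((Finset.Ico t₀ (t + 1)).filter fun t => IsWidth P (run P rule s t)).card : ℝ) ≤
          Kmax + 1 := by
        refine le_trans ?_ h.k_le
        rw [← card_isWidth]
        refine Nat.cast_le.2 (Finset.card_le_card (Finset.filter_subset_filter _ fun x hx => ?_))
        rw [Finset.mem_Ico] at hx
        rw [Finset.mem_range]
        omega
      calc _ ≤ 4 * P.ε / P.τ * (Kmax + 1) := by gcongr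
        _ ≤ P.ε / (10 ^ 4 * L ^ 2) := h.nums.hK
        _ ≤ P.ε / (10 ^ 4 * L) := by
            refine div_le_div_of_nonneg_left hε.le (by positivity) ?_
            nlinarith
        _ = y / 10 ^ 4 := ey _
    have h11 : y / 800 ≤ 2 * P.ε * P.α * (2 ^ l : ℕ) := by linarith
    push_cast at h11
    rw [hy, div_div, div_le_iff₀ (by positivity)] at h11
    have h12 : P.ε * 1 ≤ P.ε * (1600 * L * P.α * 2 ^ l) := by linarith
    exact le_of_mul_le_mul_left h12 hε

open Classical in
/-- The coordinates with large residuals in a window. -/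
noncomputable def heavy (P : Params n m) (rule : Rule n m) (s : Signs P) (t l : ℕ) :
    Finset (Coord n) :=
  Finset.univ.filter fun e => P.ε / (1600 * (1 + Real.log n)) ≤
    P.ε * P.α * ∑ t' ∈ window P rule s t l, |resid P (run P rule s t') e|

theorem Tame.card_heavy_le (h : Tame P rule s xbar Kmax N) {t l : ℕ} (ht : t < N) :
    ((heavy P rule s t l).card : ℝ) ≤
      (2 ^ l) ^ 2 * (4 * 1600 ^ 2 * (1 + Real.log n) ^ 2 * n * P.α ^ 2 / P.ε) := by
  classical
  have hε := h.nums.hε0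
  have hα := h.nums.hα0
  have hL := h.nums.one_le_L
  set L := 1 + Real.log n with hLdef
  set S := window P rule s t l with hS
  have hScard : (S.card : ℝ) ≤ 2 ^ l := by exact_mod_cast card_window_le t l
  have h1 : (heavy P rule s t l).card * (P.ε / (1600 * L)) ^ 2 ≤
      (P.ε * P.α) ^ 2 * ((2 ^ l) ^ 2 * (4 * n / P.ε)) := by
    calc _ = ∑ e ∈ heavy P rule s t l, (P.ε / (1600 * L)) ^ 2 := by
          rw [Finset.sum_const, nsmul_eq_mul]
      _ ≤ ∑ e ∈ heavy P rule s t l, (P.ε * P.α) ^ 2 *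
          (2 ^ l * ∑ t' ∈ S, resid P (run P rule s t') e ^ 2) := by
          refine Finset.sum_le_sum fun e he => ?_
          have h2 := pow_le_pow_left₀ (by positivity) (Finset.mem_filter.1 he).2 2
          refine h2.trans ?_
          rw [mul_pow]
          refine mul_le_mul_of_nonneg_left ?_ (by positivity)
          have h3 := sq_sum_le_card_mul_sum_sq (s := S)
            (f := fun t' => |resid P (run P rule s t') e|)
          simp only [sq_abs] at h3
          exact h3.trans (mul_le_mul_of_nonneg_right hScard
            (Finset.sum_nonneg fun _ _ => sq_nonneg _))
      _ ≤ ∑ e, (P.ε * P.α) ^ 2 * (2 ^ l * ∑ t' ∈ S, resid P (run P rule s t') e ^ 2) := by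
          refine Finset.sum_le_sum_of_subset_of_nonneg (Finset.subset_univ _) fun e _ _ => ?_
          have := Finset.sum_nonneg fun t' (_ : t' ∈ S) => sq_nonneg (resid P (run P rule s t') e)
          positivity
      _ = (P.ε * P.α) ^ 2 * (2 ^ l * ∑ t' ∈ S, ∑ e, resid P (run P rule s t') e ^ 2) := by
          rw [← Finset.mul_sum, ← Finset.mul_sum, Finset.sum_comm]
      _ ≤ (P.ε * P.α) ^ 2 * (2 ^ l * (2 ^ l * (4 * n / P.ε))) := by
          refine mul_le_mul_of_nonneg_left (mul_le_mul_of_nonneg_left ?_ (by positivity))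
            (by positivity)
          calc _ ≤ ∑ t' ∈ S, 4 * (n : ℝ) / P.ε := by
                refine Finset.sum_le_sum fun t' ht' => ?_
                have h4 := Finset.mem_range.1 (Finset.mem_filter.1 ht').1
                exact sum_resid_sq_univ_le h.inj h.least h.nums (h.near t' (by omega))
            _ = S.card * (4 * n / P.ε) := by rw [Finset.sum_const, nsmul_eq_mul]
            _ ≤ _ := mul_le_mul_of_nonneg_right hScard (by positivity)
      _ = _ := by ring
  have h2 : (P.ε * P.α) ^ 2 * ((2 ^ l) ^ 2 * (4 * n / P.ε)) =
      (2 ^ l) ^ 2 * (4 * 1600 ^ 2 * L ^ 2 * n * P.α ^ 2 / P.ε) * (P.ε / (1600 * L)) ^ 2 := by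
    field_simp
  rw [h2] at h1
  exact le_of_mul_le_mul_right h1 (by positivity)

end Changes

section Rank

variable {P : Params n m} {rule : Rule n m} {s : Signs P} {xbar Kmax v : ℝ} {N : ℕ}

open Classical in
theorem Tame.sum_sqrt_card_le (h : Tame P rule s xbar Kmax N) (hs : SmallNoise P rule s N v xbar)
    (hv : P.ε * P.α * v ≤ P.ε / (25600 * (1 + Real.log n))) :
    ∑ t ∈ (Finset.range N).filter (fun t => IsWidth P (run P rule s t)),
      √((widthSet P rule (run P rule s t)).card) ≤
      128032 * P.C₃ * (1 + Real.log n) ^ 4 * √(n / P.ε) / P.ε ^ 2 := by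
  have hε := h.nums.hε0
  have hL := h.nums.one_le_L
  have hn0 := h.nums.n_pos
  have hρ : 0 < P.ρ := by linarith [h.nums.hρ]
  have h1 := h.sum_energy_le hs hv
  set L := 1 + Real.log n with hLdef
  have h2 : ∀ t ∈ (Finset.range N).filter (fun t => IsWidth P (run P rule s t)),
      √((widthSet P rule (run P rule s t)).card) ≤
        8 * L * √(n / P.ε) / P.ρ * energy P rule (run P rule s t) := by
    intro t ht
    rw [Finset.mem_filter, Finset.mem_range] at ht
    have hn := h.near t ht.1.le
    have h3 := (energy_bounds h.inj h.least h.nums h.valid hn ht.2.2).2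
    have h4 := energy_nonneg (rule := rule) hn
    rw [Real.sqrt_le_left (by positivity), mul_pow, div_pow, mul_pow, Real.sq_sqrt (by positivity)]
    rw [show (8 * L) ^ 2 * (n / P.ε) / P.ρ ^ 2 * energy P rule (run P rule s t) ^ 2 =
      64 * n * L ^ 2 * energy P rule (run P rule s t) ^ 2 / (P.ρ ^ 2 * P.ε) by field_simp; ring,
      le_div_iff₀ (by positivity)]
    linarith
  calc _ ≤ ∑ t ∈ (Finset.range N).filter (fun t => IsWidth P (run P rule s t)),
        8 * L * √(n / P.ε) / P.ρ * energy P rule (run P rule s t) := Finset.sum_le_sum h2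
    _ ≤ 8 * L * √(n / P.ε) / P.ρ * (16004 * P.C₃ * L ^ 3 * P.ρ / P.ε ^ 2) := by
        rw [← Finset.mul_sum]
        exact mul_le_mul_of_nonneg_left h1 (by positivity)
    _ = _ := by field_simp; ring

open Classical in
/-- The sizes of the width reduction steps that can cause updates at time `t`. -/
noncomputable def load (P : Params n m) (rule : Rule n m) (s : Signs P) (N l t : ℕ) : ℝ :=
  if IsPrimal P (run P rule s t) then
    ∑ l' ∈ Finset.range (l + 1),
      ∑ t' ∈ (Finset.range N).filter (fun t' => IsWidth P (run P rule s t')),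
        if (run P rule s t').i + 2 ^ l' = (run P rule s t).i + 1 then
          ((widthSet P rule (run P rule s t')).card : ℝ) else 0
  else (widthSet P rule (run P rule s t)).card

open Classical in
theorem sum_sqrt_load_le (hfin : ∀ t < N, (run P rule s t).i < P.T) (l : ℕ) :
    ∑ t ∈ Finset.range N, √(load P rule s N l t) ≤ (l + 2) *
      ∑ t ∈ (Finset.range N).filter (fun t => IsWidth P (run P rule s t)),
        √((widthSet P rule (run P rule s t)).card) := by
  set W := (Finset.range N).filter (fun t => IsWidth P (run P rule s t)) with hW
  set V := ∑ t ∈ W, √((widthSet P rule (run P rule s t)).card) with hV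
  rw [← Finset.sum_filter_add_sum_filter_not (Finset.range N)
    (fun t => IsPrimal P (run P rule s t))]
  have h1 : ∑ t ∈ (Finset.range N).filter (fun t => ¬ IsPrimal P (run P rule s t)),
      √(load P rule s N l t) ≤ V := by
    refine le_of_eq ?_
    have h2 : (Finset.range N).filter (fun t => ¬ IsPrimal P (run P rule s t)) = W := by
      rw [hW]
      refine Finset.filter_congr fun t ht => ?_
      have h3 := hfin t (Finset.mem_range.1 ht)
      constructor
      · exact fun h4 => ⟨h3, fun h5 => h4 ⟨h3, h5⟩⟩
      · exact fun h4 => h4.not_isPrimal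
    rw [h2, hV]
    refine Finset.sum_congr rfl fun t ht => ?_
    rw [load, if_neg (Finset.mem_filter.1 ht).2.not_isPrimal]
  have h2 : ∑ t ∈ (Finset.range N).filter (fun t => IsPrimal P (run P rule s t)),
      √(load P rule s N l t) ≤ (l + 1) * V := by
    have h3 : ∀ t ∈ (Finset.range N).filter (fun t => IsPrimal P (run P rule s t)),
        √(load P rule s N l t) ≤ ∑ l' ∈ Finset.range (l + 1), ∑ t' ∈ W,
          if (run P rule s t').i + 2 ^ l' = (run P rule s t).i + 1 then
          √((widthSet P rule (run P rule s t')).card) else 0 := by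
      intro t ht
      rw [load, if_pos (Finset.mem_filter.1 ht).2]
      have h0 : ∀ l' t', (0 : ℝ) ≤ if (run P rule s t').i + 2 ^ l' = (run P rule s t).i + 1 then
          ((widthSet P rule (run P rule s t')).card : ℝ) else 0 := by
        intro l' t'
        split_ifs <;> positivity
      refine (sqrt_sum_le_sum_sqrt _ fun l' => Finset.sum_nonneg fun t' _ => h0 l' t').trans
        (Finset.sum_le_sum fun l' _ => ?_)
      refine (sqrt_sum_le_sum_sqrt _ fun t' => h0 l' t').trans
        (Finset.sum_le_sum fun t' _ => ?_)
      split_ifs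
      · exact le_rfl
      · simp
    refine (Finset.sum_le_sum h3).trans ?_
    rw [Finset.sum_comm]
    calc _ ≤ ∑ l' ∈ Finset.range (l + 1), V := by
          refine Finset.sum_le_sum fun l' _ => ?_
          rw [Finset.sum_comm, hV]
          refine Finset.sum_le_sum fun t' _ => ?_
          rw [← Finset.sum_filter, Finset.sum_const, nsmul_eq_mul]
          refine mul_le_of_le_one_left (Real.sqrt_nonneg _) ?_
          have h4 : (((Finset.range N).filter (fun t => IsPrimal P (run P rule s t))).filter
              fun t => (run P rule s t').i + 2 ^ l' = (run P rule s t).i + 1).card ≤ 1 := by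
            rw [Finset.card_le_one]
            intro a ha b hb
            rw [Finset.mem_filter, Finset.mem_filter] at ha hb
            exact eq_of_isPrimal P rule s ha.1.2 hb.1.2 (by have := ha.2; have := hb.2; omega)
          exact_mod_cast h4
      _ = (l + 1) * V := by
          rw [Finset.sum_const, Finset.card_range, nsmul_eq_mul]
          push_cast
          ring
  linarith

open Classical in
theorem Tame.updateRank_le_load (h : Tame P rule s xbar Kmax N)
    (hs : SmallNoise P rule s N v xbar)
    (hv : P.ε * P.α * v ≤ P.ε / (25600 * (1 + Real.log n))) {l t : ℕ} (ht : t < N)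
    (hl : l < Nat.log 2 n) (hsmall : 1600 * (1 + Real.log n) * P.α * 2 ^ l < 1)
    (hp : IsPrimal P (run P rule s t)) (hd : ¬ 2 ^ (l + 1) ∣ (run P rule s t).i + 1) :
    (updateRank P rule s t : ℝ) ≤ load P rule s N l t + 2 * 2 ^ (2 * l) *
      (4 * 1600 ^ 2 * (1 + Real.log n) ^ 2 * n * P.α ^ 2 / P.ε) := by
  have hε := h.nums.hε0
  have hα := h.nums.hα0
  have hL := h.nums.one_le_L
  set c := 4 * 1600 ^ 2 * (1 + Real.log n) ^ 2 * n * P.α ^ 2 / P.ε with hc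
  have hc0 : 0 ≤ c := by positivity
  set W := (Finset.range N).filter (fun t => IsWidth P (run P rule s t)) with hW
  set wd : ℕ → Finset (Coord n) := fun l' => (W.filter fun t' =>
    (run P rule s t').i + 2 ^ l' = (run P rule s t).i + 1).biUnion
      fun t' => widthSet P rule (run P rule s t') with hwd
  have h1 : updateRank P rule s t ≤
      ((Finset.range (l + 1)).biUnion fun l' => wd l' ∪ heavy P rule s t l').card := by
    refine updateRank_le fun e he => ?_
    have hsel : Selected P ((run P rule s t).i + 1) (run P rule s t)
        (run P rule s (t + 1)).r e := by
      by_contra h2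
      apply he
      rw [run_succ_of_isPrimal P rule s hp] at h2 ⊢
      rw [primalStep_rbar, if_neg h2]
    rcases hsel with h2 | ⟨l', hl', hd', hth, hlast⟩
    · exact absurd ((pow_dvd_pow 2 hl).trans h2) hd
    have hll : l' ≤ l := by
      by_contra h2
      exact hd ((pow_dvd_pow 2 (by omega)).trans hd')
    rw [Finset.mem_biUnion]
    refine ⟨l', Finset.mem_range.2 (by omega), Finset.mem_union.2 ?_⟩
    rcases h.selected_cases hs hv ht hp hd' hth hlast with ⟨j, h2, h3⟩ | h2 | h2
    · left
      obtain ⟨t', h4, h5, h6, h7⟩ := exists_of_lastWidth P rule s h2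
      rw [hwd, Finset.mem_biUnion]
      refine ⟨t', ?_, h7⟩
      rw [Finset.mem_filter, hW, Finset.mem_filter, Finset.mem_range]
      exact ⟨⟨by omega, h5⟩, by omega⟩
    · exfalso
      have h3 : (2 : ℝ) ^ l' ≤ 2 ^ l := pow_le_pow_right₀ one_le_two hll
      have h4 := mul_le_mul_of_nonneg_left h3
        (by positivity : 0 ≤ 1600 * (1 + Real.log n) * P.α)
      linarith
    · right
      exact Finset.mem_filter.2 ⟨Finset.mem_univ e, h2⟩
  have h2 : ((((Finset.range (l + 1)).biUnion fun l' => wd l' ∪ heavy P rule s t l').card : ℕ) : ℝ)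
      ≤ ∑ l' ∈ Finset.range (l + 1), ((∑ t' ∈ W,
        if (run P rule s t').i + 2 ^ l' = (run P rule s t).i + 1 then
          ((widthSet P rule (run P rule s t')).card : ℝ) else 0) + (2 ^ l') ^ 2 * c) := by
    have h3 : (((Finset.range (l + 1)).biUnion fun l' => wd l' ∪ heavy P rule s t l').card : ℝ) ≤
        ∑ l' ∈ Finset.range (l + 1), (((wd l' ∪ heavy P rule s t l').card : ℕ) : ℝ) := by
      exact_mod_cast Finset.card_biUnion_le
    refine h3.trans (Finset.sum_le_sum fun l' _ => ?_)
    have h4 : (((wd l' ∪ heavy P rule s t l').card : ℕ) : ℝ) ≤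
        (wd l').card + (heavy P rule s t l').card := by exact_mod_cast Finset.card_union_le _ _
    refine h4.trans (add_le_add ?_ (h.card_heavy_le ht))
    rw [← Finset.sum_filter]
    exact_mod_cast Finset.card_biUnion_le
  have h3 : ∑ l' ∈ Finset.range (l + 1), ((2 : ℝ) ^ l') ^ 2 ≤ 2 * 2 ^ (2 * l) := by
    have h4 : ∀ k : ℕ, ∑ l' ∈ Finset.range (k + 1), ((2 : ℝ) ^ l') ^ 2 ≤ 2 * 2 ^ (2 * k) := by
      intro k
      induction k with
      | zero => norm_num
      | succ k ih =>
        rw [Finset.sum_range_succ]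
        have e1 : ((2 : ℝ) ^ (k + 1)) ^ 2 = 4 * 2 ^ (2 * k) := by rw [← pow_mul]; ring
        have e2 : (2 : ℝ) ^ (2 * (k + 1)) = 4 * 2 ^ (2 * k) := by ring
        rw [e1, e2]
        have : (0 : ℝ) < 2 ^ (2 * k) := by positivity
        linarith
    exact h4 l
  rw [Finset.sum_add_distrib, ← Finset.sum_mul] at h2
  have h4 := mul_le_mul_of_nonneg_right h3 hc0
  rw [load, if_pos hp]
  have h5 : (updateRank P rule s t : ℝ) ≤ _ := (Nat.cast_le.2 h1).trans h2
  linarith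

open Classical in
/-- Updates of large rank are rare. -/
theorem Tame.card_updateRank_le (h : Tame P rule s xbar Kmax N)
    (hs : SmallNoise P rule s N v xbar)
    (hv : P.ε * P.α * v ≤ P.ε / (25600 * (1 + Real.log n)))
    (hfin : ∀ t < N, (run P rule s t).i < P.T) {E : ℝ} (hE0 : 8 ≤ E)
    (hE1 : 2 * 10 ^ 8 * ((1 + Real.log n) ^ 2 * n * P.α ^ 2 / P.ε) ≤ E)
    (hE2 : 8 * (1 + Real.log n) *
      (128032 * P.C₃ * (1 + Real.log n) ^ 4 * √(n / P.ε) / P.ε ^ 2) ≤ P.T * √(E / 2)) (l : ℕ) :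
    (((Finset.range N).filter fun t => E * 2 ^ (2 * l) ≤ (updateRank P rule s t : ℝ)).card : ℝ) ≤
      P.T / 2 ^ l := by
  have hε := h.nums.hε0
  have hε2 := h.nums.hε
  have hα := h.nums.hα0
  have hL := h.nums.one_le_L
  have hn0 := h.nums.n_pos
  obtain ⟨hlg1, hlg2, hD, -⟩ := logb_facts h.nums
  have hV := h.sum_sqrt_card_le hs hv
  set L := 1 + Real.log n with hLdef
  set V := 128032 * P.C₃ * L ^ 4 * √(n / P.ε) / P.ε ^ 2 with hVdef
  have h4l : (2 : ℝ) ^ (2 * l) = (2 ^ l) ^ 2 := by rw [← pow_mul, mul_comm]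
  have hempty : 2 * n < E * 2 ^ (2 * l) →
      (((Finset.range N).filter fun t => E * 2 ^ (2 * l) ≤ (updateRank P rule s t : ℝ)).card : ℝ) ≤
      P.T / 2 ^ l := by
    intro h1
    rw [Finset.filter_eq_empty_iff.2, Finset.card_empty, Nat.cast_zero]
    · positivity
    · intro t _ h2
      have h3 : (updateRank P rule s t : ℝ) ≤ (2 * n : ℕ) := Nat.cast_le.2 (updateRank_le_card t)
      push_cast at h3
      linarith
  by_cases hl : l < Nat.log 2 n
  swap
  · apply hempty
    have h1 : (n : ℝ) ≤ 2 * 2 ^ l := by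
      have h2 := (Nat.lt_pow_succ_log_self one_lt_two n).le
      have h3 : 2 ^ (Nat.log 2 n + 1) ≤ 2 ^ (l + 1) := Nat.pow_le_pow_right (by norm_num) (by omega)
      have h4 : (n : ℝ) ≤ 2 ^ (l + 1) := by exact_mod_cast h2.trans h3
      rw [pow_succ] at h4
      linarith
    rw [h4l]
    have h2 := h.nums.two_le_n
    have h3 : (1 : ℝ) ≤ 2 ^ l := one_le_pow₀ one_le_two
    have h4 : (2 : ℝ) ^ l * 1 ≤ 2 ^ l * 2 ^ l := mul_le_mul_of_nonneg_left h3 (by positivity)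
    have h5 : 8 * ((2 : ℝ) ^ l) ^ 2 ≤ E * (2 ^ l) ^ 2 := by gcongr
    nlinarith
  by_cases hsmall : 1600 * L * P.α * 2 ^ l < 1
  swap
  · apply hempty
    push Not at hsmall
    have h1 := pow_le_pow_left₀ zero_le_one hsmall 2
    have h2 : 2 * 10 ^ 8 * (L ^ 2 * n * P.α ^ 2 / P.ε) * 2 ^ (2 * l) ≤ E * 2 ^ (2 * l) := by gcongr
    refine lt_of_lt_of_le ?_ h2
    have h3 : 2 * 10 ^ 8 * (L ^ 2 * n * P.α ^ 2 / P.ε) * 2 ^ (2 * l) =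
        (1600 * L * P.α * 2 ^ l) ^ 2 * (2 * 10 ^ 8 / 1600 ^ 2 * (n / P.ε)) := by
      rw [h4l]; ring
    rw [h3]
    have h4 : (n : ℝ) ≤ n / P.ε := by
      rw [le_div_iff₀ hε]
      nlinarith
    have h5 : 1 ^ 2 * (2 * 10 ^ 8 / 1600 ^ 2 * (n / P.ε)) ≤
        (1600 * L * P.α * 2 ^ l) ^ 2 * (2 * 10 ^ 8 / 1600 ^ 2 * (n / P.ε)) := by gcongr
    linarith
  set R := E * 2 ^ (2 * l) with hR
  have hR0 : 0 < R := by positivity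
  set B := (Finset.range N).filter fun t => R / 2 ≤ load P rule s N l t with hB
  set Q := (Finset.range N).filter fun t =>
    IsPrimal P (run P rule s t) ∧ 2 ^ (l + 1) ∣ (run P rule s t).i + 1 with hQ
  have hsub : ((Finset.range N).filter fun t => R ≤ (updateRank P rule s t : ℝ)) ⊆ Q ∪ B := by
    intro t ht
    rw [Finset.mem_filter] at ht
    have htN := Finset.mem_range.1 ht.1
    rw [Finset.mem_union, hQ, hB, Finset.mem_filter, Finset.mem_filter]
    by_cases hp : IsPrimal P (run P rule s t)
    · by_cases hd : 2 ^ (l + 1) ∣ (run P rule s t).i + 1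
      · exact Or.inl ⟨ht.1, hp, hd⟩
      · right
        refine ⟨ht.1, ?_⟩
        have h1 := h.updateRank_le_load hs hv htN hl hsmall hp hd
        have h2 : 2 * 2 ^ (2 * l) * (4 * 1600 ^ 2 * L ^ 2 * n * P.α ^ 2 / P.ε) ≤ R / 2 := by
          have e1 : 2 * 2 ^ (2 * l) * (4 * 1600 ^ 2 * L ^ 2 * n * P.α ^ 2 / P.ε) =
            8 * 1600 ^ 2 * (L ^ 2 * n * P.α ^ 2 / P.ε) * 2 ^ (2 * l) := by ring
          have e2 : R / 2 = E / 2 * 2 ^ (2 * l) := by rw [hR]; ring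
          rw [e1, e2]
          refine mul_le_mul_of_nonneg_right ?_ (by positivity)
          have : 0 ≤ L ^ 2 * n * P.α ^ 2 / P.ε := by positivity
          linarith
        have h3 := ht.2
        linarith
    · right
      refine ⟨ht.1, ?_⟩
      have hw : IsWidth P (run P rule s t) := ⟨hfin t htN, fun h5 => hp ⟨hfin t htN, h5⟩⟩
      have h1 : (updateRank P rule s t : ℝ) ≤ (widthSet P rule (run P rule s t)).card :=
        Nat.cast_le.2 (updateRank_le_of_isWidth hw)
      rw [load, if_neg hp]
      linarith [ht.2]
  have hQcard : (Q.card : ℝ) ≤ P.T / 2 ^ (l + 1) := by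
    have h5 := card_dvd_le P rule s (S := Q) (q := 2 ^ (l + 1))
      (fun t ht => (Finset.mem_filter.1 ht).2.1) (fun t ht => (Finset.mem_filter.1 ht).2.2)
    refine (Nat.cast_le.2 h5).trans (Nat.cast_div_le.trans (le_of_eq ?_))
    push_cast
    rfl
  have hBcard : (B.card : ℝ) * (√(E / 2) * 2 ^ l) ≤ P.T * √(E / 2) / 2 := by
    have h1 : √(R / 2) = √(E / 2) * 2 ^ l := by
      rw [hR, h4l, mul_div_right_comm, Real.sqrt_mul (by positivity), Real.sqrt_sq (by positivity)]
    calc (B.card : ℝ) * (√(E / 2) * 2 ^ l) = ∑ t ∈ B, √(R / 2) := by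
          rw [Finset.sum_const, nsmul_eq_mul, h1]
      _ ≤ ∑ t ∈ B, √(load P rule s N l t) :=
          Finset.sum_le_sum fun t ht => Real.sqrt_le_sqrt (Finset.mem_filter.1 ht).2
      _ ≤ ∑ t ∈ Finset.range N, √(load P rule s N l t) :=
          Finset.sum_le_sum_of_subset_of_nonneg (Finset.filter_subset _ _)
            fun _ _ _ => Real.sqrt_nonneg _
      _ ≤ (l + 2) * V := (sum_sqrt_load_le hfin l).trans
          (mul_le_mul_of_nonneg_left hV (by positivity))
      _ ≤ (4 * L) * V := by
          have hC := h.nums.hC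
          refine mul_le_mul_of_nonneg_right ?_ (by positivity)
          have : (l : ℝ) + 1 ≤ Nat.log 2 n := by exact_mod_cast hl
          linarith
      _ ≤ _ := by linarith
  have hBcard' : (B.card : ℝ) ≤ P.T / 2 ^ (l + 1) := by
    have hE : 0 < √(E / 2) := Real.sqrt_pos.2 (by linarith)
    rw [le_div_iff₀ (by positivity)]
    have h1 : (B.card * 2 ^ (l + 1)) * √(E / 2) ≤ P.T * √(E / 2) := by
      rw [pow_succ]
      linarith
    exact le_of_mul_le_mul_right h1 hE
  calc _ ≤ ((Q ∪ B).card : ℝ) := Nat.cast_le.2 (Finset.card_le_card hsub)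
    _ ≤ Q.card + B.card := by exact_mod_cast Finset.card_union_le Q B
    _ ≤ P.T / 2 ^ (l + 1) + P.T / 2 ^ (l + 1) := add_le_add hQcard hBcard'
    _ = P.T / 2 ^ l := by
        rw [pow_succ]
        field_simp
        norm_num

end Rank

/-- The polylogarithmic factor by which the parameters are separated. -/
noncomputable def lam (C₃ : ℝ) (n : ℕ) : ℝ := 200 * C₃ * (1 + Real.log n) ^ 2

/-- The parameters in terms of `x = n ^ (1 / 2 - η)`. -/
structure Scaling (P : Params n m) (x : ℝ) : Prop where
  hn : 2 ≤ n
  hε0 : 0 < P.ε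
  hε : P.ε < 1 / 2
  hδ : P.δ = P.ε / 100
  hC : 2 ≤ P.C₃
  one_le_x : 1 ≤ x
  sq_le : (n : ℝ) ^ 2 ≤ x ^ 5
  α_eq : P.α = P.ε / (2000 * P.C₃ * lam P.C₃ n * x)
  ρ_eq : P.ρ = lam P.C₃ n ^ 3 * (x ^ 3 / n) / P.ε ^ 2
  τ_eq : P.τ = lam P.C₃ n ^ 6 * x / (8 * P.C₃ ^ 2 * P.ε ^ 4)
  le_T : P.α⁻¹ * (1 / P.ε ^ 2) * Real.log n ≤ P.T
  T_lt : P.T < P.α⁻¹ * (1 / P.ε ^ 2) * Real.log n + 1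

/-- The bound for the errors of the sketched residuals. -/
noncomputable def noiseBound (P : Params n m) : ℝ :=
  √(P.ε / (12800 * (1 + Real.log n) ^ 2 * P.α))

/-- The bound for the number of width reduction steps. -/
noncomputable def widthBound (P : Params n m) (x : ℝ) : ℝ :=
  65000 * P.C₃ * (1 + Real.log n) ^ 4 * lam P.C₃ n * x / P.ε ^ 3

namespace Scaling

variable {P : Params n m} {x : ℝ}

theorem one_le_L (h : Scaling P x) : 1 ≤ 1 + Real.log n := by
  have h1 : (1 : ℝ) ≤ n := by exact_mod_cast (by have := h.hn; omega : 1 ≤ n)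
  linarith [Real.log_nonneg h1]

theorem n_pos (h : Scaling P x) : (0 : ℝ) < n := by
  exact_mod_cast (by have := h.hn; omega : 0 < n)

theorem le_lam (h : Scaling P x) : 400 ≤ lam P.C₃ n := by
  have h1 := h.one_le_L
  have h2 := h.hC
  unfold lam
  have h3 : 1 ≤ (1 + Real.log n) ^ 2 := one_le_pow₀ h1
  nlinarith

theorem α_pos (h : Scaling P x) : 0 < P.α := by
  rw [h.α_eq]
  have h1 := h.le_lam
  have h2 := h.hC
  have h3 := h.one_le_x
  have h4 := h.hε0
  have : 0 < lam P.C₃ n := by linarith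
  positivity

theorem α_le (h : Scaling P x) : P.α ≤ P.ε / 1000 := by
  rw [h.α_eq]
  have h1 := h.le_lam
  have h2 := h.hC
  have h3 := h.one_le_x
  refine div_le_div_of_nonneg_left h.hε0.le (by norm_num) ?_
  calc (1000 : ℝ) ≤ 2000 * 2 * 400 * 1 := by norm_num
    _ ≤ 2000 * P.C₃ * lam P.C₃ n * x := by gcongr

theorem le_cube (h : Scaling P x) : (n : ℝ) ≤ x ^ 3 := by
  have h1 := h.sq_le
  have h2 := h.one_le_x
  have h3 : x ^ 5 ≤ x ^ 6 := pow_le_pow_right₀ h2 (by norm_num)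
  have h4 : (n : ℝ) ^ 2 ≤ (x ^ 3) ^ 2 := by rw [← pow_mul]; exact h1.trans h3
  exact (pow_le_pow_iff_left₀ h.n_pos.le (by positivity) two_ne_zero).1 h4

theorem one_le_z (h : Scaling P x) : 1 ≤ x ^ 3 / n := by
  rw [le_div_iff₀ h.n_pos, one_mul]
  exact h.le_cube

theorem lam_cube_le_ρ (h : Scaling P x) : lam P.C₃ n ^ 3 * (x ^ 3 / n) * 4 ≤ P.ρ := by
  rw [h.ρ_eq]
  have h1 := h.le_lam
  have h2 := h.one_le_z
  have h4 := h.hε0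
  have h5 : P.ε ^ 2 ≤ 1 / 4 := by nlinarith [h.hε]
  rw [le_div_iff₀ (by positivity)]
  have h6 : 0 ≤ lam P.C₃ n ^ 3 * (x ^ 3 / n) := by
    have : 0 < lam P.C₃ n := by linarith
    positivity
  nlinarith

theorem le_ρ (h : Scaling P x) : 4 ≤ P.ρ := by
  refine le_trans ?_ h.lam_cube_le_ρ
  have h1 := h.le_lam
  have h2 := h.one_le_z
  have h3 : (1 : ℝ) ≤ lam P.C₃ n ^ 3 := one_le_pow₀ (by linarith)
  nlinarith [mul_le_mul h3 h2 zero_le_one (by linarith)]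

theorem x_le_z_sq (h : Scaling P x) : x ≤ (x ^ 3 / n) ^ 2 := by
  have h1 := h.sq_le
  have h2 := h.one_le_x
  rw [div_pow, le_div_iff₀ (by have := h.n_pos; positivity)]
  calc x * (n : ℝ) ^ 2 ≤ x * x ^ 5 := by gcongr
    _ = (x ^ 3) ^ 2 := by ring

theorem αT_le (h : Scaling P x) : P.α * P.T ≤ (1 + Real.log n) / P.ε ^ 2 := by
  have h1 := h.α_pos
  have h2 := h.hε0
  have h3 := mul_le_mul_of_nonneg_left h.T_lt.le h1.le
  have h4 : P.α * (P.α⁻¹ * (1 / P.ε ^ 2) * Real.log n + 1) = Real.log n / P.ε ^ 2 + P.α := by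
    field_simp
  have h5 : P.α ≤ 1 / P.ε ^ 2 := by
    have := h.α_le
    have := h.hε
    rw [le_div_iff₀ (by positivity)]
    nlinarith
  rw [h4] at h3
  rw [add_div]
  linarith

theorem noiseBound_sq (h : Scaling P x) :
    noiseBound P ^ 2 = P.ε / (12800 * (1 + Real.log n) ^ 2 * P.α) := by
  have h1 := h.α_pos
  have h2 := h.hε0
  have h3 := h.one_le_L
  exact Real.sq_sqrt (by positivity)

theorem noiseBound_le (h : Scaling P x) :
    noiseBound P ≤ P.C₃ * lam P.C₃ n * (x ^ 3 / n) := by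
  have h0 := h.α_pos
  have h1 := h.le_lam
  have h2 := h.hC
  have h3 := h.one_le_x
  have h4 := h.hε0
  have h5 := h.one_le_L
  have h6 := h.n_pos
  have hl : 0 < lam P.C₃ n := by linarith
  unfold noiseBound
  rw [Real.sqrt_le_left (by positivity), h.α_eq, mul_pow]
  have h7 : P.ε / (12800 * (1 + Real.log n) ^ 2 * (P.ε / (2000 * P.C₃ * lam P.C₃ n * x))) =
      (2000 / 12800) * P.C₃ * lam P.C₃ n * x / (1 + Real.log n) ^ 2 := by
    field_simp
  rw [h7, div_le_iff₀ (by positivity)]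
  calc 2000 / 12800 * P.C₃ * lam P.C₃ n * x ≤ 1 * P.C₃ * lam P.C₃ n * x := by gcongr; norm_num
    _ = (P.C₃ * lam P.C₃ n) * x * 1 := by ring
    _ ≤ (P.C₃ * lam P.C₃ n) ^ 2 * (x ^ 3 / n) ^ 2 * (1 + Real.log n) ^ 2 := by
        have e1 : P.C₃ * lam P.C₃ n ≤ (P.C₃ * lam P.C₃ n) ^ 2 := by
          have : 1 ≤ P.C₃ * lam P.C₃ n := by nlinarith
          nlinarith
        have e2 := h.x_le_z_sq
        have e3 : 1 ≤ (1 + Real.log n) ^ 2 := one_le_pow₀ h5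
        gcongr

theorem one_le_widthBound (h : Scaling P x) : 1 ≤ widthBound P x := by
  have h1 := h.le_lam
  have h2 := h.hC
  have h3 := h.one_le_x
  have h4 := h.hε0
  have h5 := h.one_le_L
  unfold widthBound
  rw [le_div_iff₀ (by positivity), one_mul]
  have e1 : P.ε ^ 3 ≤ 1 := pow_le_one₀ h4.le (by linarith [h.hε])
  have e2 : 1 ≤ (1 + Real.log n) ^ 4 := one_le_pow₀ h5
  calc P.ε ^ 3 ≤ 65000 * 2 * 1 * 400 * 1 := by linarith
    _ ≤ _ := by gcongr

theorem hτρ (h : Scaling P x) : 4 * P.C₃ ^ 2 * P.τ < P.ρ ^ 2 := by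
  have h1 := h.le_lam
  have h2 := h.hC
  have h3 := h.one_le_x
  have h4 := h.hε0
  have h6 := h.n_pos
  have hl : 0 < lam P.C₃ n := by linarith
  rw [h.τ_eq, h.ρ_eq]
  have e1 : 4 * P.C₃ ^ 2 * (lam P.C₃ n ^ 6 * x / (8 * P.C₃ ^ 2 * P.ε ^ 4)) =
      lam P.C₃ n ^ 6 / P.ε ^ 4 * (x / 2) := by
    field_simp
    norm_num
  have e2 : (lam P.C₃ n ^ 3 * (x ^ 3 / n) / P.ε ^ 2) ^ 2 =
      lam P.C₃ n ^ 6 / P.ε ^ 4 * (x ^ 3 / n) ^ 2 := by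
    rw [div_pow, mul_pow]
    ring
  rw [e1, e2]
  exact mul_lt_mul_of_pos_left (by linarith [h.x_le_z_sq]) (by positivity)

theorem hK (h : Scaling P x) :
    4 * P.ε / P.τ * (widthBound P x + 1) ≤ P.ε / (10 ^ 4 * (1 + Real.log n) ^ 2) := by
  have h1 := h.le_lam
  have h2 := h.hC
  have h3 := h.one_le_x
  have h4 := h.hε0
  have h5 := h.one_le_L
  have hl : 0 < lam P.C₃ n := by linarith
  have hW := h.one_le_widthBound
  have hτ : 0 < P.τ := by rw [h.τ_eq]; positivity
  calc 4 * P.ε / P.τ * (widthBound P x + 1) ≤ 4 * P.ε / P.τ * (2 * widthBound P x) := by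
        gcongr; linarith
    _ = P.ε * (4160000 * P.C₃ ^ 3 * (1 + Real.log n) ^ 4 * P.ε / lam P.C₃ n ^ 5) := by
        rw [h.τ_eq, widthBound]
        field_simp
        norm_num
    _ ≤ P.ε * (1 / (10 ^ 4 * (1 + Real.log n) ^ 2)) := by
        refine mul_le_mul_of_nonneg_left ?_ h4.le
        rw [div_le_div_iff₀ (by positivity) (by positivity), lam]
        set L := 1 + Real.log n
        have hε := h.hε
        calc 4160000 * P.C₃ ^ 3 * L ^ 4 * P.ε * (10 ^ 4 * L ^ 2) =
            41600000000 * (P.C₃ ^ 3 * L ^ 6 * P.ε) := by ring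
          _ ≤ 320000000000 * (P.C₃ ^ 5 * L ^ 10 * 1) := by
              have e1 : P.C₃ ^ 3 ≤ P.C₃ ^ 5 := pow_le_pow_right₀ (by linarith) (by norm_num)
              have e2 : L ^ 6 ≤ L ^ 10 := pow_le_pow_right₀ h5 (by norm_num)
              gcongr
              · norm_num
              · linarith
          _ = 1 * (200 * P.C₃ * L ^ 2) ^ 5 := by ring
    _ = P.ε / (10 ^ 4 * (1 + Real.log n) ^ 2) := by ring

theorem hKx (h : Scaling P x) :
    (16004 * P.C₃ * (1 + Real.log n) ^ 3 * P.ρ / P.ε ^ 2) ^ 3 *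
      (64 * n * (1 + Real.log n) ^ 2) < widthBound P x ^ 3 * (P.ρ ^ 2 * P.ε) := by
  have h1 := h.le_lam
  have h2 := h.hC
  have h3 := h.one_le_x
  have h4 := h.hε0
  have h5 := h.one_le_L
  have h6 := h.n_pos
  have hl : 0 < lam P.C₃ n := by linarith
  have hρ : 0 < P.ρ := by linarith [h.le_ρ]
  set L := 1 + Real.log n with hL
  have e1 : (16004 * P.C₃ * L ^ 3 * P.ρ / P.ε ^ 2) ^ 3 * (64 * n * L ^ 2) =
      (16004 ^ 3 * 64 * L ^ 11) * (P.C₃ ^ 3 * P.ρ ^ 2 / P.ε ^ 6 * (n * P.ρ)) := by ring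
  have e2 : (n : ℝ) * P.ρ = lam P.C₃ n ^ 3 * x ^ 3 / P.ε ^ 2 := by
    rw [h.ρ_eq]; field_simp
  have e3 : widthBound P x ^ 3 * (P.ρ ^ 2 * P.ε) = (65000 ^ 3 * L ^ 12) *
      (P.C₃ ^ 3 * P.ρ ^ 2 / P.ε ^ 6 * (lam P.C₃ n ^ 3 * x ^ 3 / P.ε ^ 2)) := by
    rw [widthBound, ← hL]
    field_simp
  rw [e1, e2, e3]
  refine mul_lt_mul_of_pos_right ?_ (by positivity)
  have e4 : L ^ 11 ≤ L ^ 12 := pow_le_pow_right₀ h5 (by norm_num)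
  have e5 : 0 < L ^ 11 := by positivity
  calc 16004 ^ 3 * 64 * L ^ 11 < 65000 ^ 3 * L ^ 11 := by
        refine mul_lt_mul_of_pos_right (by norm_num) e5
    _ ≤ _ := by gcongr

theorem hcube (h : Scaling P x) :
    P.α ^ 3 * (P.C₃ * P.ρ * (4 * n / P.ε)) ≤ (1 / 1000) ^ 3 := by
  have h1 := h.le_lam
  have h2 := h.hC
  have h3 := h.one_le_x
  have h4 := h.hε0
  have h6 := h.n_pos
  have hl : 0 < lam P.C₃ n := by linarith
  have e1 : P.α ^ 3 * (P.C₃ * P.ρ * (4 * n / P.ε)) = 4 / (2000 ^ 3 * P.C₃ ^ 2) := by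
    rw [h.α_eq, h.ρ_eq]
    field_simp
  rw [e1, div_le_iff₀ (by positivity)]
  nlinarith

theorem hκ (h : Scaling P x) : 2 / (n : ℝ) ≤ 2 * P.ε * P.α * P.C₃ * P.ρ := by
  have h1 := h.le_lam
  have h2 := h.hC
  have h3 := h.one_le_x
  have h4 := h.hε0
  have h6 := h.n_pos
  have hl : 0 < lam P.C₃ n := by linarith
  have e1 : 2 * P.ε * P.α * P.C₃ * P.ρ = (lam P.C₃ n ^ 2 * x ^ 2 / 1000) / n := by
    rw [h.α_eq, h.ρ_eq]
    field_simp
    norm_num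
  rw [e1]
  refine div_le_div_of_nonneg_right ?_ h6.le
  have e2 : 400 ^ 2 ≤ lam P.C₃ n ^ 2 := by gcongr
  have e3 : 1 ≤ x ^ 2 := one_le_pow₀ h3
  nlinarith

theorem logb_le (h : Scaling P x) : Real.logb 2 n ≤ 2 * (1 + Real.log n) := by
  have h3 := Real.log_two_gt_d9
  have h4 := h.one_le_L
  rw [Real.logb, div_le_iff₀ (by linarith)]
  nlinarith

theorem nums (h : Scaling P x) : Nums P (noiseBound P) (widthBound P x) where
  hn := h.hn
  hε0 := h.hε0
  hε := h.hε
  hδ := h.hδ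
  hC := h.hC
  hα0 := h.α_pos
  hα := h.α_le
  hτ0 := by
    rw [h.τ_eq]
    have := h.le_lam
    have := h.hC
    have := h.one_le_x
    have := h.hε0
    have : 0 < lam P.C₃ n := by linarith
    positivity
  hρ := by linarith [h.le_ρ]
  hx0 := Real.sqrt_nonneg _
  hx := by
    have h1 := h.noiseBound_sq
    have h2 := h.α_pos
    have h3 := h.α_le
    have h4 := h.one_le_L
    have h5 := h.hε0
    have h6 := h.hε
    refine abs_le_of_sq_le_sq' ?_ (by norm_num) |>.2
    rw [mul_pow, h1]
    have e1 : P.α ^ 2 * (P.ε / (12800 * (1 + Real.log n) ^ 2 * P.α)) =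
      P.α * P.ε / (12800 * (1 + Real.log n) ^ 2) := by field_simp
    rw [e1, div_le_iff₀ (by positivity)]
    have e2 : 1 ≤ (1 + Real.log n) ^ 2 := one_le_pow₀ h4
    nlinarith
  hx2 := by
    have h2 := h.α_pos
    have h4 := h.one_le_L
    rw [h.noiseBound_sq]
    refine le_of_eq ?_
    field_simp
  hcube := h.hcube
  hτρ := h.hτρ
  hwide := fun h1 => h.le_ρ.trans h1
  hlog := by
    have h1 := h.le_lam
    have h2 := h.n_pos
    have h4 := h.hε0
    have h5 := h.one_le_x
    have hρ : 0 < P.ρ := by linarith [h.le_ρ]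
    have hl : 1 ≤ lam P.C₃ n ^ 3 := one_le_pow₀ (by linarith)
    refine le_trans ?_ h.logb_le
    refine Real.logb_le_logb_of_le one_lt_two (by positivity) ?_
    rw [div_le_iff₀ (by positivity)]
    have e1 : 1 ≤ P.ε * P.ρ := by
      rw [h.ρ_eq]
      have e2 : P.ε * (lam P.C₃ n ^ 3 * (x ^ 3 / n) / P.ε ^ 2) =
        lam P.C₃ n ^ 3 * (x ^ 3 / n) / P.ε := by field_simp
      rw [e2, le_div_iff₀ h4]
      have := mul_le_mul hl h.one_le_z zero_le_one (by linarith)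
      linarith [h.hε]
    nlinarith
  hK0 := by linarith [h.one_le_widthBound]
  hK := h.hK
  hT := by
    have h1 := mul_le_mul_of_nonneg_left h.αT_le h.hε0.le
    have h4 := h.hε0
    have e1 : P.ε * ((1 + Real.log n) / P.ε ^ 2) = (1 + Real.log n) / P.ε := by field_simp
    linarith
  hT' := by
    have h4 := h.hε0
    have h2 := h.α_pos
    have h1 := mul_le_mul_of_nonneg_left h.le_T (by positivity : 0 ≤ P.ε * P.α)
    have e1 : P.ε * P.α * (P.α⁻¹ * (1 / P.ε ^ 2) * Real.log n) = Real.log n / P.ε := by field_simp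
    linarith
  hβ := by
    have h1 := h.noiseBound_le
    have h2 := h.lam_cube_le_ρ
    have h3 := h.one_le_z
    have h4 := h.hC
    have h5 := h.le_lam
    have h6 : lam P.C₃ n ≤ lam P.C₃ n ^ 3 := le_self_pow₀ (by linarith) (by norm_num)
    have h7 : P.C₃ * lam P.C₃ n * (x ^ 3 / n) ≤ P.C₃ * lam P.C₃ n ^ 3 * (x ^ 3 / n) := by gcongr
    have h8 : 2 * 400 * 1 ≤ P.C₃ * lam P.C₃ n * (x ^ 3 / n) := by gcongr
    have h9 := mul_le_mul_of_nonneg_left h2 (by linarith : 0 ≤ P.C₃)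
    linarith
  hκ := h.hκ
  hKx := h.hKx

end Scaling

theorem signProb_mono (P : Params n m) {E F : Signs P → Prop} (h : ∀ s, E s → F s) :
    signProb P E ≤ signProb P F := by
  classical
  unfold signProb
  refine div_le_div_of_nonneg_right (Nat.cast_le.2 (Finset.card_le_card fun s hs => ?_))
    (Nat.cast_nonneg _)
  simp only [Finset.mem_filter, Finset.mem_univ, true_and] at hs ⊢
  exact h s hs

/-- The number of iterations up to which a run is followed. -/
noncomputable def horizon (P : Params n m) (x : ℝ) : ℕ := P.T + ⌈widthBound P x⌉₊ + 1

/-- The bound for the accumulated sketching errors. -/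
noncomputable def sumNoiseBound (P : Params n m) : ℝ := 1 / (25600 * (1 + Real.log n) * P.α)

/-- The constant in the failure probability. -/
noncomputable def logConst (C₃ : ℝ) : ℝ := Real.log (14000000 * C₃ ^ 2) + 14

/-- The square root of the polylogarithmic factor of the sketch size. -/
noncomputable def sketchFactor (C₃ : ℝ) (n : ℕ) : ℝ :=
  1000 * logConst C₃ * (1 + Real.log n) ^ 3

namespace Scaling

variable {P : Params n m} {x : ℝ}

theorem horizon_le (h : Scaling P x) :
    (horizon P x : ℝ) ≤ 14000000 * P.C₃ ^ 2 * (1 + Real.log n) ^ 6 * x / P.ε ^ 3 := by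
  have h1 := h.le_lam
  have h2 := h.hC
  have h3 := h.one_le_x
  have h4 := h.hε0
  have h5 := h.one_le_L
  have hl : 0 < lam P.C₃ n := by linarith
  have hc := (Nat.ceil_lt_add_one (by linarith [h.one_le_widthBound] : 0 ≤ widthBound P x)).le
  have hT := h.T_lt.le
  set L := 1 + Real.log n with hL
  have e0 : P.α⁻¹ * (1 / P.ε ^ 2) * Real.log n =
      2000 * (P.C₃ * lam P.C₃ n * x / P.ε ^ 3) * Real.log n := by
    rw [h.α_eq]
    field_simp
  set Z := P.C₃ * lam P.C₃ n * x / P.ε ^ 3 with hZ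
  have hZ1 : 800 ≤ Z := by
    rw [hZ, le_div_iff₀ (by positivity)]
    have e1 : P.ε ^ 3 ≤ 1 := pow_le_one₀ h4.le (by linarith [h.hε])
    calc 800 * P.ε ^ 3 ≤ 2 * 400 * 1 := by linarith
      _ ≤ P.C₃ * lam P.C₃ n * x := by gcongr
  have e2 : L ≤ L ^ 4 := le_self_pow₀ h5 (by norm_num)
  have e3 : 2000 * Z * Real.log n ≤ 2000 * Z * L ^ 4 := by
    refine mul_le_mul_of_nonneg_left ?_ (by linarith)
    linarith
  have e4 : Z * 1 ≤ Z * L ^ 4 := mul_le_mul_of_nonneg_left (by linarith) (by linarith)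
  have e5 : widthBound P x = 65000 * (Z * L ^ 4) := by rw [widthBound, ← hL, hZ]; ring
  have e6 : 14000000 * P.C₃ ^ 2 * L ^ 6 * x / P.ε ^ 3 = 70000 * (Z * L ^ 4) := by
    rw [hZ, lam, ← hL]; ring
  rw [e6]
  unfold horizon
  push_cast
  rw [e0] at hT
  linarith

theorem lt_horizon (P : Params n m) (x : ℝ) : P.T + widthBound P x < horizon P x := by
  unfold horizon
  push_cast
  linarith [Nat.le_ceil (widthBound P x)]

theorem log_horizon_le (h : Scaling P x) :
    Real.log (8 * n ^ 4 * horizon P x) ≤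
      logConst P.C₃ * (1 + Real.log n) * (1 + 1 / √(n / x) + 1 / P.ε) := by
  have h2 := h.hC
  have h3 := h.one_le_x
  have h4 := h.hε0
  have h5 := h.one_le_L
  have h6 := h.n_pos
  have hx : 0 < x := by linarith
  have hN : (0 : ℝ) < horizon P x := by
    have := lt_horizon P x
    have := h.one_le_widthBound
    have : (0 : ℝ) ≤ P.T := Nat.cast_nonneg _
    linarith
  set L := 1 + Real.log n with hL
  have e1 := Real.log_le_log hN h.horizon_le
  rw [← hL] at e1
  have hL0 : 0 < L := by linarith
  rw [Real.log_div (by positivity) (by positivity), Real.log_mul (by positivity) hx.ne',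
    Real.log_mul (by positivity) (by positivity), Real.log_pow L, Real.log_pow P.ε] at e1
  rw [Real.log_mul (by positivity) hN.ne', Real.log_mul (by norm_num) (by positivity),
    Real.log_pow]
  have hy : 0 < n / x := by positivity
  have e2 : Real.log x = Real.log n - Real.log (n / x) := by
    rw [Real.log_div h6.ne' hx.ne']; ring
  have e3 : -Real.log (n / x) ≤ 2 * (1 / √(n / x)) := by
    have e4 := Real.log_le_sub_one_of_pos (by positivity : 0 < 1 / √(n / x))
    rw [Real.log_div one_ne_zero (by positivity), Real.log_one, Real.log_sqrt hy.le] at e4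
    linarith
  have e4 : -Real.log P.ε ≤ 1 / P.ε := by
    have e5 := Real.log_le_sub_one_of_pos (by positivity : 0 < 1 / P.ε)
    rw [Real.log_div one_ne_zero h4.ne', Real.log_one] at e5
    linarith
  have e5 : Real.log L ≤ L := (Real.log_le_sub_one_of_pos hL0).trans (by linarith)
  have e6 : Real.log 8 ≤ 3 := by
    rw [show (8 : ℝ) = 2 ^ 3 by norm_num, Real.log_pow]
    have := Real.log_two_lt_d9
    push_cast
    linarith
  have e7 : 0 ≤ Real.log (14000000 * P.C₃ ^ 2) := Real.log_nonneg (by nlinarith)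
  have hs : 0 ≤ 1 / √(n / x) := by positivity
  have hs' : 0 ≤ 1 / P.ε := by positivity
  unfold logConst
  set D := Real.log (14000000 * P.C₃ ^ 2)
  set u := 1 / √(n / x)
  set w := 1 / P.ε
  push_cast at e1 ⊢
  have e8 : Real.log 8 + 4 * Real.log n + Real.log (horizon P x) ≤ D + 14 * L + 2 * u + 3 * w := by
    linarith
  refine e8.trans ?_
  have f1 : D ≤ D * L := by nlinarith
  have f2 : 14 * (1 * u) ≤ (D + 14) * (L * u) := by gcongr; linarith
  have f3 : 14 * (1 * w) ≤ (D + 14) * (L * w) := by gcongr; linarith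
  nlinarith

theorem one_le_sketchFactor (h : Scaling P x) :
    14000 * (1 + Real.log n) ^ 3 ≤ sketchFactor P.C₃ n := by
  have h2 := h.hC
  have h5 := h.one_le_L
  have e7 : 0 ≤ Real.log (14000000 * P.C₃ ^ 2) := Real.log_nonneg (by nlinarith)
  unfold sketchFactor logConst
  gcongr
  linarith

theorem mul_sumNoiseBound (h : Scaling P x) :
    P.ε * P.α * sumNoiseBound P ≤ P.ε / (25600 * (1 + Real.log n)) := by
  have hα := h.α_pos
  have h5 := h.one_le_L
  unfold sumNoiseBound
  refine le_of_eq ?_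
  field_simp

theorem sumNoiseBound_ge (h : Scaling P x) (hb1 : 1 ≤ P.b)
    (hb : sketchFactor P.C₃ n ^ 2 * (n / x) ≤ P.b * P.ε ^ 2) :
    2 * Real.log (12 * n ^ 4) * (4 * n / (P.ε * P.b)) * P.T ≤ sumNoiseBound P ^ 2 := by
  have h1 := h.le_lam
  have h2 := h.hC
  have h3 := h.one_le_x
  have h4 := h.hε0
  have h5 := h.one_le_L
  have h6 := h.n_pos
  have hα := h.α_pos
  have hg := h.one_le_sketchFactor
  have hn1 : (1 : ℝ) ≤ n := by exact_mod_cast (by have := h.hn; omega : 1 ≤ n)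
  have hl : 0 < lam P.C₃ n := by linarith
  have hx : 0 < x := by linarith
  have hb0 : (0 : ℝ) < P.b := by exact_mod_cast hb1
  set L := 1 + Real.log n with hL
  set g := sketchFactor P.C₃ n with hgdef
  have hL3 : 1 ≤ L ^ 3 := one_le_pow₀ h5
  have hg1 : 1 ≤ g := by linarith
  have hn4 : (1 : ℝ) ≤ n ^ 4 := one_le_pow₀ hn1
  have ha₁le : Real.log (12 * n ^ 4) ≤ 4 * L := by
    rw [Real.log_mul (by norm_num) (by positivity), Real.log_pow]
    have e1 : Real.log 12 ≤ 3 := by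
      rw [Real.log_le_iff_le_exp (by norm_num)]
      have := Real.exp_one_gt_d9
      have e2 : Real.exp 3 = Real.exp 1 ^ 3 := by rw [← Real.exp_nat_mul]; norm_num
      rw [e2]
      calc (12 : ℝ) ≤ 2.7 ^ 3 := by norm_num
        _ ≤ _ := by gcongr; linarith
    push_cast
    linarith
  have e3 : 0 ≤ Real.log (12 * n ^ 4) := Real.log_nonneg (by linarith)
  set a₁ := Real.log (12 * n ^ 4) with ha₁
  set y := (n : ℝ) / x with hy
  have hy0 : 0 < y := by positivity
  unfold sumNoiseBound
  rw [div_pow, one_pow, le_div_iff₀ (by positivity)]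
  have e1 : 2 * a₁ * (4 * n / (P.ε * P.b)) * P.T * (25600 * L * P.α) ^ 2 =
      8 * 25600 ^ 2 * a₁ * L ^ 2 * (n * P.α / (P.ε * P.b)) * (P.α * P.T) := by ring
  have e2 : n * P.α / (P.ε * P.b) = y / (2000 * P.C₃ * lam P.C₃ n * P.b) := by
    rw [h.α_eq, hy]
    field_simp
  rw [e1, e2]
  calc _ ≤ 8 * 25600 ^ 2 * (4 * L) * L ^ 2 * (y / (2000 * 2 * 400 * P.b)) *
        (L / P.ε ^ 2) := by
        have := h.αT_le
        gcongr
    _ = (8 * 25600 ^ 2 * 4 / 1600000 * L ^ 4) * (y / (P.b * P.ε ^ 2)) := by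
        field_simp
        norm_num
    _ ≤ (8 * 25600 ^ 2 * 4 / 1600000 * L ^ 4) * (1 / g ^ 2) := by
        refine mul_le_mul_of_nonneg_left ?_ (by positivity)
        rw [div_le_div_iff₀ (by positivity) (by positivity)]
        linarith
    _ ≤ 1 := by
        rw [mul_one_div, div_le_one (by positivity)]
        have f1 : (14000 * L ^ 3) ^ 2 ≤ g ^ 2 := by gcongr
        have f2 : L ^ 4 ≤ L ^ 6 := pow_le_pow_right₀ h5 (by norm_num)
        have f3 : (14000 * L ^ 3) ^ 2 = 196000000 * L ^ 6 := by ring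
        have f4 : 0 < L ^ 4 := by positivity
        rw [f3] at f1
        linarith

theorem noiseBound_ge (h : Scaling P x) (hb1 : 1 ≤ P.b)
    (hb : sketchFactor P.C₃ n ^ 2 * (n / x) ≤ P.b * P.ε ^ 2) :
    2 * Real.log (8 * n ^ 4 * horizon P x) * (4 * n / (P.ε * P.b)) ≤ noiseBound P ^ 2 := by
  have h1 := h.le_lam
  have h2 := h.hC
  have h3 := h.one_le_x
  have h4 := h.hε0
  have hε2 := h.hε
  have h5 := h.one_le_L
  have h6 := h.n_pos
  have hg := h.one_le_sketchFactor
  have ha₂ := h.log_horizon_le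
  have hl : 0 < lam P.C₃ n := by linarith
  have hx : 0 < x := by linarith
  have hb0 : (0 : ℝ) < P.b := by exact_mod_cast hb1
  have hb1' : (1 : ℝ) ≤ P.b := by exact_mod_cast hb1
  have hD : 0 < logConst P.C₃ := by
    have e7 : 0 ≤ Real.log (14000000 * P.C₃ ^ 2) := Real.log_nonneg (by nlinarith)
    unfold logConst
    linarith
  have e1 : P.ε / (12800 * (1 + Real.log n) ^ 2 * P.α) = 125 / 4 * P.C₃ ^ 2 * x := by
    rw [h.α_eq, lam]
    field_simp
    norm_num
  rw [h.noiseBound_sq, e1]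
  have f1 : 1000 * (logConst P.C₃ * (1 + Real.log n)) ≤ sketchFactor P.C₃ n := by
    rw [sketchFactor, mul_assoc]
    have f2 : 1 + Real.log n ≤ (1 + Real.log n) ^ 3 := le_self_pow₀ h5 (by norm_num)
    gcongr
  set L := 1 + Real.log n with hL
  set g := sketchFactor P.C₃ n with hgdef
  have hL3 : 1 ≤ L ^ 3 := one_le_pow₀ h5
  have hg1 : 1 ≤ g := by linarith
  set y := (n : ℝ) / x with hy
  have hy0 : 0 < y := by positivity
  set a₂ := Real.log (8 * n ^ 4 * horizon P x)
  have e2 : (n : ℝ) = y * x := by rw [hy]; field_simp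
  have s1 : √y ≤ P.ε * P.b / g := by
    rw [Real.sqrt_le_left (by positivity), div_pow, le_div_iff₀ (by positivity)]
    calc y * g ^ 2 ≤ P.ε ^ 2 * P.b := by linarith
      _ ≤ P.ε ^ 2 * (P.b * P.b) :=
          mul_le_mul_of_nonneg_left (le_mul_of_one_le_left hb0.le hb1') (by positivity)
      _ = (P.ε * P.b) ^ 2 := by ring
  have s2 : y / P.ε ≤ P.ε * P.b / g := by
    rw [div_le_div_iff₀ h4 (by positivity)]
    calc y * g ≤ y * g ^ 2 :=
          mul_le_mul_of_nonneg_left (le_self_pow₀ hg1 two_ne_zero) hy0.le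
      _ ≤ P.ε * P.b * P.ε := by linarith
  have s3 : y ≤ P.ε * P.b / g := by
    refine le_trans ?_ s2
    rw [le_div_iff₀ h4]
    exact mul_le_of_le_one_right hy0.le (by linarith)
  have s4 : a₂ * y ≤ logConst P.C₃ * L * (3 * (P.ε * P.b / g)) := by
    calc a₂ * y ≤ logConst P.C₃ * L * (1 + 1 / √y + 1 / P.ε) * y :=
          mul_le_mul_of_nonneg_right ha₂ hy0.le
      _ = logConst P.C₃ * L * (y + y / √y + y / P.ε) := by ring
      _ ≤ logConst P.C₃ * L * (3 * (P.ε * P.b / g)) := by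
          rw [Real.div_sqrt]
          refine mul_le_mul_of_nonneg_left (by linarith) (by positivity)
  calc 2 * a₂ * (4 * n / (P.ε * P.b)) = 8 * x * (a₂ * y) / (P.ε * P.b) := by
        rw [e2]; ring
    _ ≤ 8 * x * (logConst P.C₃ * L * (3 * (P.ε * P.b / g))) / (P.ε * P.b) := by gcongr
    _ = x * (24 * (logConst P.C₃ * L) / g) := by field_simp; norm_num
    _ ≤ x * (125 / 4 * P.C₃ ^ 2) := by
        refine mul_le_mul_of_nonneg_left ?_ hx.le
        refine le_trans (b := 1) ?_ ?_
        · rw [div_le_one (by linarith)]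
          have : 0 < logConst P.C₃ * L := by positivity
          linarith
        · have : 1 ≤ P.C₃ ^ 2 := one_le_pow₀ (by linarith)
          linarith
    _ = 125 / 4 * P.C₃ ^ 2 * x := by ring

theorem prob_smallNoise (h : Scaling P x) (rule : Rule n m) (hb1 : 1 ≤ P.b)
    (hb : sketchFactor P.C₃ n ^ 2 * (n / x) / P.ε ^ 2 ≤ P.b) :
    1 - 1 / (n : ℝ) ^ 3 ≤ signProb P
      (fun s => SmallNoise P rule s (horizon P x) (sumNoiseBound P) (noiseBound P)) := by
  have h4 := h.hε0
  have h5 := h.one_le_L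
  have h6 := h.n_pos
  have hα := h.α_pos
  have hn2 := h.nums.two_le_n
  rw [div_le_iff₀ (by positivity)] at hb
  have hN0 : (1 : ℝ) ≤ horizon P x := by
    have := lt_horizon P x
    have := h.one_le_widthBound
    have : (0 : ℝ) ≤ P.T := Nat.cast_nonneg _
    linarith
  have hn4 : (1 : ℝ) ≤ n ^ 4 := one_le_pow₀ (by linarith)
  have ha₂pos : 0 < Real.log (8 * n ^ 4 * horizon P x) := Real.log_pos (by nlinarith)
  have hx0 : 0 < noiseBound P := Real.sqrt_pos.2 (by positivity)
  have hv0 : 0 < sumNoiseBound P := by unfold sumNoiseBound; positivity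
  refine le_trans ?_ (smallNoise_prob P rule (by have := h.hn; omega) hb1 h4 (T_pos h.nums) hv0 hx0
    ha₂pos (h.sumNoiseBound_ge hb1 hb) (h.noiseBound_ge hb1 hb))
  rw [Real.exp_neg, Real.exp_neg, Real.exp_log (by positivity),
    Real.exp_log (by positivity)]
  have e1 : 2 * (2 * (n : ℝ) + 1) * (12 * (n : ℝ) ^ 4)⁻¹ ≤ 1 / (2 * n ^ 3) := by
    rw [← div_eq_mul_inv, div_le_div_iff₀ (by positivity) (by positivity)]
    have : 0 < (n : ℝ) ^ 3 := by positivity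
    nlinarith
  have e2 : 4 * (n : ℝ) * horizon P x * (8 * (n : ℝ) ^ 4 * horizon P x)⁻¹ = 1 / (2 * n ^ 3) := by
    have : (horizon P x : ℝ) ≠ 0 := by linarith
    field_simp
    norm_num
  have e3 : 1 / (n : ℝ) ^ 3 = 1 / (2 * n ^ 3) + 1 / (2 * n ^ 3) := by
    field_simp
    norm_num
  rw [e2, e3]
  linarith

/-- The constant of the guarantees. -/
noncomputable def guaranteeConst (C₃ : ℝ) : ℝ := 2 * 10 ^ 8 + 14000000 * C₃ ^ 2

theorem two_mul_le_guaranteeConst (C₃ : ℝ) : 2 * 10 ^ 8 ≤ guaranteeConst C₃ := by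
  have : 0 ≤ C₃ ^ 2 := sq_nonneg _
  unfold guaranteeConst
  linarith

theorem card_large_le (h : Scaling P x) (hC : Function.Injective P.C.mulVec)
    (hd : IsLeast (Set.range fun x : Fin m → ℝ => ‖P.C.mulVec x - P.d‖) 1) {st : State n m}
    (hst : Near P st) :
    ((large P st).card : ℝ) ≤ guaranteeConst P.C₃ * (1 + Real.log n) ^ 8 * (n / x) := by
  have h1 := h.le_lam
  have h4 := h.hε0
  have h6 := h.n_pos
  have hz := h.one_le_z
  have hx : 0 < x := by linarith [h.one_le_x]
  have hρ0 : 0 < P.ρ := by linarith [h.le_ρ]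
  have hl3 : (1 : ℝ) ≤ lam P.C₃ n ^ 3 := one_le_pow₀ (by linarith)
  have hlz : x ^ 3 / n ≤ lam P.C₃ n ^ 3 * (x ^ 3 / n) := le_mul_of_one_le_left (by linarith) hl3
  have hρ : x ^ 3 / n ≤ P.ρ := by linarith [h.lam_cube_le_ρ]
  have hερ : x ^ 3 / n ≤ P.ε * P.ρ := by
    have e1 : P.ε * P.ρ = lam P.C₃ n ^ 3 * (x ^ 3 / n) / P.ε := by
      rw [h.ρ_eq]
      field_simp
    rw [e1, le_div_iff₀ h4]
    exact (mul_le_of_le_one_right (by linarith) (by linarith [h.hε])).trans hlz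
  have e1 := NonMonotoneMWU.card_large_le hC hd h.nums hst
  have e3 : (x ^ 3 / n) ^ 2 ≤ P.ε * P.ρ ^ 2 := by
    calc (x ^ 3 / n) ^ 2 = x ^ 3 / n * (x ^ 3 / n) := sq _
      _ ≤ P.ε * P.ρ * P.ρ := by gcongr
      _ = P.ε * P.ρ ^ 2 := by ring
  have e4 : ((large P st).card : ℝ) * x ≤ 16 * P.C₃ ^ 2 * n := by
    refine le_trans ?_ e1
    rw [mul_comm]
    exact mul_le_mul_of_nonneg_right (h.x_le_z_sq.trans e3) (Nat.cast_nonneg _)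
  have e5 : 16 * P.C₃ ^ 2 ≤ guaranteeConst P.C₃ := by
    have : 0 ≤ P.C₃ ^ 2 := sq_nonneg _
    unfold guaranteeConst
    linarith
  have e6 : 1 ≤ (1 + Real.log n) ^ 8 := one_le_pow₀ h.one_le_L
  calc ((large P st).card : ℝ) ≤ 16 * P.C₃ ^ 2 * n / x := (le_div_iff₀ hx).2 e4
    _ = 16 * P.C₃ ^ 2 * 1 * (n / x) := by ring
    _ ≤ _ := by gcongr; linarith [two_mul_le_guaranteeConst P.C₃]

theorem card_iterations_le (h : Scaling P x) {N : ℕ} (hN : N ≤ horizon P x) :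
    (N : ℝ) ≤ guaranteeConst P.C₃ * (1 + Real.log n) ^ 8 * x * (1 / P.ε ^ 4) := by
  have h4 := h.hε0
  have h5 := h.one_le_L
  have hx : 0 < x := by linarith [h.one_le_x]
  calc (N : ℝ) ≤ horizon P x := Nat.cast_le.2 hN
    _ ≤ 14000000 * P.C₃ ^ 2 * (1 + Real.log n) ^ 6 * x / P.ε ^ 3 := h.horizon_le
    _ = 14000000 * P.C₃ ^ 2 * (1 + Real.log n) ^ 6 * x * (1 / P.ε ^ 3) := by ring
    _ ≤ _ := by
        have e1 : 1 / P.ε ^ 3 ≤ 1 / P.ε ^ 4 := by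
          refine one_div_le_one_div_of_le (by positivity) ?_
          exact pow_le_pow_of_le_one h4.le (by linarith [h.hε]) (by norm_num)
        have e2 : 14000000 * P.C₃ ^ 2 ≤ guaranteeConst P.C₃ := by unfold guaranteeConst; linarith
        have e3 := two_mul_le_guaranteeConst P.C₃
        have e4 : 0 ≤ guaranteeConst P.C₃ := by linarith
        gcongr
        norm_num

theorem α_sq_mul_le (h : Scaling P x) {f : ℝ} (hf : 0 < f) (hfx : f ^ 2 ≤ x) (hf5 : f ^ 5 = n) :
    2 * 10 ^ 8 * ((1 + Real.log n) ^ 2 * n * P.α ^ 2 / P.ε) ≤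
      guaranteeConst P.C₃ * (1 + Real.log n) ^ 8 * f := by
  have h1 := h.le_lam
  have h2 := h.hC
  have h4 := h.hε0
  have h5 := h.one_le_L
  have hα := h.α_pos
  have hx : 0 < x := by linarith [h.one_le_x]
  have hL2 : (1 + Real.log n) ^ 2 ≤ (1 + Real.log n) ^ 8 := pow_le_pow_right₀ h5 (by norm_num)
  have e1 : P.α ^ 2 * n ≤ P.ε * f := by
    have e2 : P.α ≤ P.ε / x := by
      rw [h.α_eq]
      refine div_le_div_of_nonneg_left h4.le hx (le_mul_of_one_le_left hx.le ?_)
      nlinarith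
    have e3 : P.ε / x ≤ P.ε / f ^ 2 := div_le_div_of_nonneg_left h4.le (by positivity) hfx
    calc P.α ^ 2 * n ≤ (P.ε / f ^ 2) ^ 2 * f ^ 5 := by
          rw [hf5]
          gcongr
          exact e2.trans e3
      _ = P.ε * (P.ε * f) := by field_simp
      _ ≤ 1 * (P.ε * f) := by gcongr; linarith [h.hε]
      _ = P.ε * f := one_mul _
  calc 2 * 10 ^ 8 * ((1 + Real.log n) ^ 2 * n * P.α ^ 2 / P.ε) =
      2 * 10 ^ 8 * (1 + Real.log n) ^ 2 * (P.α ^ 2 * n / P.ε) := by ring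
    _ ≤ 2 * 10 ^ 8 * (1 + Real.log n) ^ 2 * f := by
        refine mul_le_mul_of_nonneg_left ?_ (by positivity)
        rw [div_le_iff₀ h4]
        linarith
    _ ≤ _ := by
        have := two_mul_le_guaranteeConst P.C₃
        gcongr

theorem T_mul_sqrt_ge (h : Scaling P x) {f : ℝ} (hf : 0 < f) (hfx : f ^ 2 ≤ x)
    (hf5 : f ^ 5 = n) :
    8 * (1 + Real.log n) *
      (128032 * P.C₃ * (1 + Real.log n) ^ 4 * √(n / P.ε) / P.ε ^ 2) ≤
      P.T * √(guaranteeConst P.C₃ * (1 + Real.log n) ^ 8 * f / 2) := by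
  have h1 := h.le_lam
  have h2 := h.hC
  have h4 := h.hε0
  have h5 := h.one_le_L
  have hA := two_mul_le_guaranteeConst P.C₃
  have hx : 0 < x := by linarith [h.one_le_x]
  have hl : 0 < lam P.C₃ n := by linarith
  have hTge : 600 * P.C₃ * x * (1 + Real.log n) / P.ε ^ 3 ≤ P.T := by
    refine le_trans ?_ h.le_T
    rw [h.α_eq]
    have e1 : (P.ε / (2000 * P.C₃ * lam P.C₃ n * x))⁻¹ * (1 / P.ε ^ 2) * Real.log n =
        2000 * P.C₃ * x * (lam P.C₃ n * Real.log n) / P.ε ^ 3 := by field_simp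
    rw [e1]
    have e2 : 1 + Real.log n ≤ lam P.C₃ n * Real.log n := by
      have e3 := Real.log_le_log two_pos h.nums.two_le_n
      have e4 := Real.log_two_gt_d9
      have e5 : 400 * Real.log n ≤ lam P.C₃ n * Real.log n :=
        mul_le_mul_of_nonneg_right h1 (by linarith)
      linarith
    gcongr
    norm_num
  set L := 1 + Real.log n with hL
  set A := guaranteeConst P.C₃
  have hsE : 10 ^ 4 * L ^ 4 * √f ≤ √(A * L ^ 8 * f / 2) := by
    rw [show A * L ^ 8 * f / 2 = A / 2 * (L ^ 4) ^ 2 * f by ring,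
      Real.sqrt_mul (by positivity), Real.sqrt_mul (by positivity),
      Real.sqrt_sq (by positivity)]
    have e1 : 10 ^ 4 ≤ √(A / 2) := Real.le_sqrt_of_sq_le (by linarith)
    gcongr
  have hsn : √(n / P.ε) ≤ x * √f / P.ε := by
    rw [Real.sqrt_le_left (by positivity), div_pow, mul_pow, Real.sq_sqrt hf.le]
    rw [div_le_div_iff₀ h4 (by positivity)]
    have e1 : (n : ℝ) ≤ x ^ 2 * f := by
      calc (n : ℝ) = (f ^ 2) ^ 2 * f := by rw [← hf5]; ring
        _ ≤ x ^ 2 * f := by gcongr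
    have e2 : P.ε ^ 2 ≤ P.ε := by nlinarith [h.hε]
    exact mul_le_mul e1 e2 (by positivity) (by positivity)
  calc 8 * L * (128032 * P.C₃ * L ^ 4 * √(n / P.ε) / P.ε ^ 2) ≤
      8 * L * (128032 * P.C₃ * L ^ 4 * (x * √f / P.ε) / P.ε ^ 2) := by gcongr
    _ = 1024256 * (P.C₃ * x * L / P.ε ^ 3 * (L ^ 4 * √f)) := by field_simp; norm_num
    _ ≤ 6000000 * (P.C₃ * x * L / P.ε ^ 3 * (L ^ 4 * √f)) :=
        mul_le_mul_of_nonneg_right (by norm_num) (by positivity)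
    _ = 600 * P.C₃ * x * L / P.ε ^ 3 * (10 ^ 4 * L ^ 4 * √f) := by ring
    _ ≤ P.T * √(A * L ^ 8 * f / 2) := by gcongr

theorem guarantees {η : ℝ} (hη : η ≤ 1 / 10) (h : Scaling P ((n : ℝ) ^ ((1 / 2 : ℝ) - η)))
    (hC : Function.Injective P.C.mulVec)
    (hd : IsLeast (Set.range fun x : Fin m → ℝ => ‖P.C.mulVec x - P.d‖) 1) {rule : Rule n m}
    (hrule : rule.Valid P) {s : Signs P}
    (hs : SmallNoise P rule s (horizon P ((n : ℝ) ^ ((1 / 2 : ℝ) - η))) (sumNoiseBound P)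
      (noiseBound P)) :
    Guarantees P rule s η 6 (guaranteeConst P.C₃) 8 0 := by
  have h6 := h.n_pos
  have hN := h.nums
  have hn2 := hN.two_le_n
  have hfx : ((n : ℝ) ^ (1 / 5 : ℝ)) ^ 2 ≤ (n : ℝ) ^ ((1 / 2 : ℝ) - η) := by
    rw [← Real.rpow_natCast, ← Real.rpow_mul h6.le]
    exact Real.rpow_le_rpow_of_exponent_le (by linarith) (by push_cast; linarith)
  have hf5 : ((n : ℝ) ^ (1 / 5 : ℝ)) ^ 5 = n := by
    rw [← Real.rpow_natCast, ← Real.rpow_mul h6.le]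
    norm_num
  have hf1 : 1 ≤ (n : ℝ) ^ (1 / 5 : ℝ) := Real.one_le_rpow (by linarith) (by norm_num)
  have hyx : (n : ℝ) ^ ((1 / 2 : ℝ) + η) = n / (n : ℝ) ^ ((1 / 2 : ℝ) - η) := by
    rw [eq_div_iff (by positivity), ← Real.rpow_add h6]
    norm_num
  have hv := h.mul_sumNoiseBound
  unfold Guarantees
  rw [hyx]
  set x := (n : ℝ) ^ ((1 / 2 : ℝ) - η) with hxdef
  set f := (n : ℝ) ^ (1 / 5 : ℝ) with hfdef
  have hf0 : 0 < f := by linarith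
  have tame := fun t (ht : t ≤ horizon P x) =>
    tame_of_smallNoise hC hd hN hrule hv (hs.mono ht)
  have hk : ∀ t ≤ horizon P x, ((run P rule s t).k : ℝ) ≤ widthBound P x :=
    fun t ht => (tame t ht).k_le_Kmax (hs.mono ht) hv
  obtain ⟨K, hK1, hK2, hK3, hK4, hK5⟩ := exists_finish hk (lt_horizon P x)
  have htame := tame _ hK2
  have hs' := hs.mono hK2
  refine ⟨K, hK3, hK4, h.card_iterations_le hK2, htame.norm_le hs' hv hK3,
    fun t ht _ => h.card_large_le hC hd (htame.near t ht.le), fun l => ?_⟩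
  have hE : guaranteeConst P.C₃ * (1 + Real.log n) ^ 8 * (1 / P.ε ^ 0) * f =
      guaranteeConst P.C₃ * (1 + Real.log n) ^ 8 * f := by rw [pow_zero, div_one, mul_one]
  rw [hE]
  refine (htame.card_updateRank_le hs' hv hK5 ?_ (h.α_sq_mul_le hf0 hfx hf5)
    (h.T_mul_sqrt_ge hf0 hfx hf5) l).trans ?_
  · have e1 := two_mul_le_guaranteeConst P.C₃
    have e2 : 1 ≤ (1 + Real.log n) ^ 8 := one_le_pow₀ h.one_le_L
    calc (8 : ℝ) ≤ 2 * 10 ^ 8 * 1 * 1 := by norm_num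
      _ ≤ guaranteeConst P.C₃ * (1 + Real.log n) ^ 8 * f := by gcongr
  · refine div_le_div_of_nonneg_right ?_ (by positivity)
    push_cast
    linarith [(Nat.cast_nonneg K : (0 : ℝ) ≤ K)]

end Scaling

theorem isPolylogFactor_mul_pow {a : ℝ} (ha : 0 < a) (p : ℕ) :
    IsPolylogFactor fun n => a * (1 + Real.log n) ^ p := by
  refine ⟨max a a⁻¹, p, lt_max_of_lt_left ha, fun n hn => ?_⟩
  have h1 : (1 : ℝ) ≤ 1 + Real.log n := by
    linarith [Real.log_nonneg (by exact_mod_cast hn : (1 : ℝ) ≤ n)]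
  have h2 : 1 ≤ (1 + Real.log n) ^ p := one_le_pow₀ h1
  have h3 : (max a a⁻¹)⁻¹ ≤ a := inv_le_of_inv_le₀ ha (le_max_right _ _)
  constructor
  · calc (max a a⁻¹)⁻¹ / (1 + Real.log n) ^ p ≤ a / 1 := by gcongr
      _ = a * 1 := by ring
      _ ≤ a * (1 + Real.log n) ^ p := by gcongr
  · exact mul_le_mul_of_nonneg_right (le_max_left _ _) (by positivity)

theorem isPolylogFactor_div_pow {a : ℝ} (ha : 0 < a) (p : ℕ) :
    IsPolylogFactor fun n => a / (1 + Real.log n) ^ p := by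
  refine ⟨max a a⁻¹, p, lt_max_of_lt_left ha, fun n hn => ?_⟩
  have h1 : (1 : ℝ) ≤ 1 + Real.log n := by
    linarith [Real.log_nonneg (by exact_mod_cast hn : (1 : ℝ) ≤ n)]
  have h2 : 1 ≤ (1 + Real.log n) ^ p := one_le_pow₀ h1
  have h3 : (max a a⁻¹)⁻¹ ≤ a := inv_le_of_inv_le₀ ha (le_max_right _ _)
  constructor
  · exact div_le_div_of_nonneg_right h3 (by positivity)
  · calc a / (1 + Real.log n) ^ p ≤ a / 1 := by gcongr
      _ = a * 1 := by ring
      _ ≤ max a a⁻¹ * (1 + Real.log n) ^ p :=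
        mul_le_mul (le_max_left _ _) h2 zero_le_one (ha.le.trans (le_max_left _ _))

theorem scaling_params {C₃ η ε : ℝ} (hC₃ : 2 ≤ C₃) (hη : η ≤ 1 / 10) (hn : 2 ≤ n) (hε0 : 0 < ε)
    (hε : ε < 1 / 2) (C : Matrix (Fin n) (Fin m) ℝ) (d : Fin n → ℝ) {lα lτ lρ lb : ℕ → ℝ}
    (hα : lα n = 1 / (2000 * C₃ * lam C₃ n)) (hτ : lτ n = lam C₃ n ^ 6 / (8 * C₃ ^ 2))
    (hρ : lρ n = lam C₃ n ^ 3) :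
    Scaling (params C d ε η C₃ lα lτ lρ lb) ((n : ℝ) ^ ((1 / 2 : ℝ) - η)) := by
  have hn1 : (1 : ℝ) ≤ n := by exact_mod_cast (by omega : 1 ≤ n)
  have hn0 : (0 : ℝ) < n := by linarith
  have hx1 : 1 ≤ (n : ℝ) ^ ((1 / 2 : ℝ) - η) := Real.one_le_rpow hn1 (by linarith)
  have hxinv : (n : ℝ) ^ (-(1 / 2 : ℝ) + η) = ((n : ℝ) ^ ((1 / 2 : ℝ) - η))⁻¹ := by
    rw [← Real.rpow_neg hn0.le]
    congr 1
    ring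
  have hz : (n : ℝ) ^ ((1 / 2 : ℝ) - 3 * η) = ((n : ℝ) ^ ((1 / 2 : ℝ) - η)) ^ 3 / n := by
    rw [eq_div_iff hn0.ne', ← Real.rpow_natCast, ← Real.rpow_mul hn0.le]
    nth_rewrite 2 [← Real.rpow_one (n : ℝ)]
    rw [← Real.rpow_add hn0]
    congr 1
    push_cast
    ring
  have hsq : (n : ℝ) ^ 2 ≤ ((n : ℝ) ^ ((1 / 2 : ℝ) - η)) ^ 5 := by
    rw [← Real.rpow_natCast, ← Real.rpow_natCast, ← Real.rpow_mul hn0.le]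
    exact Real.rpow_le_rpow_of_exponent_le hn1 (by push_cast; linarith)
  have hL : (1 : ℝ) ≤ 1 + Real.log n := by linarith [Real.log_nonneg hn1]
  have hlam : 0 < lam C₃ n := by unfold lam; positivity
  refine ⟨hn, hε0, hε, rfl, hC₃, hx1, hsq, ?_, ?_, ?_, ?_, ?_⟩
  · simp only [params]
    rw [hα, hxinv]
    field_simp
  · simp only [params]
    rw [hρ, hz]
    ring
  · simp only [params]
    rw [hτ]
    field_simp
  · exact Nat.le_ceil _
  · refine Nat.ceil_lt_add_one ?_
    have : 0 < lα n := by rw [hα]; positivity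
    have := Real.log_nonneg hn1
    positivity

end NonMonotoneMWU

theorem mainTheorem3 (C₃ : ℝ) (hC₃ : 2 ≤ C₃) :
    ∃ (lα lτ lρ lb : ℕ → ℝ) (M A : ℝ) (p q : ℕ),
      NonMonotoneMWU.IsPolylogFactor lα ∧ NonMonotoneMWU.IsPolylogFactor lτ ∧
      NonMonotoneMWU.IsPolylogFactor lρ ∧ NonMonotoneMWU.IsPolylogFactor lb ∧
      ∀ (η : ℝ), η ≤ 1 / 10 →
      ∀ (n m : ℕ) (C : Matrix (Fin n) (Fin m) ℝ) (d : Fin n → ℝ) (ε : ℝ),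
        0 < ε → ε < 1 / 2 →
        Function.Injective C.mulVec →
        IsLeast (Set.range fun x : Fin m → ℝ => ‖C.mulVec x - d‖) 1 →
        ∀ rule : NonMonotoneMWU.Rule n m,
          rule.Valid (NonMonotoneMWU.params C d ε η C₃ lα lτ lρ lb) →
          1 - 1 / (n : ℝ) ^ 3 ≤
            NonMonotoneMWU.signProb (NonMonotoneMWU.params C d ε η C₃ lα lτ lρ lb)
              (fun s => NonMonotoneMWU.Guarantees
                (NonMonotoneMWU.params C d ε η C₃ lα lτ lρ lb) rule s η M A p q) := by
  open NonMonotoneMWU in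
  have hlog : 0 < logConst C₃ := by
    have h1 : 0 ≤ Real.log (14000000 * C₃ ^ 2) := Real.log_nonneg (by nlinarith)
    unfold logConst
    linarith
  refine ⟨fun n => 1 / (400000 * C₃ ^ 2) / (1 + Real.log n) ^ 2,
    fun n => 8000000000000 * C₃ ^ 4 * (1 + Real.log n) ^ 12,
    fun n => 8000000 * C₃ ^ 3 * (1 + Real.log n) ^ 6,
    fun n => 1000000 * logConst C₃ ^ 2 * (1 + Real.log n) ^ 6, 6, Scaling.guaranteeConst C₃, 8, 0,
    isPolylogFactor_div_pow (by positivity) 2, isPolylogFactor_mul_pow (by positivity) 12,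
    isPolylogFactor_mul_pow (by positivity) 6, isPolylogFactor_mul_pow (by positivity) 6, ?_⟩
  intro η hη n m C d ε hε0 hε hC hd rule hrule
  rcases lt_or_ge n 2 with hn | hn
  · refine le_trans ?_ (show (0 : ℝ) ≤ _ by unfold signProb; positivity)
    rcases (by omega : n = 0 ∨ n = 1) with rfl | rfl
    · obtain ⟨y, hy⟩ := hd.1
      have h0 : C.mulVec y - d = 0 := Subsingleton.elim _ _
      have h1 : ‖C.mulVec y - d‖ = 1 := hy
      rw [h0, norm_zero] at h1
      exact absurd h1 zero_ne_one
    · norm_num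
  have hn1 : (1 : ℝ) ≤ n := by exact_mod_cast (by omega : 1 ≤ n)
  have hL : (1 : ℝ) ≤ 1 + Real.log n := by linarith [Real.log_nonneg hn1]
  have hsc := scaling_params (lα := fun n => 1 / (400000 * C₃ ^ 2) / (1 + Real.log n) ^ 2)
    (lτ := fun n => 8000000000000 * C₃ ^ 4 * (1 + Real.log n) ^ 12)
    (lρ := fun n => 8000000 * C₃ ^ 3 * (1 + Real.log n) ^ 6)
    (lb := fun n => 1000000 * logConst C₃ ^ 2 * (1 + Real.log n) ^ 6) hC₃ hη hn hε0 hε C d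
    (by unfold lam; field_simp; norm_num) (by unfold lam; field_simp; norm_num)
    (by unfold lam; ring)
  have hyx : (n : ℝ) ^ ((1 / 2 : ℝ) + η) = n / (n : ℝ) ^ ((1 / 2 : ℝ) - η) := by
    rw [eq_div_iff (by positivity), ← Real.rpow_add (by linarith)]
    norm_num
  refine (hsc.prob_smallNoise rule ?_ ?_).trans
    (signProb_mono _ fun s hs => hsc.guarantees hη hC hd hrule hs)
  · refine Nat.ceil_pos.2 ?_
    positivity
  · refine le_trans (le_of_eq ?_) (Nat.le_ceil _)
    simp only [params, sketchFactor]
    rw [hyx]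
    ring
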